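/- Let $-\infty\le a<b\le\infty$, $n\in\mathbb N$. Let $J$ be a constant, invertible, skew-Hermitian $n\times n$ matrix, and let $q,w$ be $n\times n$ matrices of distributions of order $0$ on $(a,b)$, $q$ Hermitian and $w$ non-negative. Write $Q,W$ for antiderivatives of $q,w$ (functions of locally bounded variation) and $\Delta_q(x)=Q^+(x)-Q^-(x)$, $\Delta_w(x)=W^+(x)-W^-(x)$ for their jumps. Assume that $2J\pm\Delta_q(x)$ is invertible for all $x\in(a,b)$, and that $$\Lambda=\{\lambda\in\mathbb C:\ \det(2J+\lambda\Delta_w(x)-\Delta_q(x))=0\ \text{or}\ \det(2J-\lambda\Delta_w(x)+\Delta_q(x))=0\ \text{for some } x\in(a,b)\}$$ is a closed set that does not intersect $\mathbb R$ and contains only isolated points. A function $u:(a,b)\to\mathbb C^n$ of locally bounded variation is balanced if $u=\tfrac12(u^++u^-)$ everywhere; all solutions below are understood to be balanced. $L^2(w)$ is the Hilbert space of classes of functions $f$ with $\int f^*wf<\infty$. $T_{\max}\subset L^2(w)\times L^2(w)$ consists of the pairs of classes of functions $u,f$ with $\int u^*wu<\infty$, $\int f^*wf<\infty$, $u$ balanced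 of locally bounded variation, and $Ju'+qu=wf$. Let $T\subset T_{\max}$ be a self-adjoint linear relation and $\rho(T)$ its resolvent set, i.e. the set of $\lambda$ for which $T-\lambda$ is one-to-one and onto $L^2(w)$; let $R_\lambda=(T-\lambda)^{-1}$. Fix $x_0\in(a,b)$ where $Q$ and $W$ are continuous. For $\lambda\notin\Lambda$ let $U(\cdot,\lambda)$ be the matrix solution of $JU'+qU=\lambda wU$ with $U(x_0,\lambda)=1$. Let $N_0=\{u(x_0): Ju'+qu=0,\ wu=0\}\subset\mathbb C^n$ and let $P$ be the orthogonal projection onto $N_0^\perp$. For $f\in L^2(w)$ and $\lambda\in\rho(T)$ let $E_\lambda f$ be the unique representative $u$ of $R_\lambda f$ that satisfies $Ju'+qu=w(\lambda u+f)$ and $u(x_0)\in N_0^\perp$. For $\lambda\in\rho(T)\setminus\Lambda$ there are matrices $M_\pm(\lambda)$ with $$(E_\lambda f)(x)=\int U(x,\lambda)H(x,\cdot,\lambda)U(\cdot,\overline\lambda)^*wf\qquad (x\in(a,b))$$ for all compactly supported $f\in L^2(w)$, where $$H(x,y,\lambda)=M_-(\lambda)\chi^\#_{(a,x_0)}(y)+M_+(\lambda)\chi^\#_{(x_0,b)}(y)-\tfrac12J^{-1}\operatorname{sgn}(y-x)+S(x,\lambda)\chi_{\{x\}}(y),$$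 $S(x,\lambda)=\tfrac14U(x,\lambda)^{-1}(U^+(x,\lambda)-U^-(x,\lambda))J^{-1}$, and $\chi^\#$ denotes the characteristic function with the value $\tfrac12$ at $x_0$. Let $B_+$ and $B_-$ be the sets of the vectors $\int_{(x_0,b)}U(\cdot,\overline\lambda)^*wf$ and $\int_{(a,x_0)}U(\cdot,\overline\lambda)^*wf$, respectively, where $f$ runs through the compactly supported elements of $L^2(w)$. Then for every $\lambda\in\rho(T)\setminus\Lambda$ there is exactly one matrix $M(\lambda)$ with $M(\lambda)\zeta=PM_+(\lambda)\zeta$ for $\zeta\in B_+$, $M(\lambda)\zeta=PM_-(\lambda)\zeta$ for $\zeta\in B_-$, and $M(\lambda)\zeta=0$ for $\zeta\in N_0$. The function $M$ extends to all of $\rho(T)$, a set that contains $\mathbb C\setminus\mathbb R$, in such a way that 1. $M(\lambda)=M(\overline\lambda)^*$ for all $\lambda\in\rho(T)$; 2. $\dfrac{M(\lambda)-M(\lambda)^*}{2i\,\operatorname{Im}\lambda}\ge0$ whenever $\operatorname{Im}\lambda\neq0$; 3. $M$ is analytic on $\rho(T)$. In particular $M$ is a matrix-valued Herglotz–Nevanlinna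 function. -/

import Mathlib

open MeasureTheory Set Filter Topology TopologicalSpace
open scoped Distributions NNReal ENNReal ComplexOrder Matrix

namespace OrderZero

variable {Ω : Opens ℝ}

/-- Extension by zero of a compactly supported continuous function on `Ω`. -/
noncomputable def extendTest (φ : CompactlySupportedContinuousMap Ω ℝ≥0) : 𝓓^{0}(Ω, ℝ) where
  toFun := Function.extend Subtype.val (fun x => (φ x : ℝ)) 0
  contDiff' := by
    have h : HasCompactSupport (fun x : Ω => (φ x : ℝ)) :=
      φ.hasCompactSupport.comp_left (g := fun y : ℝ≥0 => (y : ℝ)) rfl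
    change ContDiff ℝ 0 _
    exact contDiff_zero.2 (h.continuous_extend_zero Ω.isOpen (by fun_prop))
  hasCompactSupport' := by
    have h : HasCompactSupport (fun x : Ω => (φ x : ℝ)) :=
      φ.hasCompactSupport.comp_left (g := fun y : ℝ≥0 => (y : ℝ)) rfl
    exact h.extend_zero continuous_subtype_val
  tsupport_subset' := by
    have h : HasCompactSupport (fun x : Ω => (φ x : ℝ)) :=
      φ.hasCompactSupport.comp_left (g := fun y : ℝ≥0 => (y : ℝ)) rfl
    exact (h.tsupport_extend_zero_subset continuous_subtype_val).trans
      (by rintro _ ⟨x, -, rfl⟩; exact x.2)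

theorem extendTest_coe (φ : CompactlySupportedContinuousMap Ω ℝ≥0) (x : Ω) :
    extendTest φ x = φ x :=
  Subtype.val_injective.extend_apply (fun x => (φ x : ℝ)) 0 x

theorem extendTest_off (φ : CompactlySupportedContinuousMap Ω ℝ≥0) {x : ℝ} (hx : x ∉ Ω) :
    extendTest φ x = 0 :=
  Function.extend_apply' (f := (Subtype.val : Ω → ℝ)) (fun x => (φ x : ℝ)) 0 x
    (by rintro ⟨y, rfl⟩; exact hx y.2)

theorem extendTest_add (φ ψ : CompactlySupportedContinuousMap Ω ℝ≥0) :
    extendTest (φ + ψ) = extendTest φ + extendTest ψ := by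
  ext x
  by_cases hx : x ∈ Ω
  · have h1 := extendTest_coe (φ + ψ) ⟨x, hx⟩
    have h2 := extendTest_coe φ ⟨x, hx⟩
    have h3 := extendTest_coe ψ ⟨x, hx⟩
    simp at h1 h2 h3 ⊢
    rw [h1, h2, h3]
  · simp [extendTest_off _ hx]

theorem extendTest_smul (c : ℝ≥0) (φ : CompactlySupportedContinuousMap Ω ℝ≥0) :
    extendTest (c • φ) = (c : ℝ) • extendTest φ := by
  ext x
  by_cases hx : x ∈ Ω
  · have h1 := extendTest_coe (c • φ) ⟨x, hx⟩
    have h2 := extendTest_coe φ ⟨x, hx⟩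
    simp at h1 h2 ⊢
    rw [h1, h2]
  · simp [extendTest_off _ hx]

/-- The estimate on a compact set that says that a functional has order zero. -/
theorem exists_bound (L : 𝓓'^{0}(Ω, ℝ)) (K : Compacts ℝ) (hK : (K : Set ℝ) ⊆ Ω) :
    ∃ C : ℝ, ∀ φ : 𝓓^{0}(Ω, ℝ), tsupport φ ⊆ K → ∀ B : ℝ, 0 ≤ B → (∀ x, |φ x| ≤ B) →
      |L φ| ≤ C * B := by
  have hcont : Continuous (fun f : 𝓓^{0}_{K}(ℝ, ℝ) => L (TestFunction.ofSupportedIn hK f)) :=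
    (show Continuous (fun φ : 𝓓^{0}(Ω, ℝ) => L φ) from L.continuous).comp
      (TestFunction.continuous_ofSupportedIn hK)
  let l : 𝓓^{0}_{K}(ℝ, ℝ) →ₗ[ℝ] ℝ :=
    { toFun := fun f => L (TestFunction.ofSupportedIn hK f)
      map_add' := fun f g => by
        rw [← map_add]; rfl
      map_smul' := fun c f => by
        rw [RingHom.id_apply, ← map_smul]; rfl }
  obtain ⟨s, C, -, hC⟩ := Seminorm.bound_of_continuous
    (ContDiffMapSupportedIn.withSeminorms ℝ ℝ ℝ 0 K) ((normSeminorm ℝ ℝ).comp l)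
    (by exact hcont.norm)
  refine ⟨C, fun φ hφ B hB hφB => ?_⟩
  let f : 𝓓^{0}_{K}(ℝ, ℝ) := ContDiffMapSupportedIn.of_support_subset φ.contDiff
    ((subset_tsupport _).trans hφ)
  have h1 : TestFunction.ofSupportedIn hK f = φ := by ext x; rfl
  have h2 := hC f
  have h3 : (s.sup (ContDiffMapSupportedIn.seminorm ℝ ℝ ℝ 0 K)) f ≤ B := by
    apply Seminorm.finset_sup_apply_le hB
    intro i _
    rw [ContDiffMapSupportedIn.seminorm_le_iff ℝ hB]
    intro hi x _
    have : i = 0 := by simpa using hi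
    subst this
    rw [norm_iteratedFDeriv_zero]
    exact hφB x
  have h4 : |L φ| ≤ C * (s.sup (ContDiffMapSupportedIn.seminorm ℝ ℝ ℝ 0 K)) f := by
    rw [← h1]; exact h2
  exact h4.trans (mul_le_mul_of_nonneg_left h3 C.2)


/-- The supremum that defines the positive part of a functional of order zero. -/
noncomputable def posPartFun (L : 𝓓'^{0}(Ω, ℝ)) (φ : CompactlySupportedContinuousMap Ω ℝ≥0) : ℝ :=
  sSup ((fun ψ => L (extendTest ψ)) '' {ψ | ψ ≤ φ})

theorem bddAbove_posPart (L : 𝓓'^{0}(Ω, ℝ)) (φ : CompactlySupportedContinuousMap Ω ℝ≥0) :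
    BddAbove ((fun ψ => L (extendTest ψ)) '' {ψ | ψ ≤ φ}) := by
  obtain ⟨C, hC⟩ := exists_bound L ⟨tsupport (extendTest φ), (extendTest φ).hasCompactSupport⟩
    (extendTest φ).tsupport_subset
  obtain ⟨B, hB⟩ := (extendTest φ).continuous.bounded_above_of_compact_support
    (extendTest φ).hasCompactSupport
  refine ⟨C * B, ?_⟩
  rintro _ ⟨ψ, hψ, rfl⟩
  have hle : ∀ x, |extendTest ψ x| ≤ |extendTest φ x| := by
    intro x
    by_cases hx : x ∈ Ω
    · have h1 := extendTest_coe φ ⟨x, hx⟩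
      have h2 := extendTest_coe ψ ⟨x, hx⟩
      simp only at h1 h2
      rw [h1, h2, abs_of_nonneg (NNReal.coe_nonneg _), abs_of_nonneg (NNReal.coe_nonneg _)]
      exact_mod_cast hψ ⟨x, hx⟩
    · simp [extendTest_off _ hx]
  refine (le_abs_self _).trans (hC _ ?_ B ((norm_nonneg _).trans (hB 0)) fun x => ?_)
  · apply closure_mono
    intro x hx
    rw [Function.mem_support] at hx ⊢
    intro h0
    have := hle x
    rw [h0, abs_zero] at this
    exact hx (abs_nonpos_iff.1 this)
  · exact (hle x).trans (hB x)

theorem le_posPart (L : 𝓓'^{0}(Ω, ℝ)) {φ ψ : CompactlySupportedContinuousMap Ω ℝ≥0} (h : ψ ≤ φ) :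
    L (extendTest ψ) ≤ posPartFun L φ :=
  le_csSup (bddAbove_posPart L φ) ⟨ψ, h, rfl⟩

theorem posPart_le (L : 𝓓'^{0}(Ω, ℝ)) {φ : CompactlySupportedContinuousMap Ω ℝ≥0} {B : ℝ}
    (h : ∀ ψ ≤ φ, L (extendTest ψ) ≤ B) : posPartFun L φ ≤ B := by
  refine csSup_le ⟨L (extendTest φ), φ, le_refl φ, rfl⟩ ?_
  rintro _ ⟨ψ, hψ, rfl⟩
  exact h ψ hψ

theorem posPart_nonneg (L : 𝓓'^{0}(Ω, ℝ)) (φ : CompactlySupportedContinuousMap Ω ℝ≥0) :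
    0 ≤ posPartFun L φ := by
  have h0 : extendTest (0 : CompactlySupportedContinuousMap Ω ℝ≥0) = 0 := by
    simpa using extendTest_smul 0 (0 : CompactlySupportedContinuousMap Ω ℝ≥0)
  have := le_posPart L (φ := φ) (ψ := 0) (fun x => zero_le)
  rwa [h0, map_zero] at this

theorem posPart_add (L : 𝓓'^{0}(Ω, ℝ)) (φ₁ φ₂ : CompactlySupportedContinuousMap Ω ℝ≥0) :
    posPartFun L (φ₁ + φ₂) = posPartFun L φ₁ + posPartFun L φ₂ := by
  apply le_antisymm
  · apply posPart_le
    intro ψ hψ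
    obtain ⟨ψ₂, h2⟩ := CompactlySupportedContinuousMap.exists_add_of_le
      (inf_le_left : ψ ⊓ φ₁ ≤ ψ)
    have h3 : ψ₂ ≤ φ₂ := by
      intro x
      have e : (ψ ⊓ φ₁) x + ψ₂ x = ψ x := by
        rw [← CompactlySupportedContinuousMap.add_apply, h2]
      have e2 : (ψ ⊓ φ₁) x = min (ψ x) (φ₁ x) := rfl
      have e3 : ψ x ≤ φ₁ x + φ₂ x := hψ x
      rw [e2] at e
      rcases le_total (ψ x) (φ₁ x) with h | h
      · rw [min_eq_left h] at e
        have : ψ₂ x = 0 := by simpa using e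
        rw [this]; exact zero_le
      · rw [min_eq_right h] at e
        rw [← e] at e3
        exact le_of_add_le_add_left e3
    rw [← h2, extendTest_add, map_add]
    exact add_le_add (le_posPart L inf_le_right) (le_posPart L h3)
  · rw [← le_sub_iff_add_le]
    apply posPart_le
    intro ψ₁ h1
    rw [le_sub_comm]
    apply posPart_le
    intro ψ₂ h2
    rw [le_sub_iff_add_le, ← map_add, ← extendTest_add]
    apply le_posPart
    rw [add_comm]
    exact fun x => add_le_add (h1 x) (h2 x)

theorem posPart_smul_le (L : 𝓓'^{0}(Ω, ℝ)) {c : ℝ≥0} (hc : c ≠ 0)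
    (φ : CompactlySupportedContinuousMap Ω ℝ≥0) :
    posPartFun L (c • φ) ≤ c * posPartFun L φ := by
  apply posPart_le
  intro ψ hψ
  have h1 : c⁻¹ • ψ ≤ φ := by
    intro x
    have : ψ x ≤ c * φ x := hψ x
    change c⁻¹ * ψ x ≤ φ x
    rw [inv_mul_le_iff₀ (pos_iff_ne_zero.2 hc)]
    exact this
  have h2 := le_posPart L h1
  rw [extendTest_smul, map_smul, smul_eq_mul, NNReal.coe_inv,
    inv_mul_le_iff₀ (NNReal.coe_pos.2 (pos_iff_ne_zero.2 hc))] at h2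
  exact h2

theorem posPart_smul (L : 𝓓'^{0}(Ω, ℝ)) (c : ℝ≥0) (φ : CompactlySupportedContinuousMap Ω ℝ≥0) :
    posPartFun L (c • φ) = c * posPartFun L φ := by
  rcases eq_or_ne c 0 with rfl | hc
  · have := posPart_add L 0 0
    simp at this ⊢
    exact this
  · apply le_antisymm (posPart_smul_le L hc φ)
    have h := posPart_smul_le L (inv_ne_zero hc) (c • φ)
    rw [smul_smul, inv_mul_cancel₀ hc, one_smul, NNReal.coe_inv,
      le_inv_mul_iff₀ (NNReal.coe_pos.2 (pos_iff_ne_zero.2 hc))] at h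
    exact h

/-- A functional of order zero that is additive, homogeneous and non-negative on non-negative test
functions is integration with respect to a measure. -/
theorem exists_measure (P : CompactlySupportedContinuousMap Ω ℝ≥0 → ℝ) (h0 : ∀ φ, 0 ≤ P φ)
    (hadd : ∀ φ ψ, P (φ + ψ) = P φ + P ψ) (hsmul : ∀ (c : ℝ≥0) φ, P (c • φ) = c * P φ) :
    ∃ α : Measure ℝ, α (Ω : Set ℝ)ᶜ = 0 ∧ (∀ K ⊆ (Ω : Set ℝ), IsCompact K → α K < ∞) ∧
      ∀ φ, P φ = ∫ x, extendTest φ x ∂α := by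
  have : LocallyCompactSpace Ω := Ω.isOpen.locallyCompactSpace
  let l : CompactlySupportedContinuousMap Ω ℝ≥0 →ₗ[ℝ≥0] ℝ≥0 :=
    { toFun := fun φ => ⟨P φ, h0 φ⟩
      map_add' := fun φ ψ => NNReal.eq (hadd φ ψ)
      map_smul' := fun c φ => NNReal.eq (hsmul c φ) }
  have hemb : MeasurableEmbedding (Subtype.val : Ω → ℝ) :=
    MeasurableEmbedding.subtype_coe Ω.isOpen.measurableSet
  refine ⟨(NNRealRMK.rieszMeasure l).map Subtype.val, ?_, ?_, ?_⟩
  · rw [hemb.map_apply]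
    convert measure_empty (μ := NNRealRMK.rieszMeasure l)
    ext x
    simp
  · intro K hK hKc
    rw [hemb.map_apply]
    apply IsCompact.measure_lt_top
    have h : Subtype.val '' (Subtype.val ⁻¹' K : Set Ω) = K := by
      ext x
      simpa using fun h => hK h
    exact Topology.IsInducing.subtypeVal.isCompact_iff.2 (by erw [h]; exact hKc)
  · intro φ
    rw [hemb.integral_map]
    simp only [extendTest_coe]
    rw [NNRealRMK.integral_rieszMeasure]
    rfl

/-- A test function of order zero is the difference of two non-negative ones. -/
theorem exists_extendTest_sub (φ : 𝓓^{0}(Ω, ℝ)) : ∃ φ₁ φ₂ : CompactlySupportedContinuousMap Ω ℝ≥0,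
    φ = extendTest φ₁ - extendTest φ₂ := by
  have key : HasCompactSupport (fun x : Ω => φ x) := by
    apply HasCompactSupport.intro (K := Subtype.val ⁻¹' (tsupport φ))
    · have h : Subtype.val '' (Subtype.val ⁻¹' (tsupport φ) : Set Ω) = tsupport φ := by
        ext x
        simpa using fun h => φ.tsupport_subset h
      exact Topology.IsInducing.subtypeVal.isCompact_iff.2 (by erw [h]; exact φ.hasCompactSupport)
    · intro x hx
      exact image_eq_zero_of_notMem_tsupport hx
  have hc : Continuous (fun x : Ω => φ x) := φ.continuous.comp continuous_subtype_val
  let φ₁ : CompactlySupportedContinuousMap Ω ℝ≥0 :=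
    ⟨⟨fun x => Real.toNNReal (φ x), by fun_prop⟩, key.comp_left (g := Real.toNNReal) (by simp)⟩
  let φ₂ : CompactlySupportedContinuousMap Ω ℝ≥0 :=
    ⟨⟨fun x => Real.toNNReal (-φ x), by fun_prop⟩,
      key.comp_left (g := fun y => Real.toNNReal (-y)) (by simp)⟩
  refine ⟨φ₁, φ₂, ?_⟩
  ext x
  by_cases hx : x ∈ Ω
  · have h1 := extendTest_coe φ₁ ⟨x, hx⟩
    have h2 := extendTest_coe φ₂ ⟨x, hx⟩
    have h3 : φ₁ ⟨x, hx⟩ = Real.toNNReal (φ x) := rfl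
    have h4 : φ₂ ⟨x, hx⟩ = Real.toNNReal (-φ x) := rfl
    rw [h3] at h1
    rw [h4] at h2
    change φ x = extendTest φ₁ x - extendTest φ₂ x
    simp only at h1 h2
    rw [h1, h2, Real.coe_toNNReal', Real.coe_toNNReal', max_zero_sub_eq_self]
  · change φ x = extendTest φ₁ x - extendTest φ₂ x
    rw [extendTest_off _ hx, extendTest_off _ hx]
    simpa using image_eq_zero_of_notMem_tsupport fun h => hx (φ.tsupport_subset h)

theorem integrable_test {α : Measure ℝ} (hα : ∀ K ⊆ (Ω : Set ℝ), IsCompact K → α K < ∞)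
    (φ : 𝓓^{0}(Ω, ℝ)) : Integrable φ α := by
  have h1 : IntegrableOn φ (tsupport φ) α :=
    φ.continuous.continuousOn.integrableOn_of_subset_isCompact φ.hasCompactSupport
      (isClosed_tsupport _).measurableSet subset_rfl
      (hα _ φ.tsupport_subset φ.hasCompactSupport).ne
  exact (integrableOn_iff_integrable_of_support_subset (subset_tsupport _)).1 h1

/-- A real distribution of order zero is the difference of two measures. -/
theorem exists_measure_sub (L : 𝓓'^{0}(Ω, ℝ)) : ∃ α β : Measure ℝ,
    (α (Ω : Set ℝ)ᶜ = 0 ∧ ∀ K ⊆ (Ω : Set ℝ), IsCompact K → α K < ∞) ∧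
    (β (Ω : Set ℝ)ᶜ = 0 ∧ ∀ K ⊆ (Ω : Set ℝ), IsCompact K → β K < ∞) ∧
    ∀ φ : 𝓓^{0}(Ω, ℝ), L φ = ∫ x, φ x ∂α - ∫ x, φ x ∂β := by
  obtain ⟨α, ha1, ha2, ha3⟩ := exists_measure (posPartFun L) (posPart_nonneg L) (posPart_add L)
    (posPart_smul L)
  obtain ⟨β, hb1, hb2, hb3⟩ := exists_measure (fun φ => posPartFun L φ - L (extendTest φ))
    (fun φ => sub_nonneg.2 (le_posPart L le_rfl))
    (fun φ ψ => by rw [posPart_add, extendTest_add, map_add]; ring)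
    (fun c φ => by rw [posPart_smul, extendTest_smul, map_smul, smul_eq_mul]; ring)
  refine ⟨α, β, ⟨ha1, ha2⟩, ⟨hb1, hb2⟩, fun φ => ?_⟩
  obtain ⟨φ₁, φ₂, rfl⟩ := exists_extendTest_sub φ
  have hi : ∀ γ : Measure ℝ, (∀ K ⊆ (Ω : Set ℝ), IsCompact K → γ K < ∞) →
      ∫ x, (extendTest φ₁ - extendTest φ₂) x ∂γ
        = ∫ x, extendTest φ₁ x ∂γ - ∫ x, extendTest φ₂ x ∂γ := by
    intro γ hγ
    exact integral_sub (integrable_test hγ _) (integrable_test hγ _)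
  rw [hi α ha2, hi β hb2, ← ha3, ← ha3, ← hb3, ← hb3, map_sub]
  ring

/-- A measure on the line is *Radon on `Ω`* if it is concentrated on `Ω` and finite on the compact
subsets of `Ω`. -/
structure RadonOn (Ω : Opens ℝ) (μ : Measure ℝ) : Prop where
  compl_eq_zero : μ (Ω : Set ℝ)ᶜ = 0
  lt_top : ∀ K ⊆ (Ω : Set ℝ), IsCompact K → μ K < ∞

theorem exists_exhaustion (Ω : Opens ℝ) : ∃ K : ℕ → Set ℝ,
    (∀ k, IsCompact (K k)) ∧ (∀ k, K k ⊆ Ω) ∧ ⋃ k, K k = Ω := by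
  have : LocallyCompactSpace Ω := Ω.isOpen.locallyCompactSpace
  refine ⟨fun k => Subtype.val '' (compactCovering Ω k), fun k =>
    (isCompact_compactCovering Ω k).image continuous_subtype_val, ?_, ?_⟩
  · rintro k _ ⟨x, -, rfl⟩
    exact x.2
  · rw [← image_iUnion, iUnion_compactCovering]
    simp

theorem RadonOn.sigmaFinite {μ : Measure ℝ} (h : RadonOn Ω μ) : SigmaFinite μ := by
  obtain ⟨K, hK, hKΩ, hU⟩ := exists_exhaustion Ω
  refine ⟨⟨⟨fun k => K k ∪ (Ω : Set ℝ)ᶜ, fun _ => trivial, fun k => ?_, ?_⟩⟩⟩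
  · refine (measure_union_le _ _).trans_lt ?_
    rw [h.compl_eq_zero, add_zero]
    exact h.lt_top _ (hKΩ k) (hK k)
  · rw [← iUnion_union, hU, union_compl_self]

theorem RadonOn.add {μ ν : Measure ℝ} (h : RadonOn Ω μ) (h' : RadonOn Ω ν) : RadonOn Ω (μ + ν) :=
  ⟨by simp [h.compl_eq_zero, h'.compl_eq_zero], fun K hK hc => by
    simpa using ⟨h.lt_top K hK hc, h'.lt_top K hK hc⟩⟩

theorem RadonOn.sum {ι : Type*} (s : Finset ι) {μ : ι → Measure ℝ} (h : ∀ i, RadonOn Ω (μ i)) :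
    RadonOn Ω (∑ i ∈ s, μ i) := by
  classical
  induction s using Finset.induction_on with
  | empty => exact ⟨by simp, by simp⟩
  | insert i s hi ih => rw [Finset.sum_insert hi]; exact (h i).add ih

/-- Integration of a test function against a locally integrable density. -/
theorem integrable_test_mul {μ : Measure ℝ} {g : ℝ → ℝ}
    (hg : ∀ K ⊆ (Ω : Set ℝ), IsCompact K → IntegrableOn g K μ) (φ : 𝓓^{0}(Ω, ℝ)) :
    Integrable (fun x => φ x * g x) μ := by
  have h1 : IntegrableOn (fun x => φ x * g x) (tsupport φ) μ := by
    obtain ⟨B, hB⟩ := φ.continuous.bounded_above_of_compact_support φ.hasCompactSupport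
    exact (hg _ φ.tsupport_subset φ.hasCompactSupport).bdd_mul (c := B)
      φ.continuous.aestronglyMeasurable (ae_of_all _ hB)
  refine (integrableOn_iff_integrable_of_support_subset ?_).1 h1
  intro x hx
  refine subset_tsupport _ ?_
  rw [Function.mem_support] at hx ⊢
  exact left_ne_zero_of_mul hx

/-- Finitely many measures that are Radon on `Ω` have locally integrable densities with respect to
a common one. -/
theorem RadonOn.exists_density {α μ : Measure ℝ} (ha : RadonOn Ω α) (hm : RadonOn Ω μ)
    (hle : α ≤ μ) : ∃ h : ℝ → ℝ, Measurable h ∧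
      (∀ K ⊆ (Ω : Set ℝ), IsCompact K → IntegrableOn h K μ) ∧
      ∀ φ : 𝓓^{0}(Ω, ℝ), ∫ x, φ x ∂α = ∫ x, φ x * h x ∂μ := by
  have := ha.sigmaFinite
  have := hm.sigmaFinite
  refine ⟨fun x => (α.rnDeriv μ x).toReal, (Measure.measurable_rnDeriv _ _).ennreal_toReal,
    fun K hK hc => Measure.integrableOn_toReal_rnDeriv (ha.lt_top K hK hc).ne, fun φ => ?_⟩
  rw [← integral_rnDeriv_smul (Measure.absolutelyContinuous_of_le hle)]
  simp only [smul_eq_mul, mul_comm]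

/-- Finitely many real distributions of order zero have densities with respect to a common
measure. -/
theorem exists_common_density {ι : Type*} [Finite ι] (L : ι → 𝓓'^{0}(Ω, ℝ)) :
    ∃ μ : Measure ℝ, RadonOn Ω μ ∧ ∃ h : ι → ℝ → ℝ, ∀ i, Measurable (h i) ∧
      (∀ K ⊆ (Ω : Set ℝ), IsCompact K → IntegrableOn (h i) K μ) ∧
      ∀ φ : 𝓓^{0}(Ω, ℝ), L i φ = ∫ x, φ x * h i x ∂μ := by
  classical
  cases nonempty_fintype ι
  choose α β hα hβ hL using fun i => exists_measure_sub (L i)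
  have ha : ∀ i, RadonOn Ω (α i) := fun i => ⟨(hα i).1, (hα i).2⟩
  have hb : ∀ i, RadonOn Ω (β i) := fun i => ⟨(hβ i).1, (hβ i).2⟩
  have hμ : RadonOn Ω (∑ i, (α i + β i)) := RadonOn.sum _ fun i => (ha i).add (hb i)
  have hle : ∀ i, α i + β i ≤ ∑ i, (α i + β i) := fun i =>
    Finset.single_le_sum (f := fun i => α i + β i) (fun _ _ => Measure.zero_le _)
      (Finset.mem_univ i)
  refine ⟨_, hμ, ?_⟩
  choose f hf1 hf2 hf3 using fun i => (ha i).exists_density hμ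
    ((Measure.le_add_right le_rfl).trans (hle i))
  choose g hg1 hg2 hg3 using fun i => (hb i).exists_density hμ
    ((Measure.le_add_left le_rfl).trans (hle i))
  refine ⟨fun i x => f i x - g i x, fun i => ⟨(hf1 i).sub (hg1 i),
    fun K hK hc => (hf2 i K hK hc).sub (hg2 i K hK hc), fun φ => ?_⟩⟩
  rw [hL, hf3, hg3, ← integral_sub (integrable_test_mul (hf2 i) φ) (integrable_test_mul (hg2 i) φ)]
  simp only [mul_sub]

theorem setIntegral_nonneg_of_test {μ : Measure ℝ} {g : ℝ → ℝ}
    (hg : ∀ K ⊆ (Ω : Set ℝ), IsCompact K → IntegrableOn g K μ)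
    (h : ∀ φ : 𝓓^{0}(Ω, ℝ), (∀ x, 0 ≤ φ x) → 0 ≤ ∫ x, φ x * g x ∂μ)
    {K : Set ℝ} (hKΩ : K ⊆ Ω) (hK : IsCompact K) : 0 ≤ ∫ x in K, g x ∂μ := by
  obtain ⟨δ, hδ, hδΩ⟩ := hK.exists_cthickening_subset_open Ω.isOpen hKΩ
  have hcomp : IsCompact (Metric.cthickening δ K) := hK.cthickening
  let e : ℕ → ℝ := fun k => δ / (k + 1)
  have he : ∀ k, 0 < e k := fun k => by positivity
  have hele : ∀ k, e k ≤ δ := fun k => div_le_self hδ.le (by simp)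
  have helim : Tendsto e atTop (𝓝 0) := by
    have := tendsto_one_div_add_atTop_nhds_zero_nat (𝕜 := ℝ)
    simpa [e, div_eq_mul_inv] using this.const_mul δ
  have hoff : ∀ k x, x ∉ Metric.cthickening δ K → thickenedIndicator (he k) K x = 0 := by
    intro k x hx
    apply thickenedIndicator_zero
    exact fun hx' => hx (Metric.thickening_subset_cthickening_of_le (hele k) K hx')
  have hsub : ∀ k, tsupport (fun x => (thickenedIndicator (he k) K x : ℝ)) ⊆
      Metric.cthickening δ K := by
    intro k
    refine closure_minimal ?_ Metric.isClosed_cthickening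
    intro x hx
    by_contra hx'
    exact hx (by simp [hoff k x hx'])
  let φ : ℕ → 𝓓^{0}(Ω, ℝ) := fun k =>
    { toFun := fun x => (thickenedIndicator (he k) K x : ℝ)
      contDiff' := by
        change ContDiff ℝ 0 _
        exact contDiff_zero.2 (by fun_prop)
      hasCompactSupport' := hcomp.of_isClosed_subset (isClosed_tsupport _) (hsub k)
      tsupport_subset' := (hsub k).trans hδΩ }
  have hφ : ∀ k x, φ k x = (thickenedIndicator (he k) K x : ℝ) := fun k x => rfl
  have hlim : Tendsto (fun k => ∫ x, φ k x * g x ∂μ) atTop (𝓝 (∫ x, K.indicator g x ∂μ)) := by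
    apply tendsto_integral_of_dominated_convergence ((Metric.cthickening δ K).indicator (|g ·|))
    · exact fun k => (integrable_test_mul hg (φ k)).aestronglyMeasurable
    · rw [integrable_indicator_iff hcomp.measurableSet]
      exact (hg _ hδΩ hcomp).abs
    · intro k
      refine ae_of_all _ fun x => ?_
      rw [hφ]
      by_cases hx : x ∈ Metric.cthickening δ K
      · rw [indicator_of_mem hx, norm_mul, Real.norm_eq_abs, Real.norm_eq_abs]
        have : |(thickenedIndicator (he k) K x : ℝ)| ≤ 1 := by
          rw [abs_of_nonneg (NNReal.coe_nonneg _)]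
          exact_mod_cast thickenedIndicator_le_one (he k) K x
        exact mul_le_of_le_one_left (abs_nonneg _) this
      · simp [hoff k x hx, indicator_of_notMem hx]
    · refine ae_of_all _ fun x => ?_
      have h1 := thickenedIndicator_tendsto_indicator_closure he helim K
      rw [tendsto_pi_nhds] at h1
      have h2 := h1 x
      rw [hK.isClosed.closure_eq] at h2
      have h3 : Tendsto (fun k => φ k x * g x) atTop
          (𝓝 (((K.indicator (fun _ => (1 : ℝ≥0)) x : ℝ≥0) : ℝ) * g x)) := by
        exact ((NNReal.tendsto_coe.2 h2).mul_const (g x))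
      convert h3 using 2
      by_cases hx : x ∈ K <;> simp [hx]
  rw [← integral_indicator hK.measurableSet]
  refine ge_of_tendsto' hlim fun k => h (φ k) fun x => ?_
  rw [hφ]
  exact NNReal.coe_nonneg _

theorem ae_nonneg_of_test {μ : Measure ℝ} (hμ : RadonOn Ω μ) {g : ℝ → ℝ} (hgm : Measurable g)
    (hg : ∀ K ⊆ (Ω : Set ℝ), IsCompact K → IntegrableOn g K μ)
    (h : ∀ φ : 𝓓^{0}(Ω, ℝ), (∀ x, 0 ≤ φ x) → 0 ≤ ∫ x, φ x * g x ∂μ) : ∀ᵐ x ∂μ, 0 ≤ g x := by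
  obtain ⟨K, hK, hKΩ, hU⟩ := exists_exhaustion Ω
  have hs : MeasurableSet {x | g x < 0} := measurableSet_lt hgm measurable_const
  have main : ∀ k, μ ({x | g x < 0} ∩ K k) = 0 := by
    intro k
    by_contra hne
    have hfin : IsFiniteMeasure (μ.restrict (K k)) :=
      ⟨by simpa using hμ.lt_top _ (hKΩ k) (hK k)⟩
    have hpos : 0 < μ.restrict (K k) {x | g x < 0} := by
      rw [Measure.restrict_apply hs]
      exact pos_iff_ne_zero.2 hne
    obtain ⟨C, hCs, hC, hCpos⟩ := hs.exists_lt_isCompact_of_ne_top (measure_ne_top _ _) hpos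
    rw [Measure.restrict_apply hC.measurableSet] at hCpos
    have hCK : IsCompact (C ∩ K k) := hC.inter (hK k)
    have hsub : C ∩ K k ⊆ (Ω : Set ℝ) := inter_subset_right.trans (hKΩ k)
    have h1 := setIntegral_nonneg_of_test hg h hsub hCK
    have h2 : 0 < ∫ x in C ∩ K k, -g x ∂μ := by
      rw [setIntegral_pos_iff_support_of_nonneg_ae]
      · refine hCpos.trans_le (measure_mono fun x hx => ⟨?_, hx⟩)
        have : g x < 0 := hCs hx.1
        simp [this.ne]
      · refine (ae_restrict_iff' hCK.measurableSet).2 (ae_of_all _ fun x hx => ?_)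
        have : g x < 0 := hCs hx.1
        simpa using this.le
      · exact (hg _ hsub hCK).neg
    rw [integral_neg] at h2
    linarith
  rw [ae_iff]
  simp only [not_le]
  have hcov : {x | g x < 0} ⊆ (⋃ k, {x | g x < 0} ∩ K k) ∪ (Ω : Set ℝ)ᶜ := by
    intro x hx
    by_cases hxΩ : x ∈ (Ω : Set ℝ)
    · rw [← hU] at hxΩ
      obtain ⟨k, hk⟩ := mem_iUnion.1 hxΩ
      exact Or.inl (mem_iUnion.2 ⟨k, hx, hk⟩)
    · exact Or.inr hxΩ
  refine measure_mono_null hcov (measure_union_null (measure_iUnion_null main) hμ.compl_eq_zero)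

/-! ### Matrices of distributions of order zero and their densities -/

variable {n : ℕ}

/-- A matrix of complex distributions of order zero. -/
abbrev DistMatrix (Ω : Opens ℝ) (n : ℕ) := Matrix (Fin n) (Fin n) (𝓓'^{0}(Ω, ℂ))

/-- `q` is Hermitian: `q = q^*`, where `(q^*) i j` is the conjugate of `q j i`. -/
def IsHermitianDist (q : DistMatrix Ω n) : Prop :=
  ∀ i j, ∀ φ : 𝓓^{0}(Ω, ℝ), q i j φ = star (q j i φ)

/-- `w` is non-negative: the distribution `c^* w c` is non-negative for every `c` in `ℂ^n`. -/
def IsNonnegDist (w : DistMatrix Ω n) : Prop :=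
  ∀ c : Fin n → ℂ, ∀ φ : 𝓓^{0}(Ω, ℝ), (∀ x, 0 ≤ φ x) →
    0 ≤ ∑ i, ∑ j, star (c i) * w i j φ * c j

/-- The distributions of order zero `q` and `w` written as (local) measures: `q = qd • μ` and
`w = wd • μ` for a measure `μ` that is Radon on `Ω` and densities `qd`, `wd` that are locally
integrable on `Ω`, where `wd` is pointwise non-negative. -/
structure MeasureRep (q w : DistMatrix Ω n) where
  μ : Measure ℝ
  radon : RadonOn Ω μ
  qd : ℝ → Matrix (Fin n) (Fin n) ℂ
  wd : ℝ → Matrix (Fin n) (Fin n) ℂ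
  qd_measurable : ∀ i j, Measurable fun x => qd x i j
  wd_measurable : ∀ i j, Measurable fun x => wd x i j
  qd_integrable : ∀ i j, ∀ K ⊆ (Ω : Set ℝ), IsCompact K → IntegrableOn (fun x => qd x i j) K μ
  wd_integrable : ∀ i j, ∀ K ⊆ (Ω : Set ℝ), IsCompact K → IntegrableOn (fun x => wd x i j) K μ
  q_eq : ∀ i j, ∀ φ : 𝓓^{0}(Ω, ℝ), q i j φ = ∫ x, (φ x : ℂ) * qd x i j ∂μ
  w_eq : ∀ i j, ∀ φ : 𝓓^{0}(Ω, ℝ), w i j φ = ∫ x, (φ x : ℂ) * wd x i j ∂μ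
  wd_posSemidef : ∀ x, (wd x).PosSemidef

theorem posSemidef_of_forall_nonneg {A : Matrix (Fin n) (Fin n) ℂ}
    (h : ∀ c : Fin n → ℂ, 0 ≤ star c ⬝ᵥ A *ᵥ c) : A.PosSemidef := by
  rw [Matrix.posSemidef_iff_dotProduct_mulVec]
  refine ⟨?_, h⟩
  rw [← Matrix.isSymmetric_toEuclideanLin_iff, LinearMap.isSymmetric_iff_inner_map_self_real]
  intro v
  have h1 := h (WithLp.ofLp v)
  have h2 : inner ℂ (A.toEuclideanLin v) v = star (star (WithLp.ofLp v) ⬝ᵥ A *ᵥ (WithLp.ofLp v)) := by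
    rw [EuclideanSpace.inner_eq_star_dotProduct, ← Matrix.star_dotProduct, dotProduct_comm]
    rfl
  rw [h2]
  exact congrArg star ((Complex.conj_eq_iff_im).2 (Complex.nonneg_iff.1 h1).2.symm)

/-- Every pair of matrices of distributions of order zero, the second one non-negative, is given by
densities with respect to a common measure. -/
theorem nonempty_measureRep (q w : DistMatrix Ω n) (hw : IsNonnegDist w) :
    Nonempty (MeasureRep q w) := by
  obtain ⟨μ, hμ, h, hh⟩ := exists_common_density
    (fun k : (Fin n × Fin n) × Bool × Bool =>
      Distribution.mapCLM (bif k.2.1 then Complex.reCLM else Complex.imCLM)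
        (bif k.2.2 then q k.1.1 k.1.2 else w k.1.1 k.1.2))
  let d : Bool → ℝ → Matrix (Fin n) (Fin n) ℂ := fun b x i j =>
    (h ((i, j), true, b) x : ℂ) + (h ((i, j), false, b) x : ℂ) * Complex.I
  have dmeas : ∀ b i j, Measurable fun x => d b x i j := fun b i j =>
    (Complex.measurable_ofReal.comp (hh _).1).add
      ((Complex.measurable_ofReal.comp (hh _).1).mul_const _)
  have dint : ∀ b i j, ∀ K ⊆ (Ω : Set ℝ), IsCompact K → IntegrableOn (fun x => d b x i j) K μ :=
    fun b i j K hK hc => ((hh _).2.1 K hK hc).ofReal.add (((hh _).2.1 K hK hc).ofReal.mul_const _)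
  have dphi : ∀ b i j, ∀ φ : 𝓓^{0}(Ω, ℝ), ∫ x, (φ x : ℂ) * d b x i j ∂μ =
      (bif b then q i j else w i j) φ := by
    intro b i j φ
    have e : ∀ x, (φ x : ℂ) * d b x i j = ((φ x * h ((i, j), true, b) x : ℝ) : ℂ) +
        ((φ x * h ((i, j), false, b) x : ℝ) : ℂ) * Complex.I := by
      intro x
      simp only [d]
      push_cast
      ring
    simp only [e]
    rw [integral_add (integrable_test_mul (hh _).2.1 φ).ofReal
      ((integrable_test_mul (hh _).2.1 φ).ofReal.mul_const _), integral_mul_const,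
      integral_complex_ofReal, integral_complex_ofReal, ← (hh _).2.2, ← (hh _).2.2]
    cases b <;> simp [Complex.re_add_im]
  have dpos : ∀ c : Fin n → ℂ, ∀ᵐ x ∂μ, 0 ≤ star c ⬝ᵥ d false x *ᵥ c := by
    intro c
    let g : ℝ → ℂ := fun x => star c ⬝ᵥ d false x *ᵥ c
    have hg : ∀ x, g x = ∑ i, ∑ j, star (c i) * c j * d false x i j := by
      intro x
      simp only [g, dotProduct, Matrix.mulVec, Finset.mul_sum, Pi.star_apply]
      exact Finset.sum_congr rfl fun i _ => Finset.sum_congr rfl fun j _ => by ring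
    have gmeas : Measurable g := by
      simp only [funext hg]
      exact Finset.measurable_fun_sum _ fun i _ => Finset.measurable_fun_sum _ fun j _ =>
        (dmeas false i j).const_mul _
    have gint : ∀ K ⊆ (Ω : Set ℝ), IsCompact K → IntegrableOn g K μ := by
      intro K hK hc
      simp only [funext hg]
      exact integrable_finsetSum _ fun i _ => integrable_finsetSum _ fun j _ =>
        (dint false i j K hK hc).const_mul _
    have dint' : ∀ i j, ∀ φ : 𝓓^{0}(Ω, ℝ), Integrable (fun x => (φ x : ℂ) * d false x i j) μ := by
      intro i j φ
      have e : ∀ x, (φ x : ℂ) * d false x i j = ((φ x * h ((i, j), true, false) x : ℝ) : ℂ) +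
          ((φ x * h ((i, j), false, false) x : ℝ) : ℂ) * Complex.I := by
        intro x
        simp only [d]
        push_cast
        ring
      simp only [e]
      exact (integrable_test_mul (hh _).2.1 φ).ofReal.add
        ((integrable_test_mul (hh _).2.1 φ).ofReal.mul_const _)
    have gphi : ∀ φ : 𝓓^{0}(Ω, ℝ), Integrable (fun x => (φ x : ℂ) * g x) μ ∧
        ∫ x, (φ x : ℂ) * g x ∂μ = ∑ i, ∑ j, star (c i) * w i j φ * c j := by
      intro φ
      have e : ∀ x, (φ x : ℂ) * g x =
          ∑ i, ∑ j, star (c i) * c j * ((φ x : ℂ) * d false x i j) := by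
        intro x
        rw [hg, Finset.mul_sum]
        refine Finset.sum_congr rfl fun i _ => ?_
        rw [Finset.mul_sum]
        exact Finset.sum_congr rfl fun j _ => by ring
      simp only [e]
      refine ⟨integrable_finsetSum _ fun i _ => integrable_finsetSum _ fun j _ =>
        (dint' i j φ).const_mul _, ?_⟩
      rw [integral_finsetSum _ fun i _ => integrable_finsetSum _ fun j _ =>
        (dint' i j φ).const_mul _]
      refine Finset.sum_congr rfl fun i _ => ?_
      rw [integral_finsetSum _ fun j _ => (dint' i j φ).const_mul _]
      refine Finset.sum_congr rfl fun j _ => ?_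
      rw [integral_const_mul, dphi]
      simp only [cond_false]
      ring
    have hre : ∀ φ : 𝓓^{0}(Ω, ℝ), (∫ x, (φ x : ℂ) * g x ∂μ).re = ∫ x, φ x * (g x).re ∂μ := by
      intro φ
      have := integral_re (gphi φ).1
      simpa using this.symm
    have him : ∀ φ : 𝓓^{0}(Ω, ℝ), (∫ x, (φ x : ℂ) * g x ∂μ).im = ∫ x, φ x * (g x).im ∂μ := by
      intro φ
      have := integral_im (gphi φ).1
      simpa using this.symm
    have key : ∀ φ : 𝓓^{0}(Ω, ℝ), (∀ x, 0 ≤ φ x) →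
        0 ≤ (∫ x, (φ x : ℂ) * g x ∂μ).re ∧ 0 = (∫ x, (φ x : ℂ) * g x ∂μ).im := by
      intro φ hφ
      have := hw c φ hφ
      rw [← (gphi φ).2] at this
      exact Complex.nonneg_iff.1 this
    have a1 := ae_nonneg_of_test hμ (g := fun x => (g x).re) (Complex.measurable_re.comp gmeas)
      (fun K hK hc => (gint K hK hc).re) (fun φ hφ => by rw [← hre]; exact (key φ hφ).1)
    have a2 := ae_nonneg_of_test hμ (g := fun x => (g x).im) (Complex.measurable_im.comp gmeas)
      (fun K hK hc => (gint K hK hc).im) (fun φ hφ => by rw [← him]; exact (key φ hφ).2.le)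
    have a3 := ae_nonneg_of_test hμ (g := fun x => -(g x).im)
      (Complex.measurable_im.comp gmeas).neg (fun K hK hc => (gint K hK hc).im.neg)
      (fun φ hφ => by
        simp only [mul_neg]
        rw [integral_neg, ← him, ← (key φ hφ).2, neg_zero])
    filter_upwards [a1, a2, a3] with x h1 h2 h3
    exact Complex.nonneg_iff.2 ⟨h1, le_antisymm h2 (by linarith)⟩
  have dpos' : ∀ᵐ x ∂μ, (d false x).PosSemidef := by
    have h1 : ∀ᵐ x ∂μ, ∀ k, 0 ≤ star (denseSeq (Fin n → ℂ) k) ⬝ᵥ d false x *ᵥ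
        (denseSeq (Fin n → ℂ) k) := ae_all_iff.2 fun k => dpos _
    filter_upwards [h1] with x hx
    apply posSemidef_of_forall_nonneg
    have hcl : IsClosed {c : Fin n → ℂ | 0 ≤ star c ⬝ᵥ d false x *ᵥ c} :=
      isClosed_le continuous_const (by fun_prop)
    have hsub : range (denseSeq (Fin n → ℂ)) ⊆ {c | 0 ≤ star c ⬝ᵥ d false x *ᵥ c} := by
      rintro _ ⟨k, rfl⟩
      exact hx k
    intro c
    exact hcl.closure_subset_iff.2 hsub ((denseRange_denseSeq (Fin n → ℂ)) c)
  classical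
  let N : Set ℝ := toMeasurable μ {x | ¬ (d false x).PosSemidef}
  have hN : MeasurableSet N := measurableSet_toMeasurable _ _
  have hN0 : μ N = 0 := by
    rw [measure_toMeasurable]
    exact dpos'
  have hae : ∀ᵐ x ∂μ, x ∉ N := measure_eq_zero_iff_ae_notMem.1 hN0
  let wd : ℝ → Matrix (Fin n) (Fin n) ℂ := fun x => if x ∈ N then 0 else d false x
  have hwd : ∀ i j, (fun x => wd x i j) =ᵐ[μ] fun x => d false x i j := by
    intro i j
    filter_upwards [hae] with x hx
    simp [wd, hx]
  refine ⟨⟨μ, hμ, d true, wd, dmeas true, ?_, dint true, ?_, fun i j φ => (dphi true i j φ).symm,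
    ?_, ?_⟩⟩
  · intro i j
    have : (fun x => wd x i j) = fun x => if x ∈ N then 0 else d false x i j := by
      funext x
      by_cases hx : x ∈ N <;> simp [wd, hx]
    rw [this]
    exact Measurable.ite hN measurable_const (dmeas false i j)
  · intro i j K hK hc
    exact (dint false i j K hK hc).congr (EventuallyEq.symm (ae_restrict_of_ae (hwd i j)))
  · intro i j φ
    rw [← show _ = w i j φ from dphi false i j φ]
    refine integral_congr_ae ?_
    filter_upwards [hwd i j] with x hx
    rw [hx]
  · intro x
    by_cases hx : x ∈ N
    · simp [wd, hx, Matrix.PosSemidef.zero]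
    · simp only [wd, hx, if_false]
      by_contra hcon
      exact hx (subset_toMeasurable _ _ hcon)

/-! ### The space `L²(w)` -/

namespace MeasureRep

variable {q w : DistMatrix Ω n} (r : MeasureRep q w)

/-- The density `f^* w g` with respect to `μ`. -/
def dens (f g : ℝ → Fin n → ℂ) (x : ℝ) : ℂ := star (f x) ⬝ᵥ r.wd x *ᵥ g x

theorem dens_nonneg (f : ℝ → Fin n → ℂ) (x : ℝ) : 0 ≤ r.dens f f x :=
  (Matrix.posSemidef_iff_dotProduct_mulVec.1 (r.wd_posSemidef x)).2 _

theorem dens_aestronglyMeasurable {f g : ℝ → Fin n → ℂ} (hf : AEStronglyMeasurable f r.μ)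
    (hg : AEStronglyMeasurable g r.μ) : AEStronglyMeasurable (r.dens f g) r.μ := by
  have e : r.dens f g = fun x => ∑ i, ∑ j, star (f x i) * (r.wd x i j * g x j) := by
    funext x
    simp only [dens, dotProduct, Matrix.mulVec, Finset.mul_sum, Pi.star_apply]
  have hf' : ∀ i, AEStronglyMeasurable (fun x => f x i) r.μ := fun i =>
    (continuous_apply i).comp_aestronglyMeasurable hf
  have hg' : ∀ i, AEStronglyMeasurable (fun x => g x i) r.μ := fun i =>
    (continuous_apply i).comp_aestronglyMeasurable hg
  rw [e]
  exact Finset.aestronglyMeasurable_fun_sum _ fun i _ => Finset.aestronglyMeasurable_fun_sum _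
    fun j _ => (continuous_star.comp_aestronglyMeasurable (hf' i)).mul
      ((r.wd_measurable i j).aestronglyMeasurable.mul (hg' j))

/-- `f` is in `𝓛²(w)`, i.e. `∫ f^* w f < ∞`. -/
def MemL2 (f : ℝ → Fin n → ℂ) : Prop :=
  AEStronglyMeasurable f r.μ ∧ Integrable (r.dens f f) r.μ

theorem dens_add (f g h : ℝ → Fin n → ℂ) (x : ℝ) :
    r.dens (f + g) h x = r.dens f h x + r.dens g h x := by
  simp [dens, add_dotProduct]

theorem dens_smul (c : ℂ) (f h : ℝ → Fin n → ℂ) (x : ℝ) :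
    r.dens (c • f) h x = star c * r.dens f h x := by
  simp [dens]

theorem dens_star (f g : ℝ → Fin n → ℂ) (x : ℝ) : star (r.dens f g x) = r.dens g f x := by
  have hW : (r.wd x)ᴴ = r.wd x := (r.wd_posSemidef x).1
  simp only [dens]
  rw [Matrix.star_dotProduct, star_star, Matrix.star_mulVec, hW, ← Matrix.dotProduct_mulVec]

theorem dens_add_right (f g h : ℝ → Fin n → ℂ) (x : ℝ) :
    r.dens h (f + g) x = r.dens h f x + r.dens h g x := by
  simp [dens, Matrix.mulVec_add, dotProduct_add]

theorem dens_smul_right (c : ℂ) (f h : ℝ → Fin n → ℂ) (x : ℝ) :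
    r.dens h (c • f) x = c * r.dens h f x := by
  simp [dens, Matrix.mulVec_smul]

theorem MemL2.smul {f : ℝ → Fin n → ℂ} (hf : r.MemL2 f) (c : ℂ) : r.MemL2 (c • f) := by
  refine ⟨hf.1.const_smul c, ?_⟩
  have e : r.dens (c • f) (c • f) = fun x => star c * (c * r.dens f f x) := by
    funext x
    rw [dens_smul, dens_smul_right]
  rw [e]
  exact (hf.2.const_mul _).const_mul _

theorem MemL2.add {f g : ℝ → Fin n → ℂ} (hf : r.MemL2 f) (hg : r.MemL2 g) : r.MemL2 (f + g) := by
  refine ⟨hf.1.add hg.1, ?_⟩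
  refine Integrable.mono ((hf.2.add hg.2).const_mul 2)
    (r.dens_aestronglyMeasurable (hf.1.add hg.1) (hf.1.add hg.1)) (ae_of_all _ fun x => ?_)
  have h1 : r.dens (f + g) (f + g) x ≤ 2 * (r.dens f f x + r.dens g g x) := by
    have h2 := r.dens_nonneg (f + (-1 : ℂ) • g) x
    have e : r.dens (f + (-1 : ℂ) • g) (f + (-1 : ℂ) • g) x =
        2 * (r.dens f f x + r.dens g g x) - r.dens (f + g) (f + g) x := by
      simp only [dens_add, dens_add_right, dens_smul, dens_smul_right, star_neg, star_one]
      ring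
    rw [e] at h2
    exact sub_nonneg.1 h2
  have h0 := r.dens_nonneg (f + g) x
  exact CStarAlgebra.norm_le_norm_of_nonneg_of_le h0 h1

theorem MemL2.integrable_dens {f g : ℝ → Fin n → ℂ} (hf : r.MemL2 f) (hg : r.MemL2 g) :
    Integrable (r.dens f g) r.μ := by
  have e : r.dens f g = fun x => (1 / 4 : ℂ) * (r.dens (f + g) (f + g) x
      - r.dens (f + (-1 : ℂ) • g) (f + (-1 : ℂ) • g) x
      - Complex.I * (r.dens (f + Complex.I • g) (f + Complex.I • g) x
        - r.dens (f + (-Complex.I) • g) (f + (-Complex.I) • g) x)) := by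
    funext x
    simp only [dens_add, dens_add_right, dens_smul, dens_smul_right, star_neg, star_one,
      Complex.star_def, Complex.conj_I]
    linear_combination (norm := ring_nf) (1 / 2 : ℂ) * (r.dens g f x - r.dens f g x) * Complex.I_sq
    simp only [Complex.I_sq]
    ring
  rw [e]
  exact (((hf.add r hg).2.sub (hf.add r (hg.smul r _)).2).sub
    (((hf.add r (hg.smul r _)).2.sub (hf.add r (hg.smul r _)).2).const_mul _)).const_mul _

/-- The vector space `𝓛²(w)` of functions. -/
def funSubmodule : Submodule ℂ (ℝ → Fin n → ℂ) where
  carrier := {f | r.MemL2 f}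
  add_mem' hf hg := MemL2.add r hf hg
  zero_mem' := by
    refine ⟨aestronglyMeasurable_const, ?_⟩
    have e : r.dens 0 0 = fun _ => (0 : ℂ) := by
      funext x
      simp [dens]
    rw [e]
    exact integrable_zero _ _ _
  smul_mem' c _ hf := MemL2.smul r hf c

/-- The space `𝓛²(w)` of functions, with its semi-scalar product `⟨f, g⟩ = ∫ f^* w g`. -/
def FunL2 : Type := r.funSubmodule

noncomputable instance : AddCommGroup r.FunL2 := inferInstanceAs (AddCommGroup r.funSubmodule)
noncomputable instance : Module ℂ r.FunL2 := inferInstanceAs (Module ℂ r.funSubmodule)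

/-- The underlying function of an element of `𝓛²(w)`. -/
def FunL2.fn {r : MeasureRep q w} (f : r.FunL2) : ℝ → Fin n → ℂ := f.1

theorem FunL2.memL2 {r : MeasureRep q w} (f : r.FunL2) : r.MemL2 f.fn := f.2

/-- The semi-scalar product of `𝓛²(w)`. -/
noncomputable instance preCore : PreInnerProductSpace.Core ℂ r.FunL2 where
  inner f g := ∫ x, r.dens f.fn g.fn x ∂r.μ
  conj_inner_symm f g := by
    rw [← integral_conj]
    exact integral_congr_ae (ae_of_all _ fun x => r.dens_star g.fn f.fn x)
  re_inner_nonneg f := by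
    have h := integral_re f.memL2.2
    refine le_of_le_of_eq (integral_nonneg fun x => ?_) h
    exact (Complex.nonneg_iff.1 (r.dens_nonneg f.fn x)).1
  add_left f g h := by
    rw [← integral_add (f.memL2.integrable_dens r h.memL2) (g.memL2.integrable_dens r h.memL2)]
    exact integral_congr_ae (ae_of_all _ fun x => r.dens_add f.fn g.fn h.fn x)
  smul_left f g c := by
    rw [← integral_const_mul]
    exact integral_congr_ae (ae_of_all _ fun x => r.dens_smul c f.fn g.fn x)

noncomputable instance : SeminormedAddCommGroup r.FunL2 :=
  InnerProductSpace.Core.toSeminormedAddCommGroup (𝕜 := ℂ)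
noncomputable instance : InnerProductSpace ℂ r.FunL2 := InnerProductSpace.ofCore r.preCore

/-- The space `L²(w)` of classes of functions, where functions are identified if the norm of their
difference is zero. -/
abbrev L2 : Type := SeparationQuotient r.FunL2

/-- The class of a function in `L²(w)`. -/
noncomputable def cls {r : MeasureRep q w} (f : r.FunL2) : r.L2 := SeparationQuotient.mk f

theorem inner_cls (f g : r.FunL2) :
    inner ℂ (cls f) (cls g) = ∫ x, star (f.fn x) ⬝ᵥ r.wd x *ᵥ g.fn x ∂r.μ := rfl

end MeasureRep

/-! ### The differential equation and its maximal relation -/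

/-- The interval `(a, b)`, whose endpoints may be infinite. -/
def openInterval (a b : EReal) : Opens ℝ :=
  ⟨{x : ℝ | a < (x : EReal) ∧ (x : EReal) < b},
    (isOpen_lt continuous_const continuous_coe_real_ereal).inter
      (isOpen_lt continuous_coe_real_ereal continuous_const)⟩

/-- `u` is a balanced function of locally bounded variation on `Ω`: at every point of `Ω` its value
is the mean of its one-sided limits. -/
def IsBalanced (Ω : Opens ℝ) (u : ℝ → Fin n → ℂ) : Prop :=
  LocallyBoundedVariationOn u Ω ∧
    ∀ x ∈ Ω, u x = (1 / 2 : ℂ) • (Function.leftLim u x + Function.rightLim u x)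

section

variable {q w : DistMatrix Ω n} (J : Matrix (Fin n) (Fin n) ℂ) (r : MeasureRep q w)

/-- The jump `Δ_q(x) = Q⁺(x) - Q⁻(x)` of an antiderivative `Q` of `q`. -/
noncomputable def jumpQ (x : ℝ) : Matrix (Fin n) (Fin n) ℂ := (r.μ.real {x} : ℂ) • r.qd x

/-- The jump `Δ_w(x) = W⁺(x) - W⁻(x)` of an antiderivative `W` of `w`. -/
noncomputable def jumpW (x : ℝ) : Matrix (Fin n) (Fin n) ℂ := (r.μ.real {x} : ℂ) • r.wd x

/-- The equation `J u' + q u = w g` in the sense of distributions on `Ω`. -/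
def Solves (u g : ℝ → Fin n → ℂ) : Prop :=
  ∀ φ : 𝓓(Ω, ℝ), ∀ i,
    -(∫ x, ((deriv φ x : ℝ) : ℂ) * (J *ᵥ u x) i) + ∫ x, (φ x : ℂ) * (r.qd x *ᵥ u x) i ∂r.μ =
      ∫ x, (φ x : ℂ) * (r.wd x *ᵥ g x) i ∂r.μ

/-- `u` is a balanced solution of `J u' + q u = w g`. -/
def IsSolution (u g : ℝ → Fin n → ℂ) : Prop := IsBalanced Ω u ∧ Solves J r u g

/-- The maximal relation: the classes of the pairs `(u, f)` in `𝓛²(w) × 𝓛²(w)` such that `u` is a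
balanced solution of `J u' + q u = w f`. -/
def maximalRelation : Set (r.L2 × r.L2) :=
  {p | ∃ u f : r.FunL2, IsSolution J r u.fn f.fn ∧
    MeasureRep.cls u = p.1 ∧ MeasureRep.cls f = p.2}

/-- The set `Λ` of the points `z` for which `2 J + Δ` or `2 J - Δ` is singular somewhere, where `Δ`
is the jump of `z w - q`. -/
def exceptionalSet : Set ℂ :=
  {z | ∃ x ∈ Ω, (2 • J + (z • jumpW r x - jumpQ r x)).det = 0 ∨
    (2 • J - (z • jumpW r x - jumpQ r x)).det = 0}

/-- The standing assumptions on the coefficients of `J u' + q u = w f`. -/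
structure Coefficients : Prop where
  invertible : IsUnit J
  skew : Jᴴ = -J
  hermitian : IsHermitianDist q
  nonneg : IsNonnegDist w
  add_jump : ∀ x ∈ Ω, IsUnit (2 • J + jumpQ r x)
  sub_jump : ∀ x ∈ Ω, IsUnit (2 • J - jumpQ r x)

/-- `Λ` is a closed set that does not meet the real line and has only isolated points. -/
structure ExceptionalSetDiscrete : Prop where
  closed : IsClosed (exceptionalSet J r)
  not_real : ∀ t : ℝ, (t : ℂ) ∉ exceptionalSet J r
  isolated : ∀ z ∈ exceptionalSet J r, ∀ᶠ y in 𝓝[≠] z, y ∉ exceptionalSet J r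

/-! ### Fundamental matrices -/

/-- `U` is a matrix whose columns are balanced solutions of `J u' + q u = z w u` and which is the
identity at `x₀`. -/
def IsFundamental (x₀ : ℝ) (z : ℂ) (U : ℝ → Matrix (Fin n) (Fin n) ℂ) : Prop :=
  (∀ k, IsSolution J r (fun x => (U x).col k) (z • fun x => (U x).col k)) ∧ U x₀ = 1

open Classical in
/-- The fundamental matrix `U(·, z)` with `U(x₀, z) = 1`. It exists, and is unique on `Ω`, when `z`
is not in `Λ`. -/
noncomputable def fundMatrix (x₀ : ℝ) (z : ℂ) : ℝ → Matrix (Fin n) (Fin n) ℂ :=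
  if h : ∃ U, IsFundamental J r x₀ z U then h.choose else 0

/-- The kernel `𝓛_0`: the balanced solutions of `J u' + q u = 0` with `w u = 0`. -/
def solutionsOfNormZero : Set (ℝ → Fin n → ℂ) :=
  {u | IsSolution J r u 0 ∧ ∀ᵐ x ∂r.μ, r.wd x *ᵥ u x = 0}

/-- The space `N_0` of the values at `x₀` of the elements of `𝓛_0`. -/
def nullValues (x₀ : ℝ) : Submodule ℂ (EuclideanSpace ℂ (Fin n)) :=
  Submodule.span ℂ {v | ∃ u ∈ solutionsOfNormZero J r, v = WithLp.toLp 2 (u x₀)}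

/-- The matrix `P` of the orthogonal projection onto the orthogonal complement of `N_0`. -/
noncomputable def projMatrix (x₀ : ℝ) : Matrix (Fin n) (Fin n) ℂ :=
  Matrix.toEuclideanCLM (𝕜 := ℂ) (n := Fin n) |>.symm (nullValues J r x₀)ᗮ.starProjection

/-! ### The resolvent and Green's function -/

section

variable {J r}

/-- The resolvent set of a linear relation `T`: the points `z` for which `T - z` is injective and
onto. -/
def relResolventSet (T : Submodule ℂ (r.L2 × r.L2)) : Set ℂ :=
  {z | (∀ u, (u, z • u) ∈ T → u = 0) ∧ ∀ f, ∃ u, (u, z • u + f) ∈ T}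

open Classical in
/-- The resolvent `R_z = (T - z)⁻¹`. -/
noncomputable def resolventMap (T : Submodule ℂ (r.L2 × r.L2)) (z : ℂ) (f : r.L2) : r.L2 :=
  if h : ∃ u, (u, z • u + f) ∈ T then h.choose else 0

end

open Classical in
/-- The evaluation operator: it assigns to `(u, f)` in the maximal relation the unique
representative of `u` that is a balanced solution of `J u' + q u = w f` and whose value at `x₀` is
orthogonal to `N_0`. -/
noncomputable def evalMap (x₀ : ℝ) (p : r.L2 × r.L2) : ℝ → Fin n → ℂ :=
  if h : ∃ v : ℝ → Fin n → ℂ, ∃ u f : r.FunL2, u.fn = v ∧ IsSolution J r u.fn f.fn ∧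
      MeasureRep.cls u = p.1 ∧ MeasureRep.cls f = p.2 ∧
      WithLp.toLp 2 (u.fn x₀) ∈ (nullValues J r x₀)ᗮ
  then h.choose else 0

/-- `E_z f`, the evaluation operator applied to `(R_z f, z R_z f + f)`. -/
noncomputable def resolventEval (T : Submodule ℂ (r.L2 × r.L2)) (x₀ : ℝ) (z : ℂ) (f : r.L2) :
    ℝ → Fin n → ℂ :=
  evalMap J r x₀ (resolventMap T z f, z • resolventMap T z f + f)

/-- `f` vanishes outside a compact subset of `Ω`. -/
def IsCompactlySupported (Ω : Opens ℝ) (f : ℝ → Fin n → ℂ) : Prop :=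
  ∃ K ⊆ (Ω : Set ℝ), IsCompact K ∧ ∀ x ∉ K, f x = 0

/-- The balanced characteristic function of `(x₀, ∞)`. -/
noncomputable def charRight (x₀ y : ℝ) : ℂ := if x₀ < y then 1 else if y = x₀ then 1 / 2 else 0

/-- The balanced characteristic function of `(-∞, x₀)`. -/
noncomputable def charLeft (x₀ y : ℝ) : ℂ := if y < x₀ then 1 else if y = x₀ then 1 / 2 else 0

/-- The matrix `S(x, z) = U(x, z)⁻¹ (U⁺(x, z) - U⁻(x, z)) J⁻¹ / 4`. -/
noncomputable def jumpTerm (x₀ : ℝ) (z : ℂ) (x : ℝ) : Matrix (Fin n) (Fin n) ℂ :=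
  (1 / 4 : ℂ) • ((fundMatrix J r x₀ z x)⁻¹ *
    (Function.rightLim (fundMatrix J r x₀ z) x - Function.leftLim (fundMatrix J r x₀ z) x) * J⁻¹)

/-- The kernel `H(x, y, z)` formed with the matrices `Mm = M_-` and `Mp = M_+`. -/
noncomputable def kernelH (x₀ : ℝ) (z : ℂ) (Mm Mp : Matrix (Fin n) (Fin n) ℂ) (x y : ℝ) :
    Matrix (Fin n) (Fin n) ℂ :=
  charLeft x₀ y • Mm + charRight x₀ y • Mp - ((1 / 2 : ℂ) * (SignType.sign (y - x) : ℂ)) • J⁻¹ +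
    if y = x then jumpTerm J r x₀ z x else 0

/-- The vector `U(y, z̄)^* w f` as a density with respect to `μ`. -/
noncomputable def adjDensity (x₀ : ℝ) (z : ℂ) (f : ℝ → Fin n → ℂ) (y : ℝ) : Fin n → ℂ :=
  (fundMatrix J r x₀ (star z) y)ᴴ *ᵥ r.wd y *ᵥ f y

/-- The matrices `Mm = M_-(z)` and `Mp = M_+(z)` are those in Green's function for `T - z`, i.e.,
`(E_z f)(x) = ∫ U(x, z) H(x, ·, z) U(·, z̄)^* w f` for compactly supported `f`. -/
def IsGreenPair (T : Submodule ℂ (r.L2 × r.L2)) (x₀ : ℝ) (z : ℂ)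
    (Mm Mp : Matrix (Fin n) (Fin n) ℂ) : Prop :=
  ∀ f : r.FunL2, IsCompactlySupported Ω f.fn → ∀ x ∈ Ω,
    resolventEval J r T x₀ z (MeasureRep.cls f) x =
      ∫ y, (fundMatrix J r x₀ z x * kernelH J r x₀ z Mm Mp x y) *ᵥ adjDensity J r x₀ z f.fn y ∂r.μ

/-- The space `B_+` of the vectors `∫_{(x₀, b)} U(·, z̄)^* w f`, `f` compactly supported. -/
def BPlus (x₀ : ℝ) (z : ℂ) : Set (Fin n → ℂ) :=
  {ζ | ∃ f : r.FunL2, IsCompactlySupported Ω f.fn ∧ ζ = ∫ y in Ioi x₀, adjDensity J r x₀ z f.fn y ∂r.μ}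

/-- The space `B_-` of the vectors `∫_{(a, x₀)} U(·, z̄)^* w f`, `f` compactly supported. -/
def BMinus (x₀ : ℝ) (z : ℂ) : Set (Fin n → ℂ) :=
  {ζ | ∃ f : r.FunL2, IsCompactlySupported Ω f.fn ∧ ζ = ∫ y in Iio x₀, adjDensity J r x₀ z f.fn y ∂r.μ}

/-- `A` is the value at `z` of the `M`-function of `T`: `A ζ` is `P M_+(z) ζ` for `ζ` in `B_+`,
`P M_-(z) ζ` for `ζ` in `B_-`, and `0` for `ζ` in `N_0`. -/
def IsMValue (T : Submodule ℂ (r.L2 × r.L2)) (x₀ : ℝ) (z : ℂ) (A : Matrix (Fin n) (Fin n) ℂ) :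
    Prop :=
  ∃ Mm Mp : Matrix (Fin n) (Fin n) ℂ, IsGreenPair J r T x₀ z Mm Mp ∧
    (∀ ζ ∈ BPlus J r x₀ z, A *ᵥ ζ = (projMatrix J r x₀ * Mp) *ᵥ ζ) ∧
    (∀ ζ ∈ BMinus J r x₀ z, A *ᵥ ζ = (projMatrix J r x₀ * Mm) *ᵥ ζ) ∧
    ∀ ζ, WithLp.toLp 2 ζ ∈ nullValues J r x₀ → A *ᵥ ζ = 0

end


end OrderZero

open OrderZero

/-! The `M`-function is the Weyl function of a boundary problem at the interior point `x₀`. Consider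
triples `d = (Y, H, ζ)` in which `Y` has compact support and solves `J Y' + q Y = w H - ζ δ`, with
`δ` the unit mass at `x₀`, and put `y = Y(x₀)`. There are no boundary terms at the ends of the
interval, so Green's identity only sees `x₀`: for `(u, g)` in `T` with normalized representative
`u`, `⟨u, H⟩ - ⟨g, Y⟩ = u(x₀)^* ζ`, and for two triples `⟨Y, H'⟩ - ⟨H, Y'⟩ = y^* ζ' - ζ^* y'`.
Moreover, `ζ` runs through exactly `N_0^⊥`.

For `z` in the resolvent set let `u = R_z (H - z Y)` and set `M(z) ζ = u(x₀) - P y`, and `M(z) = 0`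
on `N_0`. Green's identity turns `⟨ζ', M(z) ζ⟩` into an expression in `R_z` and the fixed classes of
`Y, H, Y', H'` (`weylForm`). All the assertions can be read off from it. It is analytic because
`R_z` is. It is Hermitian under `z ↦ z̄` because `R_z^* = R_{z̄}` (`star_weylForm`), which also
shows that the value depends on `d` only through `ζ`. Its imaginary part is `Im z ‖R_z (H - z Y) -
Y‖²` (`weylForm_sub_star`). The triples do not depend on `z`, so the points of `Λ` play no special
role and `M` is defined on the whole resolvent set. This abstract argument is `exists_weylMap`.

To identify the result with Green's function, let `z ∉ Λ`, let `f` have compact support and let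
`ζ_±` be the two integrals of `U(·, z̄)^* w f` over the two sides of `x₀`. The equation with
parameter `z`, right-hand side `f` and a source at `x₀` has a compactly supported solution with `H =
z Y + f`, `ζ = ζ_+ + ζ_-` and `y = J⁻¹ (ζ_- - ζ_+) / 2` (`exists_mem_boundaryData`). Hence `(E_z
f)(x₀) = M(z)(ζ_+ + ζ_-) + P y`, and comparison with Green's formula at `x₀` gives `P M_± = M` on
`B_±`. Green's formula at the other points follows from the one at `x₀` by variation of constants
(`eq_fundMatrix_mulVec`, `isGreenPair_iff`). Uniqueness holds because `B_+`, `B_-` and `N_0`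
together span `ℂ^n`.

The analytic groundwork is a theory of balanced solutions of linear systems with measure
coefficients. A balanced function of locally bounded variation with derivative `F dμ` has increments
equal to the mean of the integrals of `F` over the two half-open intervals (`IsPrimitive`). Initial
value problems reduce to Volterra equations over strict chains (`exists_volterra`), once the jump at
each atom is resolved by inverting a matrix, which is possible off `Λ`. Completeness of `L²(w)` is
needed in order that non-real points lie in the resolvent set (`completeSpace_funL2`). -/

set_option linter.unusedSectionVars false

namespace OrderZero

/-! ### Balanced primitives -/

section Primitive

variable {E : Type*} [NormedAddCommGroup E] [NormedSpace ℝ E]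

/-- `F` is integrable with respect to `μ` on the compact subintervals of `Ω`. -/
def LocIntegrable (Ω : Opens ℝ) (μ : Measure ℝ) (F : ℝ → E) : Prop :=
  ∀ c ∈ Ω, ∀ d ∈ Ω, IntegrableOn F (Icc c d) μ

/-- `u` is a balanced function with `du = F dμ` on `Ω`. -/
def IsPrimitive (Ω : Opens ℝ) (μ : Measure ℝ) (u F : ℝ → E) : Prop :=
  ∀ c ∈ Ω, ∀ d ∈ Ω, c ≤ d →
    u d - u c = (1 / 2 : ℝ) • ((∫ x in Ioc c d, F x ∂μ) + ∫ x in Ico c d, F x ∂μ)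

/-- The left-hand value of a balanced primitive. -/
noncomputable def leftVal (μ : Measure ℝ) (u F : ℝ → E) (x : ℝ) : E :=
  u x - (1 / 2 : ℝ) • (μ.real {x} • F x)

/-- The right-hand value of a balanced primitive. -/
noncomputable def rightVal (μ : Measure ℝ) (u F : ℝ → E) (x : ℝ) : E :=
  u x + (1 / 2 : ℝ) • (μ.real {x} • F x)

variable {Ω : Opens ℝ} {μ : Measure ℝ} {u F : ℝ → E}

theorem LocIntegrable.sub_set (hF : LocIntegrable Ω μ F) {c d : ℝ} (hc : c ∈ Ω) (hd : d ∈ Ω)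
    {s : Set ℝ} (hs : s ⊆ Icc c d) : IntegrableOn F s μ :=
  (hF c hc d hd).mono_set hs

variable [CompleteSpace E]

theorem LocIntegrable.integral_Ico (hF : LocIntegrable Ω μ F) {c d : ℝ} (hc : c ∈ Ω) (hd : d ∈ Ω)
    (h : c < d) : ∫ x in Ico c d, F x ∂μ = μ.real {c} • F c + ∫ x in Ioo c d, F x ∂μ := by
  rw [← Ioo_union_left h, union_comm, setIntegral_union (by simp) measurableSet_Ioo
    (hF.sub_set hc hd (by simp [h.le])) (hF.sub_set hc hd Ioo_subset_Icc_self)]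
  simp [Measure.real]

theorem LocIntegrable.integral_Ioc (hF : LocIntegrable Ω μ F) {c d : ℝ} (hc : c ∈ Ω) (hd : d ∈ Ω)
    (h : c < d) : ∫ x in Ioc c d, F x ∂μ = μ.real {d} • F d + ∫ x in Ioo c d, F x ∂μ := by
  rw [← Ioo_union_right h, union_comm, setIntegral_union (by simp) measurableSet_Ioo
    (hF.sub_set hc hd (by simp [h.le])) (hF.sub_set hc hd Ioo_subset_Icc_self)]
  simp [Measure.real]

/-- A balanced increment counts the atoms at both ends with weight one half. Passing to left-hand
values removes the half atom at `d` and completes the one at `c`, so that an integral over a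
half-open interval remains. -/
theorem IsPrimitive.leftVal_sub (h : IsPrimitive Ω μ u F) (hF : LocIntegrable Ω μ F) {c d : ℝ}
    (hc : c ∈ Ω) (hd : d ∈ Ω) (hcd : c ≤ d) :
    leftVal μ u F d - leftVal μ u F c = ∫ x in Ico c d, F x ∂μ := by
  rcases hcd.eq_or_lt with rfl | hlt
  · simp
  have h1 := h c hc d hd hcd
  rw [hF.integral_Ioc hc hd hlt, hF.integral_Ico hc hd hlt] at h1
  rw [hF.integral_Ico hc hd hlt, leftVal, leftVal, sub_sub_sub_comm, h1]
  module

theorem IsPrimitive.rightVal_sub (h : IsPrimitive Ω μ u F) (hF : LocIntegrable Ω μ F) {c d : ℝ}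
    (hc : c ∈ Ω) (hd : d ∈ Ω) (hcd : c ≤ d) :
    rightVal μ u F d - rightVal μ u F c = ∫ x in Ioc c d, F x ∂μ := by
  rcases hcd.eq_or_lt with rfl | hlt
  · simp
  have h1 := h c hc d hd hcd
  rw [hF.integral_Ioc hc hd hlt, hF.integral_Ico hc hd hlt] at h1
  rw [hF.integral_Ioc hc hd hlt, rightVal, rightVal, add_sub_add_comm, h1]
  module

theorem IsPrimitive.norm_sub_le (h : IsPrimitive Ω μ u F) {c d : ℝ}
    (hc : c ∈ Ω) (hd : d ∈ Ω) (hcd : c ≤ d) :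
    ‖u d - u c‖ ≤ (1 / 2 : ℝ) * ((∫ x in Ioc c d, ‖F x‖ ∂μ) + ∫ x in Ico c d, ‖F x‖ ∂μ) := by
  rw [h c hc d hd hcd, norm_smul]
  norm_num
  exact (norm_add_le _ _).trans (add_le_add (norm_integral_le_integral_norm _)
    (norm_integral_le_integral_norm _))

theorem LocIntegrable.norm (hF : LocIntegrable Ω μ F) : LocIntegrable Ω μ (fun x => ‖F x‖) :=
  fun c hc d hd => (hF c hc d hd).norm

theorem exists_lt_mem (Ω : Opens ℝ) {x : ℝ} (hx : x ∈ Ω) : ∃ c ∈ Ω, c < x ∧ Icc c x ⊆ Ω := by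
  obtain ⟨ε, hε, h⟩ := Metric.isOpen_iff.1 Ω.isOpen x hx
  refine ⟨x - ε / 2, h ?_, by linarith, fun y hy => h ?_⟩
  · rw [Metric.mem_ball, Real.dist_eq, abs_lt]; constructor <;> linarith
  · rw [Metric.mem_ball, Real.dist_eq, abs_lt]; constructor <;> linarith [hy.1, hy.2]

theorem exists_gt_mem (Ω : Opens ℝ) {x : ℝ} (hx : x ∈ Ω) : ∃ c ∈ Ω, x < c ∧ Icc x c ⊆ Ω := by
  obtain ⟨ε, hε, h⟩ := Metric.isOpen_iff.1 Ω.isOpen x hx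
  refine ⟨x + ε / 2, h ?_, by linarith, fun y hy => h ?_⟩
  · rw [Metric.mem_ball, Real.dist_eq, abs_lt]; constructor <;> linarith
  · rw [Metric.mem_ball, Real.dist_eq, abs_lt]; constructor <;> linarith [hy.1, hy.2]

theorem LocIntegrable.tendsto_integral_Ico (hF : LocIntegrable Ω μ F) {x : ℝ} (hx : x ∈ Ω) :
    Tendsto (fun t => ∫ s in Ico t x, F s ∂μ) (𝓝[<] x) (𝓝 0) := by
  obtain ⟨c, hc, hcx, -⟩ := exists_lt_mem Ω hx
  have e : ∀ t, ∫ s in Ico t x, F s ∂μ = ∫ s, (Ico t x).indicator F s ∂μ := fun t =>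
    (integral_indicator measurableSet_Ico).symm
  simp only [e]
  rw [show (0 : E) = ∫ s, (0 : E) ∂μ by simp]
  have hI : Integrable ((Ico c x).indicator F) μ :=
    (hF.sub_set hc hx Ico_subset_Icc_self).integrable_indicator measurableSet_Ico
  have hev : ∀ᶠ t in 𝓝[<] x, c < t := by
    filter_upwards [Ioo_mem_nhdsLT hcx] with t ht using ht.1
  apply tendsto_integral_filter_of_dominated_convergence (fun s => ‖(Ico c x).indicator F s‖)
  · filter_upwards [hev] with t ht
    exact ((hF.sub_set hc hx Ico_subset_Icc_self).mono_set
      (Ico_subset_Ico_left ht.le)).integrable_indicator measurableSet_Ico |>.aestronglyMeasurable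
  · filter_upwards [hev] with t ht
    refine ae_of_all _ fun s => ?_
    exact norm_indicator_le_of_subset (Ico_subset_Ico_left ht.le) _ _
  · exact hI.norm
  · refine ae_of_all _ fun s => ?_
    apply tendsto_const_nhds.congr'
    rcases lt_or_ge s x with hs | hs
    · filter_upwards [Ioo_mem_nhdsLT hs] with t ht
      rw [indicator_of_notMem]
      exact fun h => absurd h.1 (not_le.2 ht.1)
    · refine Eventually.of_forall fun t => ?_
      dsimp only
      rw [indicator_of_notMem]
      exact fun h => absurd h.2 (not_lt.2 hs)

theorem LocIntegrable.tendsto_integral_Ioc (hF : LocIntegrable Ω μ F) {x : ℝ} (hx : x ∈ Ω) :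
    Tendsto (fun t => ∫ s in Ioc x t, F s ∂μ) (𝓝[>] x) (𝓝 0) := by
  obtain ⟨c, hc, hcx, -⟩ := exists_gt_mem Ω hx
  have e : ∀ t, ∫ s in Ioc x t, F s ∂μ = ∫ s, (Ioc x t).indicator F s ∂μ := fun t =>
    (integral_indicator measurableSet_Ioc).symm
  simp only [e]
  rw [show (0 : E) = ∫ s, (0 : E) ∂μ by simp]
  have hI : Integrable ((Ioc x c).indicator F) μ :=
    (hF.sub_set hx hc Ioc_subset_Icc_self).integrable_indicator measurableSet_Ioc
  have hev : ∀ᶠ t in 𝓝[>] x, t < c := by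
    filter_upwards [Ioo_mem_nhdsGT hcx] with t ht using ht.2
  apply tendsto_integral_filter_of_dominated_convergence (fun s => ‖(Ioc x c).indicator F s‖)
  · filter_upwards [hev] with t ht
    exact ((hF.sub_set hx hc Ioc_subset_Icc_self).mono_set
      (Ioc_subset_Ioc_right ht.le)).integrable_indicator measurableSet_Ioc |>.aestronglyMeasurable
  · filter_upwards [hev] with t ht
    refine ae_of_all _ fun s => ?_
    exact norm_indicator_le_of_subset (Ioc_subset_Ioc_right ht.le) _ _
  · exact hI.norm
  · refine ae_of_all _ fun s => ?_
    apply tendsto_const_nhds.congr'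
    rcases lt_or_ge x s with hs | hs
    · filter_upwards [Ioo_mem_nhdsGT hs] with t ht
      rw [indicator_of_notMem]
      exact fun h => absurd h.2 (not_le.2 ht.2)
    · refine Eventually.of_forall fun t => ?_
      dsimp only
      rw [indicator_of_notMem]
      exact fun h => absurd h.1 (not_lt.2 hs)

theorem LocIntegrable.norm_atom_le (hF : LocIntegrable Ω μ F) {c d x : ℝ} (hc : c ∈ Ω)
    (hd : d ∈ Ω) {s : Set ℝ} (hs : s ⊆ Icc c d) (hx : x ∈ s) :
    ‖μ.real {x} • F x‖ ≤ ∫ t in s, ‖F t‖ ∂μ := by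
  have h1 : ∫ t in {x}, ‖F t‖ ∂μ ≤ ∫ t in s, ‖F t‖ ∂μ :=
    setIntegral_mono_set (hF.norm.sub_set hc hd hs) (ae_of_all _ fun _ => norm_nonneg _)
      (singleton_subset_iff.2 hx).eventuallyLE
  rw [norm_smul, Real.norm_of_nonneg measureReal_nonneg]
  simpa [Measure.real] using h1

theorem IsPrimitive.tendsto_left (h : IsPrimitive Ω μ u F) (hF : LocIntegrable Ω μ F) {x : ℝ}
    (hx : x ∈ Ω) : Tendsto u (𝓝[<] x) (𝓝 (leftVal μ u F x)) := by
  obtain ⟨c, hc, hcx, hcΩ⟩ := exists_lt_mem Ω hx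
  -- The constant `3 / 2` used below is `1` for the integral over `[t, x)` plus `1 / 2` for the half
  -- atom that the balanced value carries at `t`, which is itself bounded by that integral.
  rw [tendsto_iff_norm_sub_tendsto_zero]
  have h1 := (hF.norm.tendsto_integral_Ico hx).const_mul (3 / 2)
  rw [mul_zero] at h1
  refine squeeze_zero' (Eventually.of_forall fun _ => norm_nonneg _) ?_ h1
  filter_upwards [Ioo_mem_nhdsLT hcx] with t ht
  have htΩ : t ∈ Ω := hcΩ ⟨ht.1.le, ht.2.le⟩
  have e : u t - leftVal μ u F x = (1 / 2 : ℝ) • (μ.real {t} • F t) - ∫ s in Ico t x, F s ∂μ := by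
    rw [← h.leftVal_sub hF htΩ hx ht.2.le]
    simp only [leftVal]
    module
  have h3 := hF.norm_atom_le (x := t) htΩ hx Ico_subset_Icc_self ⟨le_rfl, ht.2⟩
  have h4 : ‖∫ s in Ico t x, F s ∂μ‖ ≤ ∫ s in Ico t x, ‖F s‖ ∂μ := norm_integral_le_integral_norm _
  rw [e]
  refine (_root_.norm_sub_le _ _).trans ?_
  rw [norm_smul]
  norm_num
  linarith

theorem IsPrimitive.tendsto_right (h : IsPrimitive Ω μ u F) (hF : LocIntegrable Ω μ F) {x : ℝ}
    (hx : x ∈ Ω) : Tendsto u (𝓝[>] x) (𝓝 (rightVal μ u F x)) := by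
  obtain ⟨c, hc, hcx, hcΩ⟩ := exists_gt_mem Ω hx
  rw [tendsto_iff_norm_sub_tendsto_zero]
  have h1 := (hF.norm.tendsto_integral_Ioc hx).const_mul (3 / 2)
  rw [mul_zero] at h1
  refine squeeze_zero' (Eventually.of_forall fun _ => norm_nonneg _) ?_ h1
  filter_upwards [Ioo_mem_nhdsGT hcx] with t ht
  have htΩ : t ∈ Ω := hcΩ ⟨ht.1.le, ht.2.le⟩
  have e : u t - rightVal μ u F x = -((1 / 2 : ℝ) • (μ.real {t} • F t)) + ∫ s in Ioc x t, F s ∂μ := by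
    rw [← h.rightVal_sub hF hx htΩ ht.1.le]
    simp only [rightVal]
    module
  have h3 := hF.norm_atom_le (x := t) hx htΩ Ioc_subset_Icc_self ⟨ht.1, le_rfl⟩
  have h4 : ‖∫ s in Ioc x t, F s ∂μ‖ ≤ ∫ s in Ioc x t, ‖F s‖ ∂μ := norm_integral_le_integral_norm _
  rw [e]
  refine (norm_add_le _ _).trans ?_
  rw [norm_neg, norm_smul]
  norm_num
  linarith

theorem IsPrimitive.leftLim_eq (h : IsPrimitive Ω μ u F) (hF : LocIntegrable Ω μ F) {x : ℝ}
    (hx : x ∈ Ω) : Function.leftLim u x = leftVal μ u F x :=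
  leftLim_eq_of_tendsto (h.tendsto_left hF hx)

theorem IsPrimitive.rightLim_eq (h : IsPrimitive Ω μ u F) (hF : LocIntegrable Ω μ F) {x : ℝ}
    (hx : x ∈ Ω) : Function.rightLim u x = rightVal μ u F x :=
  rightLim_eq_of_tendsto (h.tendsto_right hF hx)

theorem IsPrimitive.locallyBoundedVariationOn (h : IsPrimitive Ω μ u F)
    (hF : LocIntegrable Ω μ F) : LocallyBoundedVariationOn u Ω := by
  intro a b ha hb
  -- The increments of `u` are dominated by those of the monotone function `m`, the balanced
  -- primitive of `‖F‖`, so the variation of `u` is at most that of `m`.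
  let m : ℝ → ℝ := fun x =>
    (1 / 2 : ℝ) * ((∫ s in Ioc a x, ‖F s‖ ∂μ) + ∫ s in Ico a x, ‖F s‖ ∂μ)
  have key : ∀ x ∈ (Ω : Set ℝ) ∩ Icc a b, ∀ y ∈ (Ω : Set ℝ) ∩ Icc a b, x ≤ y →
      ‖u y - u x‖ ≤ m y - m x := by
    intro x hx y hy hxy
    refine (h.norm_sub_le hx.1 hy.1 hxy).trans_eq ?_
    have e1 : ∫ s in Ioc a y, ‖F s‖ ∂μ = (∫ s in Ioc a x, ‖F s‖ ∂μ) + ∫ s in Ioc x y, ‖F s‖ ∂μ := by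
      rw [← Ioc_union_Ioc_eq_Ioc hx.2.1 hxy, setIntegral_union (Ioc_disjoint_Ioc_of_le le_rfl)
        measurableSet_Ioc (hF.norm.sub_set ha hx.1 Ioc_subset_Icc_self)
        (hF.norm.sub_set hx.1 hy.1 Ioc_subset_Icc_self)]
    have e2 : ∫ s in Ico a y, ‖F s‖ ∂μ = (∫ s in Ico a x, ‖F s‖ ∂μ) + ∫ s in Ico x y, ‖F s‖ ∂μ := by
      rw [← Ico_union_Ico_eq_Ico hx.2.1 hxy, setIntegral_union (Ico_disjoint_Ico.2 (by simp [hxy, hx.2.1]))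
        measurableSet_Ico (hF.norm.sub_set ha hx.1 Ico_subset_Icc_self)
        (hF.norm.sub_set hx.1 hy.1 Ico_subset_Icc_self)]
    simp only [m]
    rw [e1, e2]
    ring
  have hmono : MonotoneOn m ((Ω : Set ℝ) ∩ Icc a b) := fun x hx y hy hxy =>
    sub_nonneg.1 ((norm_nonneg _).trans (key x hx y hy hxy))
  rcases le_or_gt a b with hab | hab
  swap
  · simp [BoundedVariationOn, Icc_eq_empty (not_le.2 hab)]
  have hm : BoundedVariationOn m ((Ω : Set ℝ) ∩ Icc a b) := by
    have := hmono.eVariationOn_eq (a := a) (b := b) ⟨ha, le_rfl, hab⟩ ⟨hb, hab, le_rfl⟩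
    rw [inter_assoc, inter_self] at this
    exact ne_top_of_le_ne_top ENNReal.ofReal_ne_top this.le
  refine ne_top_of_le_ne_top hm (iSup_le fun p => ?_)
  refine le_trans (Finset.sum_le_sum fun i _ => ?_) (eVariationOn.sum_le (f := m) p.2.2.1 p.2.2.2)
  have := key _ (p.2.2.2 i) _ (p.2.2.2 (i + 1)) (p.2.2.1 (Nat.le_succ i))
  rw [edist_dist, edist_dist, dist_eq_norm, dist_eq_norm]
  exact ENNReal.ofReal_le_ofReal (this.trans (le_abs_self _))

theorem balanced_of_isPrimitive {n : ℕ} {u F : ℝ → Fin n → ℂ} (h : IsPrimitive Ω μ u F)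
    (hF : LocIntegrable Ω μ F) : IsBalanced Ω u := by
  refine ⟨h.locallyBoundedVariationOn hF, fun x hx => ?_⟩
  rw [h.leftLim_eq hF hx, h.rightLim_eq hF hx]
  simp only [leftVal, rightVal]
  module

end Primitive

end OrderZero

namespace OrderZero

/-! ### Integration by parts -/

theorem charRight_add (s t : ℝ) : charRight s t + charRight t s = 1 := by
  rcases lt_trichotomy s t with h | h | h
  · simp [charRight, h, h.ne, h.not_gt]
  · simp [charRight, h]; norm_num
  · simp [charRight, h, h.ne, h.not_gt]

theorem norm_charRight_le (s t : ℝ) : ‖charRight s t‖ ≤ 1 := by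
  unfold charRight
  split_ifs <;> norm_num

theorem measurable_charRight : Measurable fun p : ℝ × ℝ => charRight p.1 p.2 := by
  unfold charRight
  exact Measurable.ite (measurableSet_lt measurable_fst measurable_snd) measurable_const
    (Measurable.ite (measurableSet_eq_fun measurable_snd measurable_fst) measurable_const
      measurable_const)

/-- The weight one half on the diagonal makes the integral operator with kernel `charRight` produce
balanced primitives. -/
theorem integral_charRight_mul {μ : Measure ℝ} {F : ℝ → ℂ} {c d t : ℝ}
    (hF : IntegrableOn F (Ico c d) μ) (ht : t ∈ Ico c d) :
    ∫ s in Ico c d, charRight s t * F s ∂μ =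
      (∫ s in Ico c t, F s ∂μ) + (1 / 2 : ℝ) • (μ.real {t} • F t) := by
  have e : ∀ s, charRight s t * F s =
      (Iio t).indicator F s + (1 / 2 : ℝ) • ({t} : Set ℝ).indicator F s := by
    intro s
    rcases lt_trichotomy s t with h | h | h
    · simp [charRight, h, h.ne]
    · simp [charRight, h]
    · simp [charRight, h.ne, h.ne', h.not_gt]
  simp only [e]
  have i2 : Integrable (fun s => (1 / 2 : ℝ) • ({t} : Set ℝ).indicator F s)
      (μ.restrict (Ico c d)) :=
    Integrable.smul (1 / 2 : ℝ) (hF.integrable.indicator (measurableSet_singleton t))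
  rw [integral_add (hF.integrable.indicator measurableSet_Iio) i2, integral_smul,
    setIntegral_indicator measurableSet_Iio, setIntegral_indicator (measurableSet_singleton t)]
  have e1 : Ico c d ∩ Iio t = Ico c t := by
    ext x; simp only [mem_inter_iff, mem_Ico, mem_Iio]
    exact ⟨fun h => ⟨h.1.1, h.2⟩, fun h => ⟨⟨h.1, h.2.trans ht.2⟩, h.2⟩⟩
  have e2 : Ico c d ∩ {t} = {t} := inter_eq_right.2 (singleton_subset_iff.2 ht)
  rw [e1, e2]
  simp [Measure.real]

/-- Fubini on the product measure: the two kernels cover the square, and each counts the diagonal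
with weight one half, so their sum is the constant kernel `1`. Common atoms of the two measures
therefore leave no correction term. -/
theorem integral_mul_integral_charRight {μ ν : Measure ℝ} [SFinite μ] [SFinite ν] {F G : ℝ → ℂ}
    (hF : Integrable F μ) (hG : Integrable G ν) :
    Integrable (fun t => (∫ s, charRight s t * F s ∂μ) * G t) ν ∧
    Integrable (fun t => F t * ∫ s, charRight s t * G s ∂ν) μ ∧
    (∫ t, (∫ s, charRight s t * F s ∂μ) * G t ∂ν) + (∫ t, F t * ∫ s, charRight s t * G s ∂ν ∂μ) =
      (∫ t, F t ∂μ) * ∫ t, G t ∂ν := by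
  have h1 : Integrable (fun z : ℝ × ℝ => charRight z.1 z.2 * (F z.1 * G z.2)) (μ.prod ν) :=
    (hF.mul_prod hG).bdd_mul measurable_charRight.aestronglyMeasurable
      (ae_of_all _ fun z => norm_charRight_le _ _)
  have h2 : Integrable (fun z : ℝ × ℝ => charRight z.2 z.1 * (F z.1 * G z.2)) (μ.prod ν) :=
    (hF.mul_prod hG).bdd_mul (measurable_charRight.comp measurable_swap).aestronglyMeasurable
      (ae_of_all _ fun z => norm_charRight_le _ _)
  have e1 : ∀ t, (∫ s, charRight s t * F s ∂μ) * G t = ∫ s, charRight s t * (F s * G t) ∂μ := by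
    intro t
    rw [← integral_mul_const]
    simp only [mul_assoc]
  have e2 : ∀ t, F t * ∫ s, charRight s t * G s ∂ν = ∫ s, charRight s t * (F t * G s) ∂ν := by
    intro t
    rw [← integral_const_mul]
    exact integral_congr_ae (ae_of_all _ fun s => by ring)
  simp only [e1, e2]
  refine ⟨h1.integral_prod_right, h2.integral_prod_left, ?_⟩
  rw [← integral_integral_swap (f := fun s t => charRight s t * (F s * G t)) h1,
    ← integral_add h1.integral_prod_left h2.integral_prod_left, ← integral_mul_const]
  refine integral_congr_ae ?_
  filter_upwards [h1.prod_right_ae, h2.prod_right_ae] with s hs1 hs2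
  rw [← integral_add hs1 hs2, ← integral_const_mul]
  refine integral_congr_ae (ae_of_all _ fun t => ?_)
  dsimp only
  rw [← add_mul, charRight_add, one_mul]

variable {Ω : Opens ℝ} {μ ν : Measure ℝ}

theorem IsPrimitive.eq_integral_charRight {u F : ℝ → ℂ} (h : IsPrimitive Ω μ u F)
    (hF : LocIntegrable Ω μ F) (hΩ : (Ω : Set ℝ).OrdConnected) {c d t : ℝ} (hc : c ∈ Ω) (hd : d ∈ Ω)
    (ht : t ∈ Ico c d) :
    u t = leftVal μ u F c + ∫ s in Ico c d, charRight s t * F s ∂μ := by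
  have htΩ : t ∈ Ω := hΩ.out hc hd ⟨ht.1, ht.2.le⟩
  rw [integral_charRight_mul (hF.sub_set hc hd Ico_subset_Icc_self) ht,
    ← h.leftVal_sub hF hc htΩ ht.1, leftVal, leftVal]
  module

/-- Integration by parts for balanced primitives. -/
theorem IsPrimitive.mul [SFinite μ] [SFinite ν] {u F v G : ℝ → ℂ} (hu : IsPrimitive Ω μ u F)
    (hF : LocIntegrable Ω μ F) (hv : IsPrimitive Ω ν v G) (hG : LocIntegrable Ω ν G)
    (hΩ : (Ω : Set ℝ).OrdConnected) {c d : ℝ} (hc : c ∈ Ω) (hd : d ∈ Ω) (hcd : c ≤ d) :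
    IntegrableOn (fun x => u x * G x) (Ico c d) ν ∧ IntegrableOn (fun x => F x * v x) (Ico c d) μ ∧
    (∫ x in Ico c d, u x * G x ∂ν) + ∫ x in Ico c d, F x * v x ∂μ =
      leftVal μ u F d * leftVal ν v G d - leftVal μ u F c * leftVal ν v G c := by
  have hF' : Integrable F (μ.restrict (Ico c d)) := hF.sub_set hc hd Ico_subset_Icc_self
  have hG' : Integrable G (ν.restrict (Ico c d)) := hG.sub_set hc hd Ico_subset_Icc_self
  obtain ⟨i1, i2, e⟩ := integral_mul_integral_charRight hF' hG'
  have a1 : ∀ᵐ x ∂ν.restrict (Ico c d), u x * G x = leftVal μ u F c * G x +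
      (∫ s in Ico c d, charRight s x * F s ∂μ) * G x := by
    filter_upwards [ae_restrict_mem measurableSet_Ico] with x hx
    rw [hu.eq_integral_charRight hF hΩ hc hd hx, add_mul]
  have a2 : ∀ᵐ x ∂μ.restrict (Ico c d), F x * v x = F x * leftVal ν v G c +
      F x * ∫ s in Ico c d, charRight s x * G s ∂ν := by
    filter_upwards [ae_restrict_mem measurableSet_Ico] with x hx
    rw [hv.eq_integral_charRight hG hΩ hc hd hx, mul_add]
  refine ⟨(((hG'.const_mul _).add i1).congr (EventuallyEq.symm a1)),
    (((hF'.mul_const _).add i2).congr (EventuallyEq.symm a2)), ?_⟩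
  rw [integral_congr_ae a1, integral_congr_ae a2, integral_add (hG'.const_mul _) i1,
    integral_add (hF'.mul_const _) i2, integral_const_mul, integral_mul_const]
  have h1 := hu.leftVal_sub hF hc hd hcd
  have h2 := hv.leftVal_sub hG hc hd hcd
  linear_combination e - (leftVal ν v G c + ∫ x in Ico c d, G x ∂ν) * h1 - leftVal μ u F d * h2

/-! ### Functions of locally bounded variation -/

/-- The real and imaginary parts are differences of functions that are monotone on `Ω`. -/
theorem _root_.LocallyBoundedVariationOn.bounded_aestronglyMeasurable {u : ℝ → ℂ}
    (hu : LocallyBoundedVariationOn u (Ω : Set ℝ)) (hΩ : (Ω : Set ℝ).OrdConnected) {c d : ℝ}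
    (hc : c ∈ Ω) (hd : d ∈ Ω) :
    (∃ B, ∀ x ∈ Icc c d, ‖u x‖ ≤ B) ∧ AEStronglyMeasurable u (μ.restrict (Icc c d)) := by
  have key : ∀ f : ℝ → ℝ, LocallyBoundedVariationOn f (Ω : Set ℝ) →
      (∃ B, ∀ x ∈ Icc c d, ‖f x‖ ≤ B) ∧ AEStronglyMeasurable f (μ.restrict (Icc c d)) := by
    intro f hf
    obtain ⟨p, q, hp, hq, rfl⟩ := hf.exists_monotoneOn_sub_monotoneOn
    have hsub : Icc c d ⊆ (Ω : Set ℝ) := hΩ.out hc hd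
    have hb : ∀ p : ℝ → ℝ, MonotoneOn p (Ω : Set ℝ) →
        ∀ x ∈ Icc c d, ‖p x‖ ≤ |p c| + |p d| := by
      intro p hp x hx
      have h1 := hp hc (hsub hx) hx.1
      have h2 := hp (hsub hx) hd hx.2
      rw [Real.norm_eq_abs, abs_le]
      constructor
      · linarith [neg_abs_le (p c), abs_nonneg (p d)]
      · linarith [le_abs_self (p d), abs_nonneg (p c)]
    refine ⟨⟨(|p c| + |p d|) + (|q c| + |q d|), fun x hx => ?_⟩, ?_⟩
    · exact (norm_sub_le _ _).trans (add_le_add (hb p hp x hx) (hb q hq x hx))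
    · exact ((aemeasurable_restrict_of_monotoneOn measurableSet_Icc (hp.mono hsub)).sub
        (aemeasurable_restrict_of_monotoneOn measurableSet_Icc
          (hq.mono hsub))).aestronglyMeasurable
  obtain ⟨⟨B1, h1⟩, m1⟩ := key (fun x => (u x).re)
    (Complex.reCLM.lipschitz.comp_locallyBoundedVariationOn hu)
  obtain ⟨⟨B2, h2⟩, m2⟩ := key (fun x => (u x).im)
    (Complex.imCLM.lipschitz.comp_locallyBoundedVariationOn hu)
  refine ⟨⟨B1 + B2, fun x hx => ?_⟩, ?_⟩
  · exact (Complex.norm_le_abs_re_add_abs_im _).trans (add_le_add (h1 x hx) (h2 x hx))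
  · have : u = fun x => ((u x).re : ℂ) + ((u x).im : ℂ) * Complex.I := by
      funext x; exact (Complex.re_add_im _).symm
    rw [this]
    exact (Complex.continuous_ofReal.comp_aestronglyMeasurable m1).add
      ((Complex.continuous_ofReal.comp_aestronglyMeasurable m2).mul_const _)

theorem _root_.LocallyBoundedVariationOn.exists_tendsto {u : ℝ → ℂ}
    (hu : LocallyBoundedVariationOn u (Ω : Set ℝ)) {x : ℝ} (hx : x ∈ Ω) :
    Tendsto u (𝓝[<] x) (𝓝 (Function.leftLim u x)) ∧
      Tendsto u (𝓝[>] x) (𝓝 (Function.rightLim u x)) := by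
  constructor
  · apply tendsto_leftLim_of_tendsto
    obtain ⟨c, hc, hcx, hsub⟩ := exists_lt_mem Ω hx
    obtain ⟨l, hl⟩ := (hu c x hc hx).exists_tendsto_left x
    refine ⟨l, hl.mono_left (le_of_eq_of_le (nhdsWithin_eq_nhdsWithin' (s := Ioi c)
      (isOpen_Ioi.mem_nhds hcx) ?_) le_rfl)⟩
    ext y
    simp only [mem_inter_iff, mem_Iio, mem_Ioi, mem_Icc]
    exact ⟨fun h => ⟨⟨⟨hsub ⟨h.2.le, h.1.le⟩, h.2.le, h.1.le⟩, h.1⟩, h.2⟩, fun h => ⟨h.1.2, h.2⟩⟩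
  · apply tendsto_rightLim_of_tendsto
    obtain ⟨c, hc, hcx, hsub⟩ := exists_gt_mem Ω hx
    obtain ⟨l, hl⟩ := (hu x c hx hc).exists_tendsto_right x
    refine ⟨l, hl.mono_left (le_of_eq_of_le (nhdsWithin_eq_nhdsWithin' (s := Iio c)
      (isOpen_Iio.mem_nhds hcx) ?_) le_rfl)⟩
    ext y
    simp only [mem_inter_iff, mem_Iio, mem_Ioi, mem_Icc]
    exact ⟨fun h => ⟨⟨⟨hsub ⟨h.1.le, h.2.le⟩, h.1.le, h.2.le⟩, h.1⟩, h.2⟩, fun h => ⟨h.1.2, h.2⟩⟩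

/-! ### Distributional derivatives -/

theorem exists_Ioo_of_isCompact {K : Set ℝ} (hK : IsCompact K) (hKΩ : K ⊆ (Ω : Set ℝ)) {x : ℝ}
    (hx : x ∈ Ω) : ∃ c ∈ Ω, ∃ d ∈ Ω, c < x ∧ x < d ∧ K ⊆ Ioo c d := by
  have hK' : IsCompact (insert x K) := hK.insert x
  obtain ⟨m, hm, hm2⟩ := hK'.exists_isLeast (insert_nonempty _ _)
  obtain ⟨M, hM, hM2⟩ := hK'.exists_isGreatest (insert_nonempty _ _)
  have hsub : insert x K ⊆ (Ω : Set ℝ) := insert_subset hx hKΩ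
  obtain ⟨c, hc, hcm, -⟩ := exists_lt_mem Ω (hsub hm)
  obtain ⟨d, hd, hdM, -⟩ := exists_gt_mem Ω (hsub hM)
  exact ⟨c, hc, d, hd, hcm.trans_le (hm2 (mem_insert _ _)), (hM2 (mem_insert _ _)).trans_lt hdM,
    fun y hy => ⟨hcm.trans_le (hm2 (mem_insert_of_mem _ hy)),
      (hM2 (mem_insert_of_mem _ hy)).trans_lt hdM⟩⟩

/-- The distributional derivative of a balanced primitive. -/
theorem IsPrimitive.integral_deriv_mul [SFinite μ] {u F : ℝ → ℂ} (hu : IsPrimitive Ω μ u F)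
    (hF : LocIntegrable Ω μ F) (hΩ : (Ω : Set ℝ).OrdConnected) {x₀ : ℝ} (hx₀ : x₀ ∈ Ω)
    (φ : 𝓓(Ω, ℝ)) :
    -(∫ x, ((deriv φ x : ℝ) : ℂ) * u x) = ∫ x, (φ x : ℂ) * F x ∂μ := by
  obtain ⟨c, hc, d, hd, hcx, hxd, hsub⟩ := exists_Ioo_of_isCompact φ.hasCompactSupport
    φ.tsupport_subset hx₀
  have hcd : c ≤ d := (hcx.trans hxd).le
  have hdiff : ContDiff ℝ 1 φ := φ.contDiff.of_le (by exact_mod_cast le_top)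
  have hder : ∀ x, HasDerivAt (fun x => ((φ x : ℝ) : ℂ)) ((deriv φ x : ℝ) : ℂ) x := fun x =>
    ((hdiff.differentiable one_ne_zero).differentiableAt.hasDerivAt).ofReal_comp
  have hcont : Continuous fun x => ((deriv φ x : ℝ) : ℂ) :=
    Complex.continuous_ofReal.comp (hdiff.continuous_deriv le_rfl)
  have hG : LocIntegrable Ω volume fun x => ((deriv φ x : ℝ) : ℂ) := fun c _ d _ =>
    hcont.continuousOn.integrableOn_Icc
  -- A test function is a balanced primitive with respect to Lebesgue measure, so the product rule
  -- is applied with two different measures.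
  have hv : IsPrimitive Ω volume (fun x => ((φ x : ℝ) : ℂ)) fun x => ((deriv φ x : ℝ) : ℂ) := by
    intro c _ d _ hcd
    have h1 := intervalIntegral.integral_eq_sub_of_hasDerivAt (a := c) (b := d)
      (fun x _ => hder x) (hcont.intervalIntegrable _ _)
    rw [intervalIntegral.integral_of_le hcd] at h1
    rw [integral_Ico_eq_integral_Ioc, h1]
    module
  obtain ⟨-, -, h⟩ := hu.mul hF hv hG hΩ hc hd hcd
  have z : ∀ x ∉ Ioo c d, φ x = 0 := fun x hx =>
    image_eq_zero_of_notMem_tsupport fun h => hx (hsub h)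
  have z' : ∀ x ∉ Ioo c d, deriv φ x = 0 := fun x hx =>
    image_eq_zero_of_notMem_tsupport fun h => hx (hsub (tsupport_deriv_subset (𝕜 := ℝ) h))
  have l : ∀ x, leftVal volume (fun x => ((φ x : ℝ) : ℂ)) (fun x => ((deriv φ x : ℝ) : ℂ)) x =
      φ x := fun x => by simp [leftVal, Measure.real]
  rw [l, l, z c (by simp), z d (by simp)] at h
  rw [setIntegral_eq_integral_of_forall_compl_eq_zero,
    setIntegral_eq_integral_of_forall_compl_eq_zero] at h
  · simp only [mul_comm (F _), mul_comm (u _)] at h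
    simp only [Complex.ofReal_zero, mul_zero, sub_zero] at h
    linear_combination -h
  · intro x hx
    rw [z x fun h' => hx (Ioo_subset_Ico_self h')]
    simp
  · intro x hx
    rw [z' x fun h' => hx (Ioo_subset_Ico_self h')]
    simp

/-- The lemma of du Bois-Reymond. -/
theorem ae_const_of_integral_deriv_mul_eq_zero {v : ℝ → ℂ} (hv : LocIntegrable Ω volume v)
    (hΩ : (Ω : Set ℝ).OrdConnected) {x₀ : ℝ} (hx₀ : x₀ ∈ Ω)
    (h : ∀ φ : 𝓓(Ω, ℝ), ∫ x, ((deriv φ x : ℝ) : ℂ) * v x = 0) :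
    ∃ C, ∀ᵐ x, x ∈ Ω → v x = C := by
  obtain ⟨ε, hε, hball⟩ := Metric.isOpen_iff.1 Ω.isOpen x₀ hx₀
  let b : ContDiffBump x₀ := ⟨ε / 4, ε / 2, by linarith, by linarith⟩
  let θ : ℝ → ℝ := b.normed volume
  have hθs : tsupport θ ⊆ Ω := by
    rw [b.tsupport_normed_eq]
    exact (Metric.closedBall_subset_ball (by simp [b]; linarith)).trans hball
  have hθc : HasCompactSupport θ := b.hasCompactSupport_normed
  have hθd : ContDiff ℝ (⊤ : ℕ∞) θ := b.contDiff_normed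
  have hli : LocallyIntegrableOn v (Ω : Set ℝ) := by
    rw [locallyIntegrableOn_iff Ω.isOpen.isLocallyClosed]
    intro K hK hKc
    obtain ⟨c, hc, d, hd, -, -, hsub⟩ := exists_Ioo_of_isCompact hKc hK hx₀
    exact hv.sub_set hc hd (hsub.trans Ioo_subset_Icc_self)
  have hint : ∀ g : ℝ → ℝ, Continuous g → HasCompactSupport g → tsupport g ⊆ Ω →
      Integrable fun x => (g x : ℂ) * v x := by
    intro g hg hgc hgs
    obtain ⟨c, hc, d, hd, -, -, hsub⟩ := exists_Ioo_of_isCompact hgc hgs hx₀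
    obtain ⟨B, hB⟩ := hg.bounded_above_of_compact_support hgc
    have h1 : IntegrableOn (fun x => (g x : ℂ) * v x) (Icc c d) :=
      (hv c hc d hd).bdd_mul (c := B) (Complex.continuous_ofReal.comp hg).aestronglyMeasurable
        (ae_of_all _ fun x => by simpa using hB x)
    refine (integrableOn_iff_integrable_of_support_subset ?_).1 h1
    intro x hx
    have : g x ≠ 0 := fun h0 => hx (by simp [h0])
    exact Ioo_subset_Icc_self (hsub (subset_tsupport _ this))
  refine ⟨∫ x, (θ x : ℂ) * v x, ?_⟩
  have key := Ω.isOpen.ae_eq_zero_of_integral_contDiff_smul_eq_zero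
    (f := fun x => v x - ∫ x, (θ x : ℂ) * v x) (μ := volume)
    (hli.sub ((locallyIntegrable_const _).locallyIntegrableOn _)) ?_
  · filter_upwards [key] with x hx hxΩ using sub_eq_zero.1 (hx hxΩ)
  intro g hg hgc hgs
  have hgi : Integrable g := hg.continuous.integrable_of_hasCompactSupport hgc
  have hθi : Integrable θ := hθd.continuous.integrable_of_hasCompactSupport hθc
  -- Subtracting a multiple of a bump with integral one makes the integral vanish, so the primitive
  -- of `k` has compact support and is an admissible test function.
  let k : ℝ → ℝ := fun x => g x - (∫ y, g y) * θ x
  have hkd : ContDiff ℝ (⊤ : ℕ∞) k := hg.sub (contDiff_const.mul hθd)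
  have hki : ∫ x, k x = 0 := by
    have : ∫ x, θ x = 1 := b.integral_normed
    simp only [k]
    rw [integral_sub hgi (hθi.const_mul _), integral_const_mul, this, mul_one, sub_self]
  obtain ⟨c, hc, d, hd, hcx, hxd, hsub⟩ := exists_Ioo_of_isCompact (hgc.union hθc)
    (union_subset hgs hθs) hx₀
  have hk0 : ∀ x ∉ Ioo c d, k x = 0 := by
    intro x hx
    have h1 : g x = 0 := image_eq_zero_of_notMem_tsupport fun h' => hx (hsub (Or.inl h'))
    have h2 : θ x = 0 := image_eq_zero_of_notMem_tsupport fun h' => hx (hsub (Or.inr h'))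
    simp [k, h1, h2]
  let ψ : ℝ → ℝ := fun x => ∫ t in c..x, k t
  have hψ' : ∀ x, HasDerivAt ψ (k x) x := fun x =>
    intervalIntegral.integral_hasDerivAt_right (hkd.continuous.intervalIntegrable _ _)
      (hkd.continuous.stronglyMeasurableAtFilter _ _) hkd.continuous.continuousAt
  have hψd : deriv ψ = k := funext fun x => (hψ' x).deriv
  have hψ0 : ∀ x ∉ Icc c d, ψ x = 0 := by
    intro x hx
    rcases lt_or_ge x c with hxc | hxc
    · have : ∫ t in x..c, k t = 0 := by
        rw [intervalIntegral.integral_of_le hxc.le]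
        apply setIntegral_eq_zero_of_forall_eq_zero
        exact fun t ht => hk0 t fun h' => absurd h'.1 (not_lt.2 ht.2)
      simp only [ψ]
      rw [intervalIntegral.integral_symm, this, neg_zero]
    · have hdx : d < x := by
        by_contra hcon
        exact hx ⟨hxc, not_lt.1 hcon⟩
      simp only [ψ]
      rw [intervalIntegral.integral_of_le hxc, ← hki]
      apply setIntegral_eq_integral_of_forall_compl_eq_zero
      exact fun t ht => hk0 t fun h' => ht ⟨h'.1, h'.2.le.trans hdx.le⟩
  have hts : tsupport ψ ⊆ Icc c d := by
    refine closure_minimal (fun x hx => ?_) isClosed_Icc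
    by_contra hcon
    exact hx (hψ0 x hcon)
  let φ : 𝓓(Ω, ℝ) :=
    { toFun := ψ
      contDiff' := by
        have : ContDiff ℝ (⊤ : ℕ∞) ψ := by
          rw [contDiff_infty_iff_deriv]
          exact ⟨fun x => (hψ' x).differentiableAt, hψd ▸ hkd⟩
        exact this
      hasCompactSupport' := isCompact_Icc.of_isClosed_subset (isClosed_tsupport _) hts
      tsupport_subset' := hts.trans (hΩ.out hc hd) }
  have h1 := h φ
  have h2 : deriv φ = k := hψd
  rw [h2] at h1
  have i1 := hint g hg.continuous hgc hgs
  have i2 := hint θ hθd.continuous hθc hθs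
  have e : ∀ x, (k x : ℂ) * v x = (g x : ℂ) * v x - ((∫ y, g y : ℝ) : ℂ) * ((θ x : ℂ) * v x) := by
    intro x
    simp only [k]
    push_cast
    ring
  simp only [e] at h1
  rw [integral_sub i1 (i2.const_mul _), integral_const_mul] at h1
  have e2 : ∀ x, g x • (v x - ∫ x, (θ x : ℂ) * v x) =
      (g x : ℂ) * v x - (g x : ℂ) * ∫ x, (θ x : ℂ) * v x := by
    intro x
    rw [Complex.real_smul, mul_sub]
  simp only [e2]
  have i3 : Integrable fun x => (g x : ℂ) * ∫ x, (θ x : ℂ) * v x := hgi.ofReal.mul_const _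
  rw [integral_sub i1 i3, integral_mul_const, integral_complex_ofReal]
  exact h1

end OrderZero

namespace OrderZero

/-! ### Existence of balanced primitives and their recovery from distributional derivatives. -/

section

variable {E : Type*} [NormedAddCommGroup E] [NormedSpace ℝ E]
variable {Ω : Opens ℝ} {μ : Measure ℝ} {u F : ℝ → E}

theorem LocIntegrable.integral_add_adjacent (hF : LocIntegrable Ω μ F) {c d e : ℝ} (hc : c ∈ Ω)
    (hd : d ∈ Ω) (he : e ∈ Ω) (hcd : c ≤ d) (hde : d ≤ e) :
    (∫ x in Ioc c e, F x ∂μ) + ∫ x in Ico c e, F x ∂μ =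
      ((∫ x in Ioc c d, F x ∂μ) + ∫ x in Ico c d, F x ∂μ) +
        ((∫ x in Ioc d e, F x ∂μ) + ∫ x in Ico d e, F x ∂μ) := by
  rw [← Ioc_union_Ioc_eq_Ioc hcd hde, ← Ico_union_Ico_eq_Ico hcd hde,
    setIntegral_union (Ioc_disjoint_Ioc_of_le le_rfl) measurableSet_Ioc
      (hF.sub_set hc hd Ioc_subset_Icc_self) (hF.sub_set hd he Ioc_subset_Icc_self),
    setIntegral_union (Ico_disjoint_Ico.2 (by simp [hcd, hde])) measurableSet_Ico
      (hF.sub_set hc hd Ico_subset_Icc_self) (hF.sub_set hd he Ico_subset_Icc_self)]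
  abel

theorem isPrimitive_of_base (hF : LocIntegrable Ω μ F) {x₀ : ℝ} (hx₀ : x₀ ∈ Ω)
    (hr : ∀ x ∈ Ω, x₀ ≤ x →
      u x - u x₀ = (1 / 2 : ℝ) • ((∫ s in Ioc x₀ x, F s ∂μ) + ∫ s in Ico x₀ x, F s ∂μ))
    (hl : ∀ x ∈ Ω, x ≤ x₀ →
      u x₀ - u x = (1 / 2 : ℝ) • ((∫ s in Ioc x x₀, F s ∂μ) + ∫ s in Ico x x₀, F s ∂μ)) :
    IsPrimitive Ω μ u F := by
  intro c hc d hd hcd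
  rcases le_total x₀ c with h1 | h1
  · have := hF.integral_add_adjacent hx₀ hc hd h1 hcd
    rw [← sub_eq_iff_eq_add'] at this
    rw [← this, smul_sub, ← hr d hd (h1.trans hcd), ← hr c hc h1]
    abel
  · rcases le_total x₀ d with h2 | h2
    · rw [hF.integral_add_adjacent hc hx₀ hd h1 h2, smul_add, ← hr d hd h2, ← hl c hc h1]
      abel
    · have := hF.integral_add_adjacent hc hd hx₀ hcd h2
      rw [← sub_eq_iff_eq_add] at this
      rw [← this, smul_sub, ← hl d hd h2, ← hl c hc h1]
      abel

theorem LocIntegrable.exists_isPrimitive (hF : LocIntegrable Ω μ F) {x₀ : ℝ} (hx₀ : x₀ ∈ Ω) :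
    ∃ u, IsPrimitive Ω μ u F := by
  classical
  refine ⟨fun x => if x₀ ≤ x then
    (1 / 2 : ℝ) • ((∫ s in Ioc x₀ x, F s ∂μ) + ∫ s in Ico x₀ x, F s ∂μ) else
    -((1 / 2 : ℝ) • ((∫ s in Ioc x x₀, F s ∂μ) + ∫ s in Ico x x₀, F s ∂μ)),
    isPrimitive_of_base hF hx₀ ?_ ?_⟩
  · intro x _ hx
    simp [hx]
  · intro x _ hx
    rcases hx.eq_or_lt with rfl | hx
    · simp
    · simp [hx.not_ge]

theorem IsPrimitive.add {v G : ℝ → E} (hu : IsPrimitive Ω μ u F) (hF : LocIntegrable Ω μ F)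
    (hv : IsPrimitive Ω μ v G) (hG : LocIntegrable Ω μ G) :
    IsPrimitive Ω μ (fun x => u x + v x) (fun x => F x + G x) := by
  intro c hc d hd hcd
  rw [integral_add (hF.sub_set hc hd Ioc_subset_Icc_self) (hG.sub_set hc hd Ioc_subset_Icc_self),
    integral_add (hF.sub_set hc hd Ico_subset_Icc_self) (hG.sub_set hc hd Ico_subset_Icc_self),
    add_sub_add_comm, hu c hc d hd hcd, hv c hc d hd hcd]
  module

end

variable {Ω : Opens ℝ} {μ : Measure ℝ}

theorem eq_of_ae_const_of_tendsto {v : ℝ → ℂ} {C l : ℂ} {f : Filter ℝ} (h : Tendsto v f (𝓝 l))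
    (hf : ∃ᶠ x in f, v x = C) : l = C := by
  by_contra hne
  exact hf (h.eventually_ne hne)

/-- A null set contains no one-sided punctured neighbourhood of a point. -/
theorem frequently_nhdsLT_of_ae {p : ℝ → Prop} (h : ∀ᵐ x, x ∈ Ω → p x) {x : ℝ} (hx : x ∈ Ω) :
    (∃ᶠ y in 𝓝[<] x, p y) ∧ ∃ᶠ y in 𝓝[>] x, p y := by
  have h' : volume {y | ¬ (y ∈ Ω → p y)} = 0 := h
  constructor
  · intro hcon
    obtain ⟨c, hc, hcx, hsub⟩ := exists_lt_mem Ω hx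
    obtain ⟨l, hl, hl2⟩ := (mem_nhdsLT_iff_exists_Ioo_subset' hcx).1 hcon
    have hl' : max l c < x := max_lt hl hcx
    have : Ioo (max l c) x ⊆ {y | ¬ (y ∈ Ω → p y)} := fun y hy => by
      have h1 := hl2 ⟨(le_max_left _ _).trans_lt hy.1, hy.2⟩
      exact fun h2 => h1 (h2 (hsub ⟨((le_max_right _ _).trans_lt hy.1).le, hy.2.le⟩))
    have h3 := measure_mono_null this h'
    rw [Real.volume_Ioo, ENNReal.ofReal_eq_zero] at h3
    linarith
  · intro hcon
    obtain ⟨c, hc, hcx, hsub⟩ := exists_gt_mem Ω hx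
    obtain ⟨l, hl, hl2⟩ := (mem_nhdsGT_iff_exists_Ioo_subset' hcx).1 hcon
    have hl' : x < min l c := lt_min hl hcx
    have : Ioo x (min l c) ⊆ {y | ¬ (y ∈ Ω → p y)} := fun y hy => by
      have h1 := hl2 ⟨hy.1, hy.2.trans_le (min_le_left _ _)⟩
      exact fun h2 => h1 (h2 (hsub ⟨hy.1.le, (hy.2.trans_le (min_le_right _ _)).le⟩))
    have h3 := measure_mono_null this h'
    rw [Real.volume_Ioo, ENNReal.ofReal_eq_zero] at h3
    linarith

/-- A balanced function of locally bounded variation is a primitive of its distributional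
derivative. -/
theorem isPrimitive_of_integral_deriv_mul [SFinite μ] {u F : ℝ → ℂ}
    (hu : LocallyBoundedVariationOn u (Ω : Set ℝ))
    (hb : ∀ x ∈ Ω, u x = (1 / 2 : ℂ) * (Function.leftLim u x + Function.rightLim u x))
    (hF : LocIntegrable Ω μ F) (hΩ : (Ω : Set ℝ).OrdConnected) {x₀ : ℝ} (hx₀ : x₀ ∈ Ω)
    (h : ∀ φ : 𝓓(Ω, ℝ), -(∫ x, ((deriv φ x : ℝ) : ℂ) * u x) = ∫ x, (φ x : ℂ) * F x ∂μ) :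
    IsPrimitive Ω μ u F := by
  obtain ⟨p, hp⟩ := hF.exists_isPrimitive hx₀
  have loc : ∀ f : ℝ → ℂ, LocallyBoundedVariationOn f (Ω : Set ℝ) → LocIntegrable Ω volume f := by
    intro f hf c hc d hd
    obtain ⟨⟨B, hB⟩, hm⟩ := hf.bounded_aestronglyMeasurable (μ := volume) hΩ hc hd
    exact Integrable.of_bound hm B ((ae_restrict_mem measurableSet_Icc).mono hB)
  have hpb := hp.locallyBoundedVariationOn hF
  have hcont : ∀ (f : ℝ → ℂ), LocIntegrable Ω volume f → ∀ φ : 𝓓(Ω, ℝ),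
      Integrable fun x => ((deriv φ x : ℝ) : ℂ) * f x := by
    intro f hf φ
    obtain ⟨c, hc, d, hd, -, -, hsub⟩ := exists_Ioo_of_isCompact φ.hasCompactSupport
      φ.tsupport_subset hx₀
    have hdiff : ContDiff ℝ 1 φ := φ.contDiff.of_le (by exact_mod_cast le_top)
    have hc1 : Continuous (deriv φ) := hdiff.continuous_deriv le_rfl
    obtain ⟨B, hB⟩ := hc1.bounded_above_of_compact_support φ.hasCompactSupport.deriv
    have h1 : IntegrableOn (fun x => ((deriv φ x : ℝ) : ℂ) * f x) (Icc c d) :=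
      (hf c hc d hd).bdd_mul (c := B) (Complex.continuous_ofReal.comp hc1).aestronglyMeasurable
        (ae_of_all _ fun x => by simpa using hB x)
    refine (integrableOn_iff_integrable_of_support_subset ?_).1 h1
    intro x hx
    have h0 : deriv φ x ≠ 0 := fun h0 => hx (by simp [h0])
    exact Ioo_subset_Icc_self (hsub (support_deriv_subset h0))
  have hz : ∀ φ : 𝓓(Ω, ℝ), ∫ x, ((deriv φ x : ℝ) : ℂ) * (u x - p x) = 0 := by
    intro φ
    simp only [mul_sub]
    rw [integral_sub (hcont u (loc u hu) φ) (hcont p (loc p hpb) φ)]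
    have h1 := h φ
    rw [← hp.integral_deriv_mul hF hΩ hx₀ φ] at h1
    rw [neg_injective h1, sub_self]
  obtain ⟨C, hC⟩ := ae_const_of_integral_deriv_mul_eq_zero (v := fun x => u x - p x)
    (fun c hc d hd => (loc u hu c hc d hd).sub (loc p hpb c hc d hd)) hΩ hx₀ hz
  -- An almost everywhere constant difference has that constant as each of its one-sided limits.
  -- Both functions are the means of their one-sided limits, so the identity holds at every point.
  have key : ∀ x ∈ Ω, u x - p x = C := by
    intro x hx
    obtain ⟨h1, h2⟩ := frequently_nhdsLT_of_ae hC hx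
    obtain ⟨t1, t2⟩ := hu.exists_tendsto hx
    have e1 := eq_of_ae_const_of_tendsto (t1.sub (hp.tendsto_left hF hx)) h1
    have e2 := eq_of_ae_const_of_tendsto (t2.sub (hp.tendsto_right hF hx)) h2
    have e3 : leftVal μ p F x + rightVal μ p F x = 2 * p x := by
      simp only [leftVal, rightVal]
      ring
    rw [hb x hx]
    linear_combination (1 / 2 : ℂ) * e1 + (1 / 2 : ℂ) * e2 + (1 / 2 : ℂ) * e3
  intro c hc d hd hcd
  rw [← hp c hc d hd hcd]
  linear_combination key d hd - key c hc

end OrderZero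

namespace OrderZero

/-! ### Volterra equations with respect to a strict order -/

section Volterra

variable {α : Type*} [MeasurableSpace α] {R : α → α → Prop}

/-- The iterated integrals over `t₁ ≺ t₂ ≺ ⋯ ≺ tₖ ≺ x`. -/
noncomputable def simplexVol (m : Measure α) (R : α → α → Prop) : ℕ → α → ℝ≥0∞
  | 0, _ => 1
  | k + 1, x => ∫⁻ t in {t | R t x}, simplexVol m R k t ∂m

variable {m : Measure α} (hR : MeasurableSet {p : α × α | R p.1 p.2})
include hR

theorem measurableSet_rel_left (x : α) : MeasurableSet {t | R t x} :=
  (measurable_id.prodMk measurable_const) hR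

theorem measurableSet_rel_right (x : α) : MeasurableSet {t | R x t} :=
  (measurable_const.prodMk measurable_id) hR

theorem measurable_simplexVol [SFinite m] (k : ℕ) : Measurable (simplexVol m R k) := by
  induction k with
  | zero => exact measurable_const
  | succ k ih =>
    have e : simplexVol m R (k + 1) = fun x =>
        ∫⁻ t, {p : α × α | R p.1 p.2}.indicator (fun p => simplexVol m R k p.1) (t, x) ∂m := by
      funext x
      rw [simplexVol, ← lintegral_indicator (measurableSet_rel_left hR x)]
      rfl
    rw [e]
    exact ((ih.comp measurable_fst).indicator hR).lintegral_prod_left'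

variable (htrans : ∀ {s t x}, R s t → R t x → R s x) (hasymm : ∀ {s t}, R s t → ¬ R t s)
include htrans hasymm

/-- Insert one more point `s ≺ x` into a chain ending in `t ≺ x`. If `s ≺ t`, the induction
hypothesis at `t` applies and contributes `k + 1` copies of the next iterated integral. If not `s ≺
t`, this includes the chains with `t ≺ s ≺ x`, which contribute one further copy. Only transitivity
and asymmetry enter; points that are equal or incomparable make the inequality strict at worst, so
atoms do no harm. -/
theorem simplexVol_succ_le [SFinite m] (k : ℕ) (x : α) :
    (k + 1) * simplexVol m R (k + 1) x ≤ m {t | R t x} * simplexVol m R k x := by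
  induction k generalizing x with
  | zero => simp [simplexVol]
  | succ k ih =>
    have hm := measurable_simplexVol (m := m) hR k
    have hNm : Measurable fun t => m {s | R s t} := by
      have := measurable_simplexVol (m := m) hR 1
      simpa [simplexVol] using this
    have hMx := measurableSet_rel_left hR x
    have hdiff : MeasurableSet {p : α × α | R p.2 x ∧ ¬ R p.2 p.1} :=
      (measurable_snd hMx).inter (measurable_swap hR).compl
    have hset : ∀ t, MeasurableSet {s | R s x ∧ ¬ R s t} := fun t =>
      hMx.inter (measurableSet_rel_left hR t).compl
    have hDm : Measurable fun t => m {s | R s x ∧ ¬ R s t} :=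
      measurable_measure_prodMk_left hdiff
    have split : ∀ t ∈ {t | R t x}, m {s | R s x} * simplexVol m R k t =
        m {s | R s t} * simplexVol m R k t + m {s | R s x ∧ ¬ R s t} * simplexVol m R k t := by
      intro t ht
      rw [← add_mul, ← measure_union _ (hset t)]
      · congr 2
        ext s
        simp only [mem_ofPred_eq, mem_union]
        constructor
        · intro hs
          by_cases h : R s t
          · exact Or.inl h
          · exact Or.inr ⟨hs, h⟩
        · rintro (h | h)
          · exact htrans h ht
          · exact h.1
      · exact Set.disjoint_left.2 fun s h1 h2 => h2.2 h1
    have e1 : m {t | R t x} * simplexVol m R (k + 1) x =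
        (∫⁻ t in {t | R t x}, m {s | R s t} * simplexVol m R k t ∂m) +
          ∫⁻ t in {t | R t x}, m {s | R s x ∧ ¬ R s t} * simplexVol m R k t ∂m := by
      rw [simplexVol, ← lintegral_const_mul _ hm, setLIntegral_congr_fun hMx split,
        lintegral_add_left (f := fun t => m {s | R s t} * simplexVol m R k t) (hNm.mul hm)]
    -- Tonelli exchanges the last two variables of the chain; asymmetry turns `t ≺ s` into the
    -- weaker condition that not `s ≺ t`.
    have e2 : simplexVol m R (k + 2) x ≤
        ∫⁻ t in {t | R t x}, m {s | R s x ∧ ¬ R s t} * simplexVol m R k t ∂m := by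
      let K : α → α → ℝ≥0∞ := fun s t =>
        {p : α × α | R p.1 x ∧ R p.2 p.1}.indicator (fun p => simplexVol m R k p.2) (s, t)
      have hKset : MeasurableSet {p : α × α | R p.1 x ∧ R p.2 p.1} :=
        (measurable_fst hMx).inter (measurable_swap hR)
      have hK : Measurable (Function.uncurry K) :=
        (hm.comp measurable_snd).indicator hKset
      have a1 : simplexVol m R (k + 2) x = ∫⁻ s, ∫⁻ t, K s t ∂m ∂m := by
        rw [simplexVol, ← lintegral_indicator hMx]
        congr 1
        funext s
        by_cases hs : R s x
        · rw [indicator_of_mem (by exact hs), simplexVol,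
            ← lintegral_indicator (measurableSet_rel_left hR s)]
          congr 1
          funext t
          by_cases ht : R t s <;> simp [K, indicator, hs, ht]
        · rw [indicator_of_notMem (by exact hs)]
          symm
          simp [K, indicator, hs]
      rw [a1, lintegral_lintegral_swap hK.aemeasurable, ← lintegral_indicator hMx]
      refine lintegral_mono fun t => ?_
      by_cases ht : R t x
      · rw [indicator_of_mem (by exact ht)]
        calc ∫⁻ s, K s t ∂m ≤ ∫⁻ s, {s | R s x ∧ ¬ R s t}.indicator
              (fun _ => simplexVol m R k t) s ∂m := by
              refine lintegral_mono fun s => ?_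
              simp only [K]
              by_cases hs : R s x ∧ R t s
              · rw [indicator_of_mem (by exact hs), indicator_of_mem]
                exact ⟨hs.1, hasymm hs.2⟩
              · rw [indicator_of_notMem (by exact hs)]
                exact zero_le
          _ = _ := by rw [lintegral_indicator_const (hset t), mul_comm]
      · rw [indicator_of_notMem (by exact ht)]
        refine le_of_eq ?_
        have : ∀ s, K s t = 0 := by
          intro s
          apply indicator_of_notMem
          exact fun h => ht (htrans h.2 h.1)
        simp [this]
    rw [e1, show ((k + 1 : ℕ) : ℝ≥0∞) + 1 = (k + 1) + 1 by push_cast; ring, add_mul, one_mul]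
    refine add_le_add ?_ e2
    rw [show simplexVol m R (k + 1 + 1) x = ∫⁻ t in {t | R t x}, simplexVol m R (k + 1) t ∂m from rfl,
      ← lintegral_const_mul _ (measurable_simplexVol (m := m) hR _)]
    exact lintegral_mono fun t => ih t

theorem simplexVol_le [SFinite m] (k : ℕ) (x : α) :
    (k.factorial : ℝ≥0∞) * simplexVol m R k x ≤ m {t | R t x} ^ k := by
  induction k with
  | zero => simp [simplexVol]
  | succ k ih =>
    calc ((k + 1).factorial : ℝ≥0∞) * simplexVol m R (k + 1) x
        = k.factorial * ((k + 1) * simplexVol m R (k + 1) x) := by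
          rw [Nat.factorial_succ]; push_cast; ring
      _ ≤ k.factorial * (m {t | R t x} * simplexVol m R k x) := by
          exact mul_le_mul_right (simplexVol_succ_le (m := m) hR htrans hasymm k x) _
      _ = m {t | R t x} * (k.factorial * simplexVol m R k x) := by ring
      _ ≤ m {t | R t x} * m {t | R t x} ^ k := by gcongr
      _ = _ := by rw [pow_succ, mul_comm]

theorem simplexVol_toReal_le [SFinite m] (k : ℕ) {x : α} (hx : m {t | R t x} ≠ ∞) :
    simplexVol m R k x ≠ ∞ ∧
      (simplexVol m R k x).toReal ≤ m.real {t | R t x} ^ k / k.factorial := by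
  have h := simplexVol_le (m := m) hR htrans hasymm k x
  have hp : m {t | R t x} ^ k ≠ ∞ := ENNReal.pow_ne_top hx
  have hf : (k.factorial : ℝ≥0∞) ≠ 0 := by exact_mod_cast k.factorial_ne_zero
  have h1 : simplexVol m R k x ≠ ∞ := by
    intro h0
    rw [h0, ENNReal.mul_top hf] at h
    exact hp (top_le_iff.1 h)
  refine ⟨h1, ?_⟩
  rw [le_div_iff₀ (by positivity), mul_comm]
  have h2 := ENNReal.toReal_mono hp h
  rwa [ENNReal.toReal_mul, ENNReal.toReal_pow, ENNReal.toReal_natCast] at h2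

/-- Existence of solutions of linear Volterra equations `v(x) = g(x) + ∫_{t ≺ x} B(t) v(t) dν(t)`. -/
theorem exists_volterra {n : ℕ} {ν : Measure α} [SFinite ν] {B : α → Matrix (Fin n) (Fin n) ℂ}
    (hB : ∀ i j, Measurable fun t => B t i j) {β : α → ℝ≥0∞} (hβ : Measurable β)
    (hBβ : ∀ t v, ‖B t *ᵥ v‖ₑ ≤ β t * ‖v‖ₑ) {X : Set α} (hX : ∀ {t x}, x ∈ X → R t x → t ∈ X)
    (hβX : ∀ x ∈ X, ∫⁻ t in {t | R t x}, β t ∂ν ≠ ∞) {g : α → Fin n → ℂ} (hg : Measurable g)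
    (hgX : ∀ x ∈ X, ∃ C : ℝ≥0, ∀ t, R t x ∨ t = x → ‖g t‖ₑ ≤ C) :
    ∃ v : α → Fin n → ℂ, ∀ x ∈ X, IntegrableOn (fun t => B t *ᵥ v t) {t | R t x} ν ∧
      v x = g x + ∫ t in {t | R t x}, B t *ᵥ v t ∂ν := by
  let m := ν.withDensity β
  have hmR : ∀ x, m {t | R t x} = ∫⁻ t in {t | R t x}, β t ∂ν := fun x =>
    withDensity_apply _ (measurableSet_rel_left hR x)
  -- The terms of the Picard series. The `k`-th is bounded by a constant times the iterated integral
  -- of `β`, hence by a term of an exponential series.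
  let V : ℕ → α → Fin n → ℂ := fun k => Nat.rec g
    (fun _ W x => ∫ t in {t | R t x}, B t *ᵥ W t ∂ν) k
  have V0 : V 0 = g := rfl
  have Vs : ∀ k x, V (k + 1) x = ∫ t in {t | R t x}, B t *ᵥ V k t ∂ν := fun _ _ => rfl
  have hBm : ∀ {W : α → Fin n → ℂ}, Measurable W → Measurable fun t => B t *ᵥ W t := by
    intro W hW
    refine measurable_pi_lambda _ fun i => ?_
    simp only [Matrix.mulVec, dotProduct]
    exact Finset.measurable_fun_sum _ fun j _ => (hB i j).mul ((measurable_pi_apply j).comp hW)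
  have Vm : ∀ k, Measurable (V k) := by
    intro k
    induction k with
    | zero => exact hg
    | succ k ih =>
      have e : V (k + 1) = fun x => ∫ t, {p : α × α | R p.1 p.2}.indicator
          (fun p => B p.1 *ᵥ V k p.1) (t, x) ∂ν := by
        funext x
        rw [Vs, ← integral_indicator (measurableSet_rel_left hR x)]
        rfl
      rw [e]
      exact (StronglyMeasurable.integral_prod_left'
        (((hBm ih).comp measurable_fst).indicator hR).stronglyMeasurable).measurable
  have hlin : ∀ (k : ℕ) (C : ℝ≥0) (x : α), (∀ t, R t x → ‖V k t‖ₑ ≤ C * simplexVol m R k t) →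
      ∫⁻ t in {t | R t x}, ‖B t *ᵥ V k t‖ₑ ∂ν ≤ C * simplexVol m R (k + 1) x := by
    intro k C x hC
    rw [simplexVol, ← lintegral_const_mul _ (measurable_simplexVol (m := m) hR k)]
    rw [setLIntegral_withDensity_eq_setLIntegral_mul _ hβ
      ((measurable_simplexVol hR k).const_mul _) (measurableSet_rel_left hR x)]
    refine setLIntegral_mono (hβ.mul ((measurable_simplexVol hR k).const_mul _)) fun t ht => ?_
    exact (hBβ t _).trans (mul_le_mul_right (hC t ht) _)
  -- The constant is chosen at the end point `x` and must serve at all `t ≺ x` as well, because the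
  -- induction descends along the order.
  have hbound : ∀ x ∈ X, ∀ C : ℝ≥0, (∀ t, R t x ∨ t = x → ‖g t‖ₑ ≤ C) →
      ∀ k t, R t x ∨ t = x → ‖V k t‖ₑ ≤ C * simplexVol m R k t := by
    intro x hx C hC k
    induction k with
    | zero => intro t ht; simpa [simplexVol, V0] using hC t ht
    | succ k ih =>
      intro t ht
      rw [Vs]
      refine (enorm_integral_le_lintegral_enorm _).trans (hlin k C t fun s hs => ih s (Or.inl ?_))
      rcases ht with ht | rfl
      · exact htrans hs ht
      · exact hs
  have hfin : ∀ x ∈ X, m {t | R t x} ≠ ∞ := fun x hx => by rw [hmR]; exact hβX x hx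
  have hsum : ∀ x ∈ X, Summable fun k => V k x := by
    intro x hx
    obtain ⟨C, hC⟩ := hgX x hx
    refine Summable.of_norm_bounded (g := fun k => (C : ℝ) * (m.real {t | R t x} ^ k / k.factorial))
      ((Real.summable_pow_div_factorial _).mul_left _) fun k => ?_
    have h1 := hbound x hx C hC k x (Or.inr rfl)
    obtain ⟨h2, h3⟩ := simplexVol_toReal_le hR htrans hasymm k (hfin x hx)
    have h4 := ENNReal.toReal_mono (ENNReal.mul_ne_top ENNReal.coe_ne_top h2) h1
    rw [toReal_enorm, ENNReal.toReal_mul, ENNReal.coe_toReal] at h4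
    exact h4.trans (mul_le_mul_of_nonneg_left h3 C.2)
  refine ⟨fun x => ∑' k, V k x, fun x hx => ?_⟩
  obtain ⟨C, hC⟩ := hgX x hx
  have hF : ∀ k, IntegrableOn (fun t => B t *ᵥ V k t) {t | R t x} ν ∧
      ∫ t in {t | R t x}, ‖B t *ᵥ V k t‖ ∂ν ≤
        C * (m.real {t | R t x} ^ (k + 1) / (k + 1).factorial) := by
    intro k
    have h1 := hlin k C x fun t ht => hbound x hx C hC k t (Or.inl ht)
    obtain ⟨h2, h3⟩ := simplexVol_toReal_le hR htrans hasymm (k + 1) (hfin x hx)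
    have h4 : (C : ℝ≥0∞) * simplexVol m R (k + 1) x ≠ ∞ := ENNReal.mul_ne_top ENNReal.coe_ne_top h2
    refine ⟨⟨(hBm (Vm k)).aestronglyMeasurable, h1.trans_lt h4.lt_top⟩, ?_⟩
    rw [integral_norm_eq_lintegral_enorm (hBm (Vm k)).aestronglyMeasurable]
    have h5 := ENNReal.toReal_mono h4 h1
    rw [ENNReal.toReal_mul, ENNReal.coe_toReal] at h5
    exact h5.trans (mul_le_mul_of_nonneg_left h3 C.2)
  have hS : Summable fun k => ∫ t in {t | R t x}, ‖B t *ᵥ V k t‖ ∂ν := by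
    refine Summable.of_nonneg_of_le (fun k => integral_nonneg fun _ => norm_nonneg _)
      (fun k => (hF k).2) (Summable.mul_left _ ?_)
    exact (summable_nat_add_iff 1).2 (Real.summable_pow_div_factorial _)
  have hval : ∀ t ∈ {t | R t x}, (∑' k, B t *ᵥ V k t) = B t *ᵥ ∑' k, V k t := by
    intro t ht
    have h1 := (hsum t (hX hx ht)).hasSum
    exact (h1.map (Matrix.mulVecLin (B t)) (by
      change Continuous fun v => B t *ᵥ v
      fun_prop)).tsum_eq
  have hHS := hasSum_integral_of_summable_integral_norm (fun k => (hF k).1) hS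
  rw [setIntegral_congr_fun (measurableSet_rel_left hR x) hval] at hHS
  constructor
  · have hint : IntegrableOn (fun t => ∑' k, B t *ᵥ V k t) {t | R t x} ν := by
      refine ⟨?_, ?_⟩
      · refine aestronglyMeasurable_of_tendsto_ae (u := atTop)
          (f := fun N t => ∑ k ∈ Finset.range N, B t *ᵥ V k t) (fun N =>
          (Finset.measurable_fun_sum _ fun k _ => hBm (Vm k)).aestronglyMeasurable) ?_
        filter_upwards [ae_restrict_mem (measurableSet_rel_left hR x)] with t ht
        have h1 := (hsum t (hX hx ht)).hasSum
        have h2 := h1.map (Matrix.mulVecLin (B t)) (by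
          change Continuous fun v => B t *ᵥ v
          fun_prop)
        have h3 := h2.tendsto_sum_nat
        rw [← h2.tsum_eq] at h3
        exact h3
      · have h1 : ∫⁻ t in {t | R t x}, ‖∑' k, B t *ᵥ V k t‖ₑ ∂ν ≤
            ∑' k, ∫⁻ t in {t | R t x}, ‖B t *ᵥ V k t‖ₑ ∂ν := by
          rw [← lintegral_tsum fun k => (hBm (Vm k)).enorm.aemeasurable]
          exact lintegral_mono fun t => enorm_tsum_le_tsum_enorm
        refine h1.trans_lt ?_
        have h2 : ∀ k, ∫⁻ t in {t | R t x}, ‖B t *ᵥ V k t‖ₑ ∂ν =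
            ENNReal.ofReal (∫ t in {t | R t x}, ‖B t *ᵥ V k t‖ ∂ν) := fun k =>
          (ofReal_integral_norm_eq_lintegral_enorm (hF k).1).symm
        simp only [h2]
        exact hS.tsum_ofReal_lt_top
    exact hint.congr ((ae_restrict_iff' (measurableSet_rel_left hR x)).2 (ae_of_all _ hval))
  · dsimp only
    rw [← hHS.tsum_eq, (hsum x hx).tsum_eq_zero_add, V0]

end Volterra

end OrderZero

namespace OrderZero

/-! ### Linear equations with measure coefficients -/

section Linear

variable {n : ℕ} {Ω : Opens ℝ} {μ : Measure ℝ}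

theorem norm_mulVec_le_sum (M : Matrix (Fin n) (Fin n) ℂ) (v : Fin n → ℂ) :
    ‖M *ᵥ v‖ ≤ (∑ i, ∑ j, ‖M i j‖) * ‖v‖ := by
  rw [pi_norm_le_iff_of_nonneg (by positivity)]
  intro i
  calc ‖(M *ᵥ v) i‖ ≤ ∑ j, ‖M i j * v j‖ := norm_sum_le (E := ℂ) _ _
    _ ≤ ∑ j, ‖M i j‖ * ‖v‖ := by
        refine Finset.sum_le_sum fun j _ => ?_
        rw [norm_mul]
        exact mul_le_mul_of_nonneg_left (norm_le_pi_norm v j) (norm_nonneg _)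
    _ = (∑ j, ‖M i j‖) * ‖v‖ := by rw [Finset.sum_mul]
    _ ≤ _ := by
        refine mul_le_mul_of_nonneg_right ?_ (norm_nonneg _)
        exact Finset.single_le_sum (f := fun i => ∑ j, ‖M i j‖)
          (fun i _ => Finset.sum_nonneg fun j _ => norm_nonneg _) (Finset.mem_univ i)

theorem measurable_measureReal_singleton [SFinite μ] : Measurable fun x => μ.real {x} := by
  have h : MeasurableSet {p : ℝ × ℝ | p.2 = p.1} :=
    measurableSet_eq_fun measurable_snd measurable_fst
  exact (measurable_measure_prodMk_left (ν := μ) h).ennreal_toReal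

/-- By Cramer's rule. The formula also covers singular matrices, where the inverse is zero by
convention. -/
theorem measurable_inv_apply {M : ℝ → Matrix (Fin n) (Fin n) ℂ}
    (hM : ∀ i j, Measurable fun x => M x i j) (i j : Fin n) : Measurable fun x => (M x)⁻¹ i j := by
  have hM' : Measurable (fun x i j => M x i j) :=
    measurable_pi_lambda _ fun i => measurable_pi_lambda _ fun j => hM i j
  have h1 : Measurable fun x => (M x).det := by
    have : Continuous fun N : Fin n → Fin n → ℂ => (Matrix.of N).det := by
      exact Continuous.matrix_det continuous_id
    exact this.measurable.comp hM'
  have h2 : Measurable fun x => (M x).adjugate i j := by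
    have : Continuous fun N : Fin n → Fin n → ℂ => (Matrix.of N).adjugate i j := by
      have h3 : Continuous fun N : Fin n → Fin n → ℂ => (Matrix.of N).adjugate :=
        Continuous.matrix_adjugate continuous_id
      exact (continuous_apply j).comp ((continuous_apply i).comp h3)
    exact this.measurable.comp hM'
  have e : ∀ x, (M x)⁻¹ i j = ((M x).det)⁻¹ * (M x).adjugate i j := by
    intro x
    rw [Matrix.inv_def, Ring.inverse_eq_inv', Matrix.smul_apply, smul_eq_mul]
  simp only [e]
  exact h1.inv.mul h2

/-- The matrix that solves the jump condition of a balanced solution. -/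
noncomputable def jumpInv (μ : Measure ℝ) (A : ℝ → Matrix (Fin n) (Fin n) ℂ) (σ : ℝ) (x : ℝ) :
    Matrix (Fin n) (Fin n) ℂ :=
  (1 - (σ / 2 * μ.real {x}) • A x)⁻¹

variable {A : ℝ → Matrix (Fin n) (Fin n) ℂ}

theorem measurable_jumpInv [SFinite μ] (hA : ∀ i j, Measurable fun x => A x i j) (σ : ℝ)
    (i j : Fin n) : Measurable fun x => jumpInv μ A σ x i j := by
  refine measurable_inv_apply (fun i j => ?_) i j
  simp only [Matrix.sub_apply, Matrix.smul_apply]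
  exact measurable_const.sub ((measurable_measureReal_singleton.const_mul _).smul (hA i j))

/-- The measure `f dμ` on `s` is finite, so only finitely many points can have mass at least one. -/
theorem finite_large_atoms {f : ℝ → ℝ} {s : Set ℝ} (hf : IntegrableOn f s μ) (h0 : ∀ x, 0 ≤ f x) :
    {x ∈ s | 1 ≤ μ.real {x} * f x}.Finite := by
  have h1 : ∫⁻ x in s, ENNReal.ofReal (f x) ∂μ < ∞ := by
    have := hf.2
    refine (lintegral_mono fun x => ?_).trans_lt this
    rw [← Real.enorm_of_nonneg (h0 x)]
  let m := (μ.restrict s).withDensity fun x => ENNReal.ofReal (f x)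
  have hm : m univ ≠ ∞ := by
    rw [withDensity_apply _ MeasurableSet.univ, Measure.restrict_univ]
    exact h1.ne
  have h2 := Measure.finite_const_le_meas_of_disjoint_iUnion m (ε := 1) one_pos
    (As := fun x : ℝ => {x}) (fun x => measurableSet_singleton x)
    (fun x y hxy => by simpa [Function.onFun] using hxy) (by
      exact ne_top_of_le_ne_top hm (measure_mono (subset_univ _)))
  refine h2.subset fun x hx => ?_
  change 1 ≤ m {x}
  rw [withDensity_apply _ (measurableSet_singleton x), Measure.restrict_restrict
    (measurableSet_singleton x), inter_eq_left.2 (singleton_subset_iff.2 hx.1), lintegral_singleton]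
  have h3 : ENNReal.ofReal 1 ≤ ENNReal.ofReal (μ.real {x} * f x) := ENNReal.ofReal_le_ofReal hx.2
  rw [ENNReal.ofReal_one, ENNReal.ofReal_mul measureReal_nonneg, mul_comm] at h3
  refine h3.trans (mul_le_mul_right ?_ _)
  exact ENNReal.ofReal_toReal_le

/-- Except at the finitely many points where the atom of `A` is large, the matrix to be inverted
differs from the identity by a matrix of norm at most one half, and its inverse is bounded by `2`.
The finitely many exceptions have a common bound. -/
theorem bounded_jumpInv (hAi : ∀ i j, LocIntegrable Ω μ fun x => A x i j) {σ : ℝ} (hσ : |σ| ≤ 1)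
    (hinv : ∀ x ∈ Ω, IsUnit (1 - (σ / 2 * μ.real {x}) • A x)) {c d : ℝ} (hc : c ∈ Ω) (hd : d ∈ Ω)
    (hcd : Icc c d ⊆ Ω) : ∃ K, ∀ x ∈ Icc c d, ∀ i j, ‖jumpInv μ A σ x i j‖ ≤ K := by
  let f : ℝ → ℝ := fun x => ∑ i, ∑ j, ‖A x i j‖
  have hf0 : ∀ x, 0 ≤ f x := fun x =>
    Finset.sum_nonneg fun i _ => Finset.sum_nonneg fun j _ => norm_nonneg _
  have hf : IntegrableOn f (Icc c d) μ := integrable_finsetSum _ fun i _ =>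
    integrable_finsetSum _ fun j _ => (hAi i j c hc d hd).norm
  have hfin := finite_large_atoms hf hf0
  obtain ⟨K, hK⟩ := (hfin.image fun x => ∑ i, ∑ j, ‖jumpInv μ A σ x i j‖).bddAbove
  refine ⟨max K 2, fun x hx i j => ?_⟩
  by_cases hxs : 1 ≤ μ.real {x} * f x
  · refine le_trans ?_ (le_max_left _ _)
    refine le_trans ?_ (hK ⟨x, ⟨hx, hxs⟩, rfl⟩)
    refine le_trans ?_ (Finset.single_le_sum (f := fun i => ∑ j, ‖jumpInv μ A σ x i j‖)
      (fun i _ => Finset.sum_nonneg fun j _ => norm_nonneg _) (Finset.mem_univ i))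
    exact Finset.single_le_sum (f := fun j => ‖jumpInv μ A σ x i j‖)
      (fun j _ => norm_nonneg _) (Finset.mem_univ j)
  · refine le_trans ?_ (le_max_right _ _)
    push Not at hxs
    let v : Fin n → ℂ := jumpInv μ A σ x *ᵥ Pi.single j 1
    have h1 : (1 - (σ / 2 * μ.real {x}) • A x) *ᵥ v = Pi.single j 1 := by
      simp only [v, jumpInv]
      rw [Matrix.mulVec_mulVec, Matrix.mul_nonsing_inv _
        ((Matrix.isUnit_iff_isUnit_det _).1 (hinv x (hcd hx))), Matrix.one_mulVec]
    rw [Matrix.sub_mulVec, Matrix.one_mulVec, Matrix.smul_mulVec, sub_eq_iff_eq_add] at h1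
    have h2 : ‖v‖ ≤ 1 + 1 / 2 * ‖v‖ := by
      nth_rewrite 1 [h1]
      refine (norm_add_le _ _).trans (add_le_add ?_ ?_)
      · rw [Pi.norm_single, norm_one]
      · rw [norm_smul]
        have h3 := norm_mulVec_le_sum (A x) v
        have h4 : ‖σ / 2 * μ.real {x}‖ ≤ 1 / 2 * μ.real {x} := by
          rw [norm_mul, Real.norm_of_nonneg measureReal_nonneg, Real.norm_eq_abs, abs_div]
          refine mul_le_mul_of_nonneg_right ?_ measureReal_nonneg
          rw [abs_two]
          linarith
        calc ‖σ / 2 * μ.real {x}‖ * ‖A x *ᵥ v‖ ≤ (1 / 2 * μ.real {x}) * (f x * ‖v‖) := by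
              gcongr
          _ = 1 / 2 * (μ.real {x} * f x) * ‖v‖ := by ring
          _ ≤ 1 / 2 * 1 * ‖v‖ := by gcongr
          _ = _ := by ring
    have h5 : jumpInv μ A σ x i j = v i := by
      simp only [v]
      rw [Matrix.mulVec_single_one]
      rfl
    rw [h5]
    exact (norm_le_pi_norm v i).trans (by linarith)

variable {R : ℝ → ℝ → Prop}

/-- The equation on one side of `x₀`, with `σ = 1` to the right and `σ = -1` to the left. Atoms make
it implicit, since the unknown `u(x)` also appears in half of its own jump. Let `v` be the one-sided
value on the side facing `x₀` and `g` the half jump due to `G`; then `u = C (v + g)` with `C` the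
inverse matrix, and `v` satisfies a Volterra equation over strict chains with coefficient `D = A C`.
Local boundedness of `C` keeps `D` locally integrable. -/
theorem exists_half_solution [SFinite μ] (hR : MeasurableSet {p : ℝ × ℝ | R p.1 p.2})
    (htrans : ∀ {s t x}, R s t → R t x → R s x) (hasymm : ∀ {s t}, R s t → ¬ R t s)
    (hA : ∀ i j, Measurable fun x => A x i j) (hAi : ∀ i j, LocIntegrable Ω μ fun x => A x i j)
    {G : ℝ → Fin n → ℂ} (hG : Measurable G) (hGi : LocIntegrable Ω μ G) {σ : ℝ} (hσ : |σ| ≤ 1)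
    (hσ0 : σ ≠ 0) (hinv : ∀ x ∈ Ω, IsUnit (1 - (σ / 2 * μ.real {x}) • A x)) (x₀ : ℝ) (ξ : Fin n → ℂ) :
    ∃ u : ℝ → Fin n → ℂ, ∀ x ∈ Ω,
      (∃ c ∈ Ω, ∃ d ∈ Ω, Icc c d ⊆ Ω ∧ {t | R x₀ t ∧ R t x} ⊆ Icc c d) →
      IntegrableOn (fun t => A t *ᵥ u t + G t) {t | R x₀ t ∧ R t x} μ ∧
      u x = ξ + σ • (∫ t in {t | R x₀ t ∧ R t x}, A t *ᵥ u t + G t ∂μ) +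
        (σ / 2) • (μ.real {x} • (A x *ᵥ u x + G x)) := by
  have hset : ∀ x, MeasurableSet {t | R x₀ t ∧ R t x} := fun x =>
    (measurableSet_rel_right hR x₀).inter (measurableSet_rel_left hR x)
  let C := jumpInv μ A σ
  have hC := measurable_jumpInv (μ := μ) hA σ
  let D : ℝ → Matrix (Fin n) (Fin n) ℂ := fun t => A t * C t
  have hD : ∀ i j, Measurable fun t => D t i j := by
    intro i j
    simp only [D, Matrix.mul_apply]
    exact Finset.measurable_fun_sum _ fun k _ => (hA i k).mul (hC k j)
  have hDi : ∀ c ∈ Ω, ∀ d ∈ Ω, Icc c d ⊆ Ω → ∀ i j, IntegrableOn (fun t => D t i j) (Icc c d) μ := by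
    intro c hc d hd hcd i j
    obtain ⟨K, hK⟩ := bounded_jumpInv hAi hσ hinv hc hd hcd
    simp only [D, Matrix.mul_apply]
    refine integrable_finsetSum _ fun k _ => ?_
    exact (hAi i k c hc d hd).mul_bdd (c := K) (hC k j).aestronglyMeasurable
      ((ae_restrict_mem measurableSet_Icc).mono fun x hx => hK x hx k j)
  let g : ℝ → Fin n → ℂ := fun t => (σ / 2) • (μ.real {t} • G t)
  have hg : Measurable g := (measurable_measureReal_singleton.smul hG).const_smul (σ / 2)
  have hDgm : Measurable fun t => D t *ᵥ g t := by
    refine measurable_pi_lambda _ fun i => ?_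
    simp only [Matrix.mulVec, dotProduct]
    exact Finset.measurable_fun_sum _ fun j _ => (hD i j).mul ((measurable_pi_apply j).comp hg)
  let H : ℝ → Fin n → ℂ := fun t => D t *ᵥ g t + G t
  have hH : Measurable H := hDgm.add hG
  have hHi : ∀ c ∈ Ω, ∀ d ∈ Ω, Icc c d ⊆ Ω → IntegrableOn H (Icc c d) μ := by
    intro c hc d hd hcd
    refine Integrable.add ?_ (hGi c hc d hd)
    refine Integrable.of_eval fun i => ?_
    simp only [Matrix.mulVec, dotProduct]
    refine integrable_finsetSum _ fun j _ => ?_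
    refine (hDi c hc d hd hcd i j).mul_bdd (c := ‖σ / 2‖ * ∫ t in Icc c d, ‖G t‖ ∂μ)
      ((measurable_pi_apply j).comp hg).aestronglyMeasurable
      ((ae_restrict_mem measurableSet_Icc).mono fun x hx => ?_)
    refine (norm_le_pi_norm (g x) j).trans ?_
    simp only [g]
    rw [norm_smul]
    gcongr
    exact hGi.norm_atom_le hc hd subset_rfl hx
  -- Points reached from `x₀` within a compact interval of `Ω`. Only there are the coefficients
  -- known to be integrable.
  let X : Set ℝ := {x | ∃ c ∈ Ω, ∃ d ∈ Ω, Icc c d ⊆ Ω ∧ {t | R x₀ t ∧ R t x} ⊆ Icc c d}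
  let ν := μ.restrict {t | R x₀ t}
  have hνr : ∀ x, ν.restrict {t | R t x} = μ.restrict {t | R x₀ t ∧ R t x} := by
    intro x
    rw [Measure.restrict_restrict (measurableSet_rel_left hR x), inter_comm]
    rfl
  let gV : ℝ → Fin n → ℂ := fun x => ξ + σ • ∫ t in {t | R x₀ t ∧ R t x}, H t ∂μ
  have hgVm : Measurable gV := by
    have e : gV = fun x => ξ + σ • ∫ t, {p : ℝ × ℝ | R x₀ p.1 ∧ R p.1 p.2}.indicator
        (fun p => H p.1) (t, x) ∂μ := by
      funext x
      simp only [gV]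
      rw [← integral_indicator (hset x)]
      rfl
    rw [e]
    refine measurable_const.add (Measurable.const_smul ?_ σ)
    exact (StronglyMeasurable.integral_prod_left' (((hH.comp measurable_fst).indicator
      ((measurable_fst (measurableSet_rel_right hR x₀)).inter hR)).stronglyMeasurable)).measurable
  have hβm : Measurable fun t => ENNReal.ofReal (|σ| * ∑ i, ∑ j, ‖D t i j‖) :=
    ((Finset.measurable_fun_sum _ fun i _ => Finset.measurable_fun_sum _ fun j _ =>
      (hD i j).norm).const_mul _).ennreal_ofReal
  obtain ⟨v, hv⟩ := exists_volterra hR htrans hasymm (ν := ν) (B := fun t => σ • D t)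
    (fun i j => (hD i j).const_smul σ) (β := fun t => ENNReal.ofReal (|σ| * ∑ i, ∑ j, ‖D t i j‖))
    hβm
    (fun t w => by
      rw [Matrix.smul_mulVec, enorm_smul, ← ofReal_norm (D t *ᵥ w), ← ofReal_norm σ, ← ofReal_norm w,
        ← ENNReal.ofReal_mul (norm_nonneg _), ← ENNReal.ofReal_mul (by positivity), mul_assoc]
      exact ENNReal.ofReal_le_ofReal
        (mul_le_mul_of_nonneg_left (norm_mulVec_le_sum _ _) (norm_nonneg _)))
    (X := X)
    (fun {t x} hx htx => by
      obtain ⟨c, hc, d, hd, h1, h2⟩ := hx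
      exact ⟨c, hc, d, hd, h1, fun s hs => h2 ⟨hs.1, htrans hs.2 htx⟩⟩)
    (fun x hx => by
      obtain ⟨c, hc, d, hd, h1, h2⟩ := hx
      rw [hνr]
      have hi : IntegrableOn (fun t => |σ| * ∑ i, ∑ j, ‖D t i j‖) {t | R x₀ t ∧ R t x} μ :=
        (integrable_finsetSum _ fun i _ => integrable_finsetSum _ fun j _ =>
          ((hDi c hc d hd h1 i j).mono_set h2).norm).const_mul _
      exact hi.lintegral_lt_top.ne)
    hgVm
    (fun x hx => by
      obtain ⟨c, hc, d, hd, h1, h2⟩ := hx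
      refine ⟨‖ξ‖₊ + ‖σ‖₊ * (∫ t in {t | R x₀ t ∧ R t x}, ‖H t‖ ∂μ).toNNReal, fun t ht => ?_⟩
      rw [enorm_eq_nnnorm, ENNReal.coe_le_coe, ← NNReal.coe_le_coe]
      push_cast
      refine (norm_add_le _ _).trans (add_le_add le_rfl ?_)
      rw [norm_smul]
      refine mul_le_mul_of_nonneg_left ?_ (norm_nonneg _)
      refine le_trans ?_ (Real.le_coe_toNNReal _)
      refine (norm_integral_le_integral_norm _).trans ?_
      refine setIntegral_mono_set ((hHi c hc d hd h1).mono_set h2).norm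
        (ae_of_all _ fun _ => norm_nonneg _) (LE.le.eventuallyLE fun s hs => ?_)
      rcases ht with ht | rfl
      · exact ⟨hs.1, htrans hs.2 ht⟩
      · exact hs)
  have hF : ∀ t, A t *ᵥ (C t *ᵥ (v t + g t)) + G t = D t *ᵥ v t + H t := by
    intro t
    simp only [D, H]
    rw [Matrix.mulVec_mulVec, Matrix.mulVec_add, add_assoc]
  refine ⟨fun t => C t *ᵥ (v t + g t), fun x hx hX => ?_⟩
  obtain ⟨i1, e1⟩ := hv x hX
  have hX' := hX
  obtain ⟨c, hc, d, hd, h1, h2⟩ := hX'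
  have i2 : IntegrableOn H {t | R x₀ t ∧ R t x} μ := (hHi c hc d hd h1).mono_set h2
  rw [IntegrableOn, hνr] at i1
  rw [hνr] at e1
  simp only [Matrix.smul_mulVec] at i1 e1
  rw [integral_smul] at e1
  have hinvx := hinv x hx
  have hsolve : C x *ᵥ (v x + g x) = v x + (σ / 2) • (μ.real {x} •
      (A x *ᵥ (C x *ᵥ (v x + g x)) + G x)) := by
    have h3 : (1 - (σ / 2 * μ.real {x}) • A x) *ᵥ (C x *ᵥ (v x + g x)) = v x + g x := by
      simp only [C, jumpInv]
      rw [Matrix.mulVec_mulVec, Matrix.mul_nonsing_inv _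
        ((Matrix.isUnit_iff_isUnit_det _).1 hinvx), Matrix.one_mulVec]
    rw [Matrix.sub_mulVec, Matrix.one_mulVec, Matrix.smul_mulVec, sub_eq_iff_eq_add] at h3
    nth_rewrite 1 [h3]
    simp only [g, smul_add, smul_smul]
    abel
  have i3 : IntegrableOn (fun t => D t *ᵥ v t) {t | R x₀ t ∧ R t x} μ := by
    have h4 := Integrable.smul σ⁻¹ i1
    refine h4.congr (ae_of_all _ fun t => ?_)
    simp [smul_smul, hσ0]
  have h5 := hF x
  simp only [hF]
  refine ⟨i3.add i2, ?_⟩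
  rw [hsolve, integral_add i3 i2, h5]
  nth_rewrite 1 [e1]
  simp only [gV]
  module

end Linear

end OrderZero

namespace OrderZero

/-! ### Two-sided initial value problems. -/

section Linear

variable {n : ℕ} {Ω : Opens ℝ} {μ : Measure ℝ} {A : ℝ → Matrix (Fin n) (Fin n) ℂ}

theorem exists_primitive_of_measurable [SFinite μ] (hΩ : (Ω : Set ℝ).OrdConnected)
    (hA : ∀ i j, Measurable fun x => A x i j) (hAi : ∀ i j, LocIntegrable Ω μ fun x => A x i j)
    {G : ℝ → Fin n → ℂ} (hG : Measurable G) (hGi : LocIntegrable Ω μ G)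
    (hinv₁ : ∀ x ∈ Ω, IsUnit (1 - (1 / 2 * μ.real {x}) • A x))
    (hinv₂ : ∀ x ∈ Ω, IsUnit (1 + (1 / 2 * μ.real {x}) • A x))
    (hμ : ∀ x ∈ Ω, μ {x} ≠ ∞) {x₀ : ℝ} (hx₀ : x₀ ∈ Ω) (ξ : Fin n → ℂ) :
    ∃ u : ℝ → Fin n → ℂ, u x₀ = ξ ∧ LocIntegrable Ω μ (fun x => A x *ᵥ u x + G x) ∧
      IsPrimitive Ω μ u (fun x => A x *ᵥ u x + G x) := by
  -- The density at `x₀` is determined by the prescribed value `ξ`. The half solutions start from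
  -- the right-hand and left-hand values of the solution at `x₀`, namely `ξ` plus or minus half of
  -- the jump there.
  let F₀ : Fin n → ℂ := A x₀ *ᵥ ξ + G x₀
  obtain ⟨ur, hr⟩ := exists_half_solution (R := fun s t => s < t) (σ := 1)
    (measurableSet_lt measurable_fst measurable_snd) (fun h h' => h.trans h') (fun h => h.not_gt)
    hA hAi hG hGi (by simp) one_ne_zero hinv₁ x₀ (ξ + (1 / 2 : ℝ) • (μ.real {x₀} • F₀))
  obtain ⟨ul, hl⟩ := exists_half_solution (R := fun s t => t < s) (σ := -1)
    (measurableSet_lt measurable_snd measurable_fst) (fun h h' => h'.trans h) (fun h => h.not_gt)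
    hA hAi hG hGi (by simp) (by norm_num)
    (fun x hx => by
      have := hinv₂ x hx
      rwa [show (-1 / 2 * μ.real {x} : ℝ) = -(1 / 2 * μ.real {x}) by ring, neg_smul, sub_neg_eq_add])
    x₀ (ξ - (1 / 2 : ℝ) • (μ.real {x₀} • F₀))
  have sr : ∀ x, {t | x₀ < t ∧ t < x} = Ioo x₀ x := fun x => rfl
  have sl : ∀ x, {t | t < x₀ ∧ x < t} = Ioo x x₀ := fun x => by
    ext t; exact and_comm
  let u : ℝ → Fin n → ℂ := fun x => if x₀ < x then ur x else if x < x₀ then ul x else ξ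
  have u0 : u x₀ = ξ := by simp [u]
  have u1 : ∀ {x}, x₀ < x → u x = ur x := fun h => by simp [u, h]
  have u2 : ∀ {x}, x < x₀ → u x = ul x := fun h => by simp [u, h, h.not_gt]
  let F : ℝ → Fin n → ℂ := fun x => A x *ᵥ u x + G x
  have hFr : ∀ x ∈ Ω, x₀ < x → IntegrableOn F (Ioo x₀ x) μ ∧
      u x = u x₀ + (1 / 2 : ℝ) • (μ.real {x₀} • F x₀) + (∫ t in Ioo x₀ x, F t ∂μ) +
        (1 / 2 : ℝ) • (μ.real {x} • F x) := by
    intro x hx hlt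
    obtain ⟨h1, h2⟩ := hr x hx ⟨x₀, hx₀, x, hx, hΩ.out hx₀ hx, by
      rw [sr]; exact Ioo_subset_Icc_self⟩
    rw [sr] at h1 h2
    have e : ∀ t ∈ Ioo x₀ x, A t *ᵥ ur t + G t = F t := fun t ht => by
      simp only [F, u1 ht.1]
    refine ⟨h1.congr_fun e measurableSet_Ioo, ?_⟩
    rw [setIntegral_congr_fun measurableSet_Ioo e, one_smul, ← u1 hlt] at h2
    simp only [F] at h2 ⊢
    rw [u0]
    exact h2
  have hFl : ∀ x ∈ Ω, x < x₀ → IntegrableOn F (Ioo x x₀) μ ∧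
      u x = u x₀ - (1 / 2 : ℝ) • (μ.real {x₀} • F x₀) - (∫ t in Ioo x x₀, F t ∂μ) -
        (1 / 2 : ℝ) • (μ.real {x} • F x) := by
    intro x hx hlt
    obtain ⟨h1, h2⟩ := hl x hx ⟨x, hx, x₀, hx₀, hΩ.out hx hx₀, by
      rw [sl]; exact Ioo_subset_Icc_self⟩
    rw [sl] at h1 h2
    have e : ∀ t ∈ Ioo x x₀, A t *ᵥ ul t + G t = F t := fun t ht => by
      simp only [F, u2 ht.2]
    refine ⟨h1.congr_fun e measurableSet_Ioo, ?_⟩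
    rw [setIntegral_congr_fun measurableSet_Ioo e, ← u2 hlt] at h2
    simp only [F] at h2 ⊢
    rw [u0]
    refine h2.trans ?_
    simp only [F₀]
    module
  have hs : ∀ x ∈ Ω, IntegrableOn F {x} μ := fun x hx => by
    simp [(hμ x hx).lt_top]
  have hFi : LocIntegrable Ω μ F := by
    intro c hc d hd
    obtain ⟨c', hc', hcc, -⟩ := exists_lt_mem Ω (show min c x₀ ∈ Ω by
      rcases min_choice c x₀ with h | h <;> rw [h] <;> assumption)
    obtain ⟨d', hd', hdd, -⟩ := exists_gt_mem Ω (show max d x₀ ∈ Ω by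
      rcases max_choice d x₀ with h | h <;> rw [h] <;> assumption)
    have h1 := (hFl c' hc' (hcc.trans_le (min_le_right _ _))).1
    have h2 := (hFr d' hd' ((le_max_right _ _).trans_lt hdd)).1
    refine ((h1.union (hs x₀ hx₀)).union h2).mono_set fun x hx => ?_
    have h3 : c' < x := (hcc.trans_le (min_le_left _ _)).trans_le hx.1
    have h4 : x < d' := hx.2.trans_lt ((le_max_left _ _).trans_lt hdd)
    rcases lt_trichotomy x x₀ with h | rfl | h
    · exact Or.inl (Or.inl ⟨h3, h⟩)
    · exact Or.inl (Or.inr rfl)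
    · exact Or.inr ⟨h, h4⟩
  refine ⟨u, u0, hFi, isPrimitive_of_base hFi hx₀ (fun x hx hle => ?_) fun x hx hle => ?_⟩
  · rcases hle.eq_or_lt with rfl | hlt
    · simp
    rw [hFi.integral_Ioc hx₀ hx hlt, hFi.integral_Ico hx₀ hx hlt, (hFr x hx hlt).2]
    module
  · rcases hle.eq_or_lt with rfl | hlt
    · simp
    rw [hFi.integral_Ioc hx hx₀ hlt, hFi.integral_Ico hx hx₀ hlt, (hFl x hx hlt).2]
    module

theorem IsPrimitive.congr_ae {E : Type*} [NormedAddCommGroup E] [NormedSpace ℝ E] {u F F' : ℝ → E}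
    (h : IsPrimitive Ω μ u F) (hF : F =ᵐ[μ] F') : IsPrimitive Ω μ u F' := by
  intro c hc d hd hcd
  rw [h c hc d hd hcd, integral_congr_ae (ae_restrict_of_ae hF),
    integral_congr_ae (ae_restrict_of_ae hF)]

theorem LocIntegrable.congr_ae {E : Type*} [NormedAddCommGroup E] {F F' : ℝ → E}
    (h : LocIntegrable Ω μ F) (hF : F =ᵐ[μ] F') : LocIntegrable Ω μ F' :=
  fun c hc d hd => (h c hc d hd).congr (ae_restrict_of_ae hF)

/-- The initial value problem `du = (A u + G) dμ`, `u(x₀) = ξ` has a balanced solution. -/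
theorem exists_primitive [SFinite μ] (hΩ : (Ω : Set ℝ).OrdConnected)
    (hA : ∀ i j, Measurable fun x => A x i j) (hAi : ∀ i j, LocIntegrable Ω μ fun x => A x i j)
    {G : ℝ → Fin n → ℂ} (hG : AEStronglyMeasurable G μ) (hGi : LocIntegrable Ω μ G)
    (hinv₁ : ∀ x ∈ Ω, IsUnit (1 - (1 / 2 * μ.real {x}) • A x))
    (hinv₂ : ∀ x ∈ Ω, IsUnit (1 + (1 / 2 * μ.real {x}) • A x))
    (hμ : ∀ x ∈ Ω, μ {x} ≠ ∞) {x₀ : ℝ} (hx₀ : x₀ ∈ Ω) (ξ : Fin n → ℂ) :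
    ∃ u : ℝ → Fin n → ℂ, u x₀ = ξ ∧ LocIntegrable Ω μ (fun x => A x *ᵥ u x + G x) ∧
      IsPrimitive Ω μ u (fun x => A x *ᵥ u x + G x) := by
  obtain ⟨u, h0, h1, h2⟩ := exists_primitive_of_measurable hΩ hA hAi
    hG.stronglyMeasurable_mk.measurable (hGi.congr_ae hG.ae_eq_mk) hinv₁ hinv₂ hμ hx₀ ξ
  have e : (fun x => A x *ᵥ u x + hG.mk G x) =ᵐ[μ] fun x => A x *ᵥ u x + G x := by
    filter_upwards [hG.ae_eq_mk] with x hx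
    rw [hx]
  exact ⟨u, h0, h1.congr_ae e, h2.congr_ae e⟩

end Linear

end OrderZero

namespace OrderZero

variable {Ω : Opens ℝ} {n : ℕ} {q w : DistMatrix Ω n}

/-! ### Completeness of `L²(w)` -/

open scoped Matrix.Norms.L2Operator MatrixOrder in
/-- A measurable family of positive semidefinite matrices has a measurable family of square
roots. -/
theorem exists_measurable_sqrt {A : ℝ → Matrix (Fin n) (Fin n) ℂ}
    (hA : ∀ i j, Measurable fun x => A x i j) (hp : ∀ x, (A x).PosSemidef) :
    ∃ S : ℝ → Matrix (Fin n) (Fin n) ℂ, (∀ i j, Measurable fun x => S x i j) ∧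
      (∀ x, (S x).PosSemidef) ∧ ∀ x, S x * S x = A x := by
  refine ⟨fun x => CFC.sqrt (A x), fun i j => ?_, fun x => ?_, fun x => ?_⟩
  -- Measurability of the square roots comes from continuity of the square root on the positive
  -- cone.
  · have hc : ContinuousOn (fun a : Matrix (Fin n) (Fin n) ℂ => (CFC.sqrt a) i j)
        {a | 0 ≤ a} :=
      (continuous_apply_apply i j).comp_continuousOn CFC.continuousOn_sqrt
    rw [continuousOn_iff_continuous_domRestrict] at hc
    have hm : Measurable fun x => (⟨fun i j => A x i j, Matrix.nonneg_iff_posSemidef.2 (hp x)⟩ :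
        {a : Fin n → Fin n → ℂ | 0 ≤ (show Matrix (Fin n) (Fin n) ℂ from a)}) :=
      Measurable.subtype_mk (measurable_pi_iff.2 fun i => measurable_pi_iff.2 fun j => hA i j)
    exact (show Continuous ({a : Fin n → Fin n → ℂ |
      0 ≤ (show Matrix (Fin n) (Fin n) ℂ from a)}.domRestrict fun a => (CFC.sqrt
        (show Matrix (Fin n) (Fin n) ℂ from a)) i j) from hc).measurable.comp hm
  · exact Matrix.nonneg_iff_posSemidef.1 (CFC.sqrt_nonneg _)
  · exact CFC.sqrt_mul_sqrt_self _ (Matrix.nonneg_iff_posSemidef.2 (hp x))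

/-- Coercivity of `S + ε` and the Cauchy–Schwarz inequality. For `ε > 0` it gives invertibility and
the bound `1` for the Euclidean norm of `ε (S + ε)⁻¹`. -/
theorem norm_le_norm_add_mulVec {S : Matrix (Fin n) (Fin n) ℂ} (hS : S.PosSemidef) (ε : ℝ)
    (v : Fin n → ℂ) :
    ε * ‖WithLp.toLp 2 v‖ ≤ ‖WithLp.toLp 2 ((S + (ε : ℂ) • 1) *ᵥ v)‖ := by
  have h1 : RCLike.re (inner ℂ (WithLp.toLp 2 v) (WithLp.toLp 2 ((S + (ε : ℂ) • 1) *ᵥ v))) ≥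
      ε * ‖WithLp.toLp 2 v‖ ^ 2 := by
    have h2 : 0 ≤ star v ⬝ᵥ S *ᵥ v := (Matrix.posSemidef_iff_dotProduct_mulVec.1 hS).2 v
    have e : WithLp.toLp 2 ((S + (ε : ℂ) • 1) *ᵥ v) =
        WithLp.toLp 2 (S *ᵥ v) + (ε : ℂ) • WithLp.toLp 2 v := by
      rw [Matrix.add_mulVec, Matrix.smul_mulVec, Matrix.one_mulVec]
      rfl
    rw [e, inner_add_right, inner_smul_right, inner_self_eq_norm_sq_to_K, map_add,
      EuclideanSpace.inner_toLp_toLp, dotProduct_comm]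
    have h3 := (Complex.nonneg_iff.1 h2).1
    have h4 : RCLike.re ((ε : ℂ) * ((‖WithLp.toLp 2 v‖ : ℝ) : ℂ) ^ 2) =
        ε * ‖WithLp.toLp 2 v‖ ^ 2 := by
      rw [show (ε : ℂ) * ((‖WithLp.toLp 2 v‖ : ℝ) : ℂ) ^ 2 =
        ((ε * ‖WithLp.toLp 2 v‖ ^ 2 : ℝ) : ℂ) by push_cast; ring]
      exact Complex.ofReal_re _
    have h5 : RCLike.re ((ε : ℂ) * ((‖WithLp.toLp 2 v‖ : ℝ) : ℂ) ^ 2) +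
      RCLike.re (star v ⬝ᵥ S *ᵥ v) ≥ ε * ‖WithLp.toLp 2 v‖ ^ 2 := by
      rw [h4]; simpa using h3
    rw [add_comm]
    exact h5
  have h2 := (RCLike.re_le_norm _).trans (norm_inner_le_norm (𝕜 := ℂ) (WithLp.toLp 2 v)
    (WithLp.toLp 2 ((S + (ε : ℂ) • 1) *ᵥ v)))
  rcases (norm_nonneg (WithLp.toLp 2 v)).eq_or_lt with h | h
  · rw [← h]; simp
  · refine le_of_mul_le_mul_left ?_ h
    calc _ = ε * ‖WithLp.toLp 2 v‖ ^ 2 := by ring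
      _ ≤ _ := h1.le.trans h2

/-- Tikhonov regularization: a solution of `S v = G` is the limit of the solutions of
`(S + ε) v = G`. -/
theorem exists_tendsto_regularized {S : Matrix (Fin n) (Fin n) ℂ} (hS : S.PosSemidef)
    {G : Fin n → ℂ} (hG : ∃ v, S *ᵥ v = G) {e : ℕ → ℝ} (he : ∀ k, 0 < e k)
    (hlim : Tendsto e atTop (𝓝 0)) :
    ∃ v, S *ᵥ v = G ∧ Tendsto (fun k => (S + (e k : ℂ) • 1)⁻¹ *ᵥ G) atTop (𝓝 v) := by
  obtain ⟨h, rfl⟩ := hG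
  -- As `S` is Hermitian, its kernel is the orthogonal complement of its range. The component in the
  -- range is the solution of minimal norm, and the regularized solutions converge to it.
  have hdec : ∃ h0 k, h = h0 + S *ᵥ k ∧ S *ᵥ h0 = 0 := by
    let L : EuclideanSpace ℂ (Fin n) →ₗ[ℂ] EuclideanSpace ℂ (Fin n) := S.toEuclideanLin
    have hL : L.IsSymmetric := Matrix.isSymmetric_toEuclideanLin_iff.2 hS.1
    have h1 : (LinearMap.range L)ᗮ = LinearMap.ker L := hL.orthogonal_range
    have h2 : WithLp.toLp 2 h ∈ LinearMap.range L ⊔ (LinearMap.range L)ᗮ := by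
      rw [Submodule.sup_orthogonal_of_hasOrthogonalProjection]; trivial
    rw [h1] at h2
    obtain ⟨a, ⟨k, rfl⟩, b, hb, hab⟩ := Submodule.mem_sup.1 h2
    refine ⟨WithLp.ofLp b, WithLp.ofLp k, ?_, ?_⟩
    · rw [add_comm]
      exact (congrArg WithLp.ofLp hab).symm
    · exact congrArg WithLp.ofLp (LinearMap.mem_ker.1 hb)
  obtain ⟨h0, k, rfl, h0S⟩ := hdec
  have hinv : ∀ m, IsUnit (S + (e m : ℂ) • 1) := by
    intro m
    rw [← Matrix.mulVec_injective_iff_isUnit]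
    intro x y hxy
    have h1 := norm_le_norm_add_mulVec hS (e m) (x - y)
    rw [Matrix.mulVec_sub, sub_eq_zero.2 hxy] at h1
    have h2 : ‖WithLp.toLp 2 (x - y)‖ ≤ 0 := by
      have : (0 : ℝ) = ‖WithLp.toLp 2 (0 : Fin n → ℂ)‖ := by simp
      rw [← this] at h1
      exact nonpos_of_mul_nonpos_right h1 (he m)
    have h3 := norm_le_zero_iff.1 h2
    exact sub_eq_zero.1 (congrArg WithLp.ofLp h3)
  refine ⟨S *ᵥ k, by rw [Matrix.mulVec_add, h0S, zero_add], ?_⟩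
  rw [Matrix.mulVec_add, h0S, zero_add]
  -- From `(S + ε)⁻¹ S = 1 - ε (S + ε)⁻¹`, used twice. In the last term `ε (S + ε)⁻¹ k` stays
  -- bounded, so the second factor `ε` sends it to zero.
  have key : ∀ m, (S + (e m : ℂ) • 1)⁻¹ *ᵥ (S *ᵥ (S *ᵥ k)) = S *ᵥ k - (e m : ℂ) • k +
      (e m : ℂ) • ((e m : ℂ) • ((S + (e m : ℂ) • 1)⁻¹ *ᵥ k)) := by
    intro m
    have h1 : (S + (e m : ℂ) • 1)⁻¹ * (S + (e m : ℂ) • 1) = 1 :=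
      Matrix.nonsing_inv_mul _ ((Matrix.isUnit_iff_isUnit_det _).1 (hinv m))
    have h2 : ∀ x, (S + (e m : ℂ) • 1)⁻¹ *ᵥ (S *ᵥ x) =
        x - (e m : ℂ) • ((S + (e m : ℂ) • 1)⁻¹ *ᵥ x) := by
      intro x
      have h3 : S *ᵥ x = (S + (e m : ℂ) • 1) *ᵥ x - (e m : ℂ) • x := by
        rw [Matrix.add_mulVec, Matrix.smul_mulVec, Matrix.one_mulVec]; abel
      rw [h3, Matrix.mulVec_sub, Matrix.mulVec_mulVec, h1, Matrix.one_mulVec, Matrix.mulVec_smul]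
    rw [h2, h2, smul_sub]
    abel
  simp only [key]
  have hc : Tendsto (fun m => (e m : ℂ)) atTop (𝓝 0) := by
    have := (Complex.continuous_ofReal.tendsto 0).comp hlim
    simpa [Function.comp_def] using this
  have hb : ∀ m, ‖(e m : ℂ) • ((S + (e m : ℂ) • 1)⁻¹ *ᵥ k)‖ ≤ ‖WithLp.toLp 2 k‖ := by
    intro m
    have h1 := norm_le_norm_add_mulVec hS (e m) ((S + (e m : ℂ) • 1)⁻¹ *ᵥ k)
    rw [Matrix.mulVec_mulVec, Matrix.mul_nonsing_inv _
      ((Matrix.isUnit_iff_isUnit_det _).1 (hinv m)), Matrix.one_mulVec] at h1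
    rw [norm_smul, Complex.norm_real, Real.norm_of_nonneg (he m).le]
    refine le_trans (mul_le_mul_of_nonneg_left ?_ (he m).le) h1
    rw [pi_norm_le_iff_of_nonneg (norm_nonneg _)]
    exact fun i => PiLp.norm_apply_le (WithLp.toLp 2 ((S + (e m : ℂ) • 1)⁻¹ *ᵥ k)) i
  have t1 : Tendsto (fun m => (e m : ℂ) • k) atTop (𝓝 0) := by
    simpa using hc.smul_const k
  have t2 : Tendsto (fun m => (e m : ℂ) • ((e m : ℂ) • ((S + (e m : ℂ) • 1)⁻¹ *ᵥ k))) atTop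
      (𝓝 0) := by
    refine hc.zero_smul_isBoundedUnder_le ?_
    exact isBoundedUnder_of ⟨_, hb⟩
  simpa using (tendsto_const_nhds.sub t1).add t2

end OrderZero

namespace OrderZero

variable {Ω : Opens ℝ} {n : ℕ} {q w : DistMatrix Ω n}

theorem aestronglyMeasurable_mulVec {μ : Measure ℝ} {A : ℝ → Matrix (Fin n) (Fin n) ℂ}
    (hA : ∀ i j, AEStronglyMeasurable (fun x => A x i j) μ) {f : ℝ → Fin n → ℂ}
    (hf : AEStronglyMeasurable f μ) : AEStronglyMeasurable (fun x => A x *ᵥ f x) μ := by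
  have hf' : ∀ i, AEStronglyMeasurable (fun x => f x i) μ := fun i =>
    (continuous_apply i).comp_aestronglyMeasurable hf
  refine (aemeasurable_pi_lambda _ fun i => ?_).aestronglyMeasurable
  refine AEStronglyMeasurable.aemeasurable ?_
  exact Finset.aestronglyMeasurable_fun_sum (f := fun j x => A x i j * f x j) Finset.univ
    fun j _ => (hA i j).mul (hf' j)

namespace MeasureRep

theorem norm_cls_sq {r : MeasureRep q w} (f : r.FunL2) :
    ((‖cls f‖ ^ 2 : ℝ) : ℂ) = ∫ x, r.dens f.fn f.fn x ∂r.μ := by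
  have h := inner_self_eq_norm_sq_to_K (𝕜 := ℂ) (cls f)
  rw [inner_cls] at h
  push_cast
  exact h.symm

/-- `𝓛²(w)` is complete. -/
theorem completeSpace_funL2 (r : MeasureRep q w) : CompleteSpace r.FunL2 := by
  obtain ⟨S, hSm, hSp, hSS⟩ := exists_measurable_sqrt r.wd_measurable r.wd_posSemidef
  have hSa : ∀ i j, AEStronglyMeasurable (fun x => S x i j) r.μ := fun i j =>
    (hSm i j).aestronglyMeasurable
  -- Multiplication by the square root of the density of `w` is an isometry into a complete `L²`
  -- space over `μ`, so it remains to see that its range is closed.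
  let Φ : (ℝ → Fin n → ℂ) → ℝ → EuclideanSpace ℂ (Fin n) := fun f x => WithLp.toLp 2 (S x *ᵥ f x)
  have hΦm : ∀ f, AEStronglyMeasurable f r.μ → AEStronglyMeasurable (Φ f) r.μ := fun f hf =>
    (PiLp.continuous_toLp 2 _).comp_aestronglyMeasurable (aestronglyMeasurable_mulVec hSa hf)
  have hΦn : ∀ f x, ((‖Φ f x‖ ^ 2 : ℝ) : ℂ) = r.dens f f x := by
    intro f x
    have h := inner_self_eq_norm_sq_to_K (𝕜 := ℂ) (Φ f x)
    rw [EuclideanSpace.inner_toLp_toLp, dotProduct_comm, Matrix.star_mulVec,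
      ← Matrix.dotProduct_mulVec, (hSp x).1, Matrix.mulVec_mulVec, hSS] at h
    push_cast
    exact h.symm
  have hint : ∀ f, AEStronglyMeasurable f r.μ →
      (Integrable (r.dens f f) r.μ ↔ MemLp (Φ f) 2 r.μ) := by
    intro f hf
    rw [memLp_two_iff_integrable_sq_norm (hΦm f hf)]
    have e : r.dens f f = fun x => ((‖Φ f x‖ ^ 2 : ℝ) : ℂ) := by funext x; rw [hΦn]
    rw [e]
    exact ⟨fun h => h.re.congr (ae_of_all _ fun x => Complex.ofReal_re _), fun h => h.ofReal⟩
  have hmem : ∀ f : r.FunL2, MemLp (Φ f.fn) 2 r.μ := fun f => (hint f.fn f.memL2.1).1 f.memL2.2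
  let φ : r.FunL2 →ₗ[ℂ] Lp (EuclideanSpace ℂ (Fin n)) 2 r.μ :=
    { toFun := fun f => (hmem f).toLp
      map_add' := fun f g => by
        rw [← MemLp.toLp_add]
        congr 1
        funext x
        exact congrArg (WithLp.toLp 2) (Matrix.mulVec_add (S x) (f.fn x) (g.fn x))
      map_smul' := fun c f => by
        rw [RingHom.id_apply, ← MemLp.toLp_const_smul]
        congr 1
        funext x
        exact congrArg (WithLp.toLp 2) (Matrix.mulVec_smul (S x) c (f.fn x)) }
  have hφ : ∀ f, ‖φ f‖ = ‖f‖ := by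
    intro f
    have h1 := inner_self_eq_norm_sq_to_K (𝕜 := ℂ) (φ f)
    rw [L2.inner_def] at h1
    have h2 := norm_cls_sq f
    have h3 : ∫ x, inner ℂ (φ f x) (φ f x) ∂r.μ = ∫ x, r.dens f.fn f.fn x ∂r.μ := by
      refine integral_congr_ae ?_
      filter_upwards [(hmem f).coeFn_toLp] with x hx
      have hx' : φ f x = Φ f.fn x := hx
      rw [hx', ← hΦn, inner_self_eq_norm_sq_to_K]
      push_cast; rfl
    rw [h3, ← h2] at h1
    have h4 : ‖cls f‖ ^ 2 = ‖φ f‖ ^ 2 := by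
      have : ((‖cls f‖ ^ 2 : ℝ) : ℂ) = ((‖φ f‖ ^ 2 : ℝ) : ℂ) := by
        rw [h1]; push_cast; rfl
      exact_mod_cast this
    have h5 : ‖cls f‖ = ‖f‖ := SeparationQuotient.norm_mk f
    rw [← h5]
    exact ((sq_eq_sq₀ (norm_nonneg _) (norm_nonneg _)).1 h4).symm
  let φi : r.FunL2 →ₗᵢ[ℂ] Lp (EuclideanSpace ℂ (Fin n)) 2 r.μ := ⟨φ, hφ⟩
  have hui : IsUniformInducing φi := φi.isometry.isUniformInducing
  rw [completeSpace_iff_isComplete_range hui]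
  refine IsClosed.isComplete (isSeqClosed_iff_isClosed.1 fun f G hf hG => ?_)
  choose g hg using hf
  obtain ⟨ns, hns, hae⟩ := (tendstoInMeasure_of_tendsto_Lp hG).exists_seq_tendsto_ae
  let e : ℕ → ℝ := fun k => 1 / ((k : ℝ) + 1)
  have he : ∀ k, 0 < e k := fun k => Nat.one_div_pos_of_nat
  have helim : Tendsto e atTop (𝓝 0) := tendsto_one_div_add_atTop_nhds_zero_nat
  have hfΦ : ∀ᵐ x ∂r.μ, ∀ k, f k x = Φ (g k).fn x := by
    refine ae_all_iff.2 fun k => ?_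
    have : f k =ᵐ[r.μ] Φ (g k).fn := by
      rw [← hg k]
      exact (hmem (g k)).coeFn_toLp
    exact this
  -- Almost everywhere along a subsequence the limit `G x` lies in the closed range of `S x`. A
  -- preimage could be picked at each point, but a measurable choice is needed; the limit of the
  -- regularized solutions provides one.
  have hsel : ∀ᵐ x ∂r.μ, ∃ v, S x *ᵥ v = WithLp.ofLp (G x) ∧
      Tendsto (fun k => (S x + (e k : ℂ) • 1)⁻¹ *ᵥ WithLp.ofLp (G x)) atTop (𝓝 v) := by
    filter_upwards [hae, hfΦ] with x h1 h2
    refine exists_tendsto_regularized (hSp x) ?_ he helim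
    have hcl : IsClosed (LinearMap.range (S x).mulVecLin : Set (Fin n → ℂ)) :=
      Submodule.closed_of_finiteDimensional _
    have := hcl.mem_of_tendsto (((PiLp.continuous_ofLp 2 _).tendsto _).comp h1)
      (Eventually.of_forall fun k => by
        simp only [Function.comp, h2]
        exact ⟨(g (ns k)).fn x, rfl⟩)
    obtain ⟨v, hv⟩ := this
    exact ⟨v, hv⟩
  obtain ⟨v, hvm, hv⟩ := exists_stronglyMeasurable_limit_of_tendsto_ae
    (f := fun k x => (S x + (e k : ℂ) • 1)⁻¹ *ᵥ WithLp.ofLp (G x)) (μ := r.μ) (fun k => by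
      refine aestronglyMeasurable_mulVec (fun i j => ?_)
        ((PiLp.continuous_ofLp 2 _).comp_aestronglyMeasurable (Lp.aestronglyMeasurable G))
      refine (measurable_inv_apply (fun i j => ?_) i j).aestronglyMeasurable
      simp only [Matrix.add_apply]
      exact (hSm i j).add measurable_const)
    (hsel.mono fun x ⟨v, _, hv⟩ => ⟨v, hv⟩)
  have hvG : G =ᵐ[r.μ] Φ v := by
    filter_upwards [hsel, hv] with x ⟨v', h1, h2⟩ h3
    rw [tendsto_nhds_unique h2 h3] at h1
    exact (congrArg (WithLp.toLp 2) h1).symm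
  have hvL : r.MemL2 v := ⟨hvm.aestronglyMeasurable,
    (hint v hvm.aestronglyMeasurable).2 ((memLp_congr_ae hvG).1 (Lp.memLp G))⟩
  refine ⟨(⟨v, hvL⟩ : r.funSubmodule), ?_⟩
  refine Lp.ext ?_
  exact (MemLp.coeFn_toLp (hmem (⟨v, hvL⟩ : r.funSubmodule))).trans hvG.symm

instance completeSpace_L2 (r : MeasureRep q w) : CompleteSpace r.L2 := by
  have := r.completeSpace_funL2
  infer_instance

end MeasureRep

end OrderZero

namespace OrderZero

/-! ### Self-adjoint relations and their resolvents -/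

section Relation

variable {𝓗 : Type*} [NormedAddCommGroup 𝓗] [InnerProductSpace ℂ 𝓗] {T : Submodule ℂ (𝓗 × 𝓗)}

/-- The resolvent set of a linear relation. -/
def relResSet (T : Submodule ℂ (𝓗 × 𝓗)) : Set ℂ :=
  {z | (∀ u, (u, z • u) ∈ T → u = 0) ∧ ∀ f, ∃ u, (u, z • u + f) ∈ T}

theorem inner_symm_of_adjoint_eq (hT : T.adjoint = T) {u g v h : 𝓗} (hu : (u, g) ∈ T)
    (hv : (v, h) ∈ T) : inner ℂ g v = inner ℂ u h := by
  rw [← hT] at hv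
  exact sub_eq_zero.1 ((Submodule.mem_adjoint_iff T (v, h)).1 hv u g hu)

theorem mem_of_adjoint_eq (hT : T.adjoint = T) {v h : 𝓗}
    (H : ∀ u g, (u, g) ∈ T → inner ℂ g v = inner ℂ u h) : (v, h) ∈ T := by
  rw [← hT]
  exact (Submodule.mem_adjoint_iff T (v, h)).2 fun a b hab => sub_eq_zero.2 (H a b hab)

theorem isClosed_of_adjoint_eq (hT : T.adjoint = T) : IsClosed (T : Set (𝓗 × 𝓗)) := by
  have e : (T : Set (𝓗 × 𝓗)) = ⋂ p ∈ (T : Set (𝓗 × 𝓗)), {x | inner ℂ p.2 x.1 = inner ℂ p.1 x.2} := by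
    ext x
    simp only [mem_iInter, mem_ofPred_eq, SetLike.mem_coe]
    exact ⟨fun hx p hp => inner_symm_of_adjoint_eq hT hp hx,
      fun h => mem_of_adjoint_eq hT fun u g hu => h (u, g) hu⟩
  rw [e]
  exact isClosed_biInter fun p _ => isClosed_eq (by fun_prop) (by fun_prop)

/-- Symmetry of `T` applied to the pair and itself leaves `Im z ‖u‖² = -Im ⟨u, f⟩`. -/
theorem abs_im_mul_norm_le (hT : T.adjoint = T) {z : ℂ} {u f : 𝓗} (h : (u, z • u + f) ∈ T) :
    |z.im| * ‖u‖ ≤ ‖f‖ := by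
  have h1 := inner_symm_of_adjoint_eq hT h h
  rw [inner_add_left, inner_add_right, inner_smul_left, inner_smul_right] at h1
  have h2 : 2 * z.im * ‖u‖ ^ 2 = -2 * (inner ℂ u f).im := by
    have h3 := congrArg Complex.im h1
    rw [inner_self_eq_norm_sq_to_K, ← inner_conj_symm f u] at h3
    have e : ((‖u‖ : ℂ)) ^ 2 = ((‖u‖ ^ 2 : ℝ) : ℂ) := by push_cast; rfl
    change ((starRingEnd ℂ) z * (‖u‖ : ℂ) ^ 2 + _).im = (z * (‖u‖ : ℂ) ^ 2 + _).im at h3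
    rw [e] at h3
    simp only [Complex.add_im, Complex.im_mul_ofReal, Complex.conj_im] at h3
    linarith
  have h3 : |z.im| * ‖u‖ ^ 2 ≤ ‖u‖ * ‖f‖ := by
    have h4 : z.im * ‖u‖ ^ 2 = -(inner ℂ u f).im := by linarith
    calc |z.im| * ‖u‖ ^ 2 = |z.im * ‖u‖ ^ 2| := by rw [abs_mul, abs_of_nonneg (sq_nonneg ‖u‖)]
      _ = |(inner ℂ u f).im| := by rw [h4, abs_neg]
      _ ≤ ‖inner ℂ u f‖ := Complex.abs_im_le_norm _
      _ ≤ ‖u‖ * ‖f‖ := norm_inner_le_norm u f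
  rcases (norm_nonneg u).eq_or_lt with h0 | h0
  · rw [← h0]; simp
  · refine le_of_mul_le_mul_left ?_ h0
    calc _ = |z.im| * ‖u‖ ^ 2 := by ring
      _ ≤ _ := h3

/-- The non-real points are in the resolvent set of a self-adjoint relation. -/
theorem mem_relResSet_of_im_ne_zero [CompleteSpace 𝓗] (hT : T.adjoint = T) {z : ℂ}
    (hz : z.im ≠ 0) : z ∈ relResSet T := by
  have inj : ∀ z : ℂ, z.im ≠ 0 → ∀ u, (u, z • u) ∈ T → u = 0 := by
    intro z hz u hu
    have h1 := abs_im_mul_norm_le hT (u := u) (f := 0) (by rwa [add_zero])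
    rw [norm_zero] at h1
    exact norm_le_zero_iff.1 (nonpos_of_mul_nonpos_right h1 (abs_pos.2 hz))
  refine ⟨inj z hz, ?_⟩
  let L : 𝓗 × 𝓗 →ₗ[ℂ] 𝓗 := LinearMap.snd ℂ 𝓗 𝓗 - z • LinearMap.fst ℂ 𝓗 𝓗
  have hL : ∀ f, f ∈ T.map L ↔ ∃ u, (u, z • u + f) ∈ T := by
    intro f
    rw [Submodule.mem_map]
    constructor
    · rintro ⟨⟨u, g⟩, hp, rfl⟩
      refine ⟨u, ?_⟩
      convert hp using 2
      simp [L]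
    · rintro ⟨u, hu⟩
      exact ⟨_, hu, by simp [L]⟩
  -- By the lower bound, convergence of the images forces convergence of the preimages, and `T` is
  -- closed because it is an adjoint.
  have hclosed : IsClosed (T.map L : Set 𝓗) := by
    refine isSeqClosed_iff_isClosed.1 fun f g hf hg => ?_
    choose u hu using fun k => (hL (f k)).1 (hf k)
    have hcau : CauchySeq u := by
      have h1 := hg.cauchySeq
      rw [Metric.cauchySeq_iff] at h1 ⊢
      intro ε hε
      obtain ⟨N, hN⟩ := h1 (|z.im| * ε) (mul_pos (abs_pos.2 hz) hε)
      refine ⟨N, fun m hm k hk => ?_⟩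
      have h2 := hN m hm k hk
      rw [dist_eq_norm] at h2 ⊢
      have h3 := abs_im_mul_norm_le hT (z := z) (u := u m - u k) (f := f m - f k) (by
        convert T.sub_mem (hu m) (hu k) using 1
        simp only [Prod.mk_sub_mk, smul_sub]
        congr 1
        abel)
      exact lt_of_mul_lt_mul_left (h3.trans_lt h2) (abs_nonneg _)
    obtain ⟨v, hv⟩ := cauchySeq_tendsto_of_complete hcau
    refine (hL g).2 ⟨v, (isClosed_of_adjoint_eq hT).mem_of_tendsto
      (hv.prodMk_nhds ((hv.const_smul z).add hg)) (Eventually.of_forall hu)⟩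
  -- A vector `h` orthogonal to the range of `T - z` satisfies `(h, z̄ h) ∈ T^* = T`, and `z̄` is
  -- not an eigenvalue.
  have horth : (T.map L)ᗮ = ⊥ := by
    rw [Submodule.eq_bot_iff]
    intro h hh
    refine inj (star z) (by simpa using hz) h (mem_of_adjoint_eq hT fun u g hu => ?_)
    have h1 := (Submodule.mem_orthogonal _ _).1 hh (g - z • u) ((hL _).2 ⟨u, by
      rwa [add_sub_cancel]⟩)
    rw [inner_sub_left, inner_smul_left, sub_eq_zero] at h1
    rw [h1, inner_smul_right]
    rfl
  have : CompleteSpace (T.map L) := hclosed.completeSpace_coe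
  have htop := (Submodule.orthogonal_eq_bot_iff).1 horth
  intro f
  exact (hL f).1 (htop ▸ Submodule.mem_top)

theorem star_mem_relResSet [CompleteSpace 𝓗] (hT : T.adjoint = T) {z : ℂ} (hz : z ∈ relResSet T) :
    star z ∈ relResSet T := by
  by_cases h : z.im = 0
  · rwa [show star z = z from Complex.conj_eq_iff_im.2 h]
  · exact mem_relResSet_of_im_ne_zero hT (by simpa using h)

theorem relResSet_unique {z : ℂ} (hz : z ∈ relResSet T) {u v f : 𝓗} (hu : (u, z • u + f) ∈ T)
    (hv : (v, z • v + f) ∈ T) : u = v := by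
  refine sub_eq_zero.1 (hz.1 _ ?_)
  convert T.sub_mem hu hv using 1
  simp [smul_sub]

/-- The resolvent of a self-adjoint relation is bounded. -/
theorem exists_resolvent [CompleteSpace 𝓗] (hT : T.adjoint = T) {z : ℂ} (hz : z ∈ relResSet T) :
    ∃ R : 𝓗 →L[ℂ] 𝓗, ∀ f, (R f, z • R f + f) ∈ T := by
  choose R hR using hz.2
  let R' : 𝓗 →ₗ[ℂ] 𝓗 :=
    { toFun := R
      map_add' := fun f g => relResSet_unique hz (hR _) (by
        convert T.add_mem (hR f) (hR g) using 1
        simp only [Prod.mk_add_mk, smul_add]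
        congr 1
        abel)
      map_smul' := fun c f => relResSet_unique hz (hR _) (by
        convert T.smul_mem c (hR f) using 1
        simp only [Prod.smul_mk, smul_add, RingHom.id_apply]
        rw [smul_comm]) }
  -- Boundedness follows from the closed graph theorem, since `T` is closed.
  refine ⟨⟨R', R'.continuous_of_seq_closed_graph fun u x y hu hy => ?_⟩, hR⟩
  refine relResSet_unique hz ?_ (hR x)
  exact (isClosed_of_adjoint_eq hT).mem_of_tendsto (hy.prodMk_nhds ((hy.const_smul z).add hu))
    (Eventually.of_forall fun k => hR _)

/-- The resolvent is analytic. -/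
theorem analyticOnNhd_resolvent [CompleteSpace 𝓗] {R : ℂ → 𝓗 →L[ℂ] 𝓗}
    (hR : ∀ z ∈ relResSet T, ∀ f, (R z f, z • R z f + f) ∈ T) :
    AnalyticOnNhd ℂ R (relResSet T) := by
  intro z₀ hz₀
  -- By the resolvent identity `R z` must equal `R z₀` composed with the inverse of `B z`. Near `z₀`
  -- this inverse exists and is analytic, and it is checked that such `z` are in the resolvent set,
  -- so the formula does agree with `R z`.
  let B : ℂ → 𝓗 →L[ℂ] 𝓗 := fun z => 1 - (z - z₀) • R z₀
  have hB : AnalyticAt ℂ B z₀ :=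
    analyticAt_const.sub ((analyticAt_id.sub analyticAt_const).smul analyticAt_const)
  have hB0 : B z₀ = 1 := by simp [B]
  have hu : ∀ᶠ z in 𝓝 z₀, IsUnit (B z) := by
    refine hB.continuousAt.eventually (p := IsUnit) ?_
    rw [hB0]
    exact Units.isOpen.mem_nhds isUnit_one
  have hinv : AnalyticAt ℂ (fun z => Ring.inverse (B z)) z₀ := by
    have h1 : AnalyticAt ℂ Ring.inverse (B z₀) := by
      rw [hB0]
      exact analyticAt_inverse (𝕜 := ℂ) (1 : (𝓗 →L[ℂ] 𝓗)ˣ)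
    exact h1.comp hB
  have hmain : AnalyticAt ℂ (fun z => R z₀ * Ring.inverse (B z)) z₀ := analyticAt_const.mul hinv
  refine hmain.congr ?_
  filter_upwards [hu] with z hz
  have hBi : B z * Ring.inverse (B z) = 1 := Ring.mul_inverse_cancel _ hz
  have hiB : Ring.inverse (B z) * B z = 1 := Ring.inverse_mul_cancel _ hz
  have hinj : ∀ u, (u, z • u) ∈ T → u = 0 := by
    intro u hu
    have h1 : u = R z₀ ((z - z₀) • u) := relResSet_unique hz₀ (f := (z - z₀) • u)
      (by rw [← add_smul]; simpa using hu) (hR z₀ hz₀ _)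
    have h2 : B z u = 0 := by
      simp only [B, sub_apply, smul_apply,
        one_apply_eq_self]
      rw [← map_smul, ← h1, sub_self]
    have h3 := congrArg (fun A : 𝓗 →L[ℂ] 𝓗 => A u) hiB
    simp only [mul_apply_eq_comp, h2, map_zero, one_apply_eq_self] at h3
    exact h3.symm
  have hmem : ∀ f, ((R z₀ * Ring.inverse (B z)) f,
      z • (R z₀ * Ring.inverse (B z)) f + f) ∈ T := by
    intro f
    have h1 := congrArg (fun A : 𝓗 →L[ℂ] 𝓗 => A f) hBi
    simp only [mul_apply_eq_comp, one_apply_eq_self] at h1 ⊢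
    set g := Ring.inverse (B z) f
    convert hR z₀ hz₀ g using 2
    rw [← h1]
    simp only [B, sub_apply, smul_apply,
        one_apply_eq_self]
    module
  have hzρ : z ∈ relResSet T := ⟨hinj, fun f => ⟨_, hmem f⟩⟩
  ext f
  exact relResSet_unique hzρ (hmem f) (hR z hzρ f)

end Relation

end OrderZero

namespace OrderZero

/-! ### The Weyl map of a self-adjoint relation -/

section WeylMap

variable {𝓗 : Type*} [NormedAddCommGroup 𝓗] [InnerProductSpace ℂ 𝓗] {T : Submodule ℂ (𝓗 × 𝓗)}
  {E : Type*} [NormedAddCommGroup E] [InnerProductSpace ℂ E]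
  {D : Type*} [AddCommGroup D] [Module ℂ D] (Y H : D →ₗ[ℂ] 𝓗) (ζ y : D →ₗ[ℂ] E)

/-- The sesquilinear form of the Weyl map, where `R` is the resolvent at `z`. -/
noncomputable def weylForm (R : 𝓗 →L[ℂ] 𝓗) (z : ℂ) (d' : D) : D →ₗ[ℂ] ℂ where
  -- With `f = H d - z Y d` and `u = R f`, the first three terms are `⟨H d', u⟩ - ⟨Y d', z u + f⟩`.
  -- By Green's identity for `(u, z u + f)` in `T` they amount to `⟨ζ d', e⟩`, with `e` the boundary
  -- value of that pair. So the form is `⟨ζ d', e - y d⟩`, written without reference to evaluation.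
  toFun d := inner ℂ (H d') (R (H d - z • Y d)) - z * inner ℂ (Y d') (R (H d - z • Y d)) -
    inner ℂ (Y d') (H d - z • Y d) - inner ℂ (ζ d') (y d)
  map_add' d₁ d₂ := by
    simp only [map_add, map_sub, map_smul, smul_add, inner_add_right, inner_sub_right,
      inner_smul_right]
    ring
  map_smul' c d := by
    simp only [map_sub, map_smul, inner_sub_right, inner_smul_right, smul_eq_mul,
      RingHom.id_apply]
    ring

theorem weylForm_apply (R : 𝓗 →L[ℂ] 𝓗) (z : ℂ) (d' d : D) : weylForm Y H ζ y R z d' d =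
    inner ℂ (H d') (R (H d - z • Y d)) - z * inner ℂ (Y d') (R (H d - z • Y d)) -
      inner ℂ (Y d') (H d - z • Y d) - inner ℂ (ζ d') (y d) := rfl

theorem inner_resolvent (hT : T.adjoint = T) {z : ℂ} {R R' : 𝓗 →L[ℂ] 𝓗}
    (hR : ∀ f, (R f, z • R f + f) ∈ T) (hR' : ∀ f, (R' f, star z • R' f + f) ∈ T) (f g : 𝓗) :
    inner ℂ (R' f) g = inner ℂ f (R g) := by
  have h := inner_symm_of_adjoint_eq hT (hR' f) (hR g)
  rw [inner_add_left, inner_add_right, inner_smul_left, inner_smul_right] at h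
  have e : (starRingEnd ℂ) (star z) = z := star_star z
  rw [e] at h
  exact (add_left_cancel h).symm

/-- The resolvent terms are exchanged by `R_z^* = R_{z̄}`, and what is left over is Green's identity
for the two boundary data. -/
theorem star_weylForm (hT : T.adjoint = T) {z : ℂ} {R R' : 𝓗 →L[ℂ] 𝓗}
    (hR : ∀ f, (R f, z • R f + f) ∈ T) (hR' : ∀ f, (R' f, star z • R' f + f) ∈ T)
    (hG : ∀ d d', inner ℂ (Y d) (H d') - inner ℂ (H d) (Y d') =
      inner ℂ (y d) (ζ d') - inner ℂ (ζ d) (y d')) (d' d : D) :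
    star (weylForm Y H ζ y R' (star z) d d') = weylForm Y H ζ y R z d' d := by
  simp only [weylForm_apply, star_sub, star_mul', star_star]
  have hs : ∀ a b : 𝓗, star (inner ℂ a b) = inner ℂ b a := fun a b => inner_conj_symm _ _
  have hs' : ∀ a b : E, star (inner ℂ a b) = inner ℂ b a := fun a b => inner_conj_symm _ _
  have hr := inner_resolvent hT hR hR'
  simp only [hs, hs', inner_sub_right, inner_smul_right, hr, map_sub, map_smul, star_sub,
    star_mul', star_star]
  linear_combination hG d' d

/-- Put `u = R (H d - z Y d)`. The difference of `(u, z u + H d - z Y d)` and `(Y d, H d)` is `(u -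
Y d, z (u - Y d))`, an eigenpair up to the source at the base point. The Green form of this pair
with itself produces `z - z̄` times the square of its norm, and symmetry of `T` together with
Green's identity for `d` removes the other terms. -/
theorem weylForm_sub_star (hT : T.adjoint = T) {z : ℂ} {R : 𝓗 →L[ℂ] 𝓗}
    (hR : ∀ f, (R f, z • R f + f) ∈ T)
    (hG : ∀ d d', inner ℂ (Y d) (H d') - inner ℂ (H d) (Y d') =
      inner ℂ (y d) (ζ d') - inner ℂ (ζ d) (y d')) (d : D) :
    weylForm Y H ζ y R z d d - star (weylForm Y H ζ y R z d d) =
      (z - star z) * ((‖R (H d - z • Y d) - Y d‖ ^ 2 : ℝ) : ℂ) := by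
  have hs : ∀ a b : 𝓗, star (inner ℂ a b) = inner ℂ b a := fun a b => inner_conj_symm _ _
  have hs' : ∀ a b : E, star (inner ℂ a b) = inner ℂ b a := fun a b => inner_conj_symm _ _
  have hn : ∀ a : 𝓗, ((‖a‖ ^ 2 : ℝ) : ℂ) = inner ℂ a a := by
    intro a
    rw [inner_self_eq_norm_sq_to_K]
    push_cast; rfl
  rw [hn, weylForm_apply]
  have h := inner_symm_of_adjoint_eq hT (hR (H d - z • Y d)) (hR (H d - z • Y d))
  set u := R (H d - z • Y d)
  have e : (starRingEnd ℂ) z = star z := rfl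
  simp only [star_sub, star_mul', hs, hs', inner_sub_left, inner_sub_right, inner_smul_left,
    inner_smul_right, inner_add_left, inner_add_right, e] at h ⊢
  linear_combination h - hG d d

/-- The Weyl map of a self-adjoint relation `T` with respect to boundary data: `D` parametrizes
triples `(Y, H, ζ)` for which Green's identity has `ζ` as its boundary term. -/
theorem exists_weylMap [CompleteSpace 𝓗] [FiniteDimensional ℂ E] (hT : T.adjoint = T)
    {N : Submodule ℂ E} {e : 𝓗 × 𝓗 → E} (he : ∀ p ∈ T, e p ∈ Nᗮ)
    (heG : ∀ p ∈ T, ∀ d, inner ℂ p.1 (H d) - inner ℂ p.2 (Y d) = inner ℂ (e p) (ζ d))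
    (hζ : LinearMap.range ζ = Nᗮ)
    (hG : ∀ d d', inner ℂ (Y d) (H d') - inner ℂ (H d) (Y d') =
      inner ℂ (y d) (ζ d') - inner ℂ (ζ d) (y d')) :
    ∃ M : ℂ → E →ₗ[ℂ] E,
      (∀ z ∈ relResSet T, ∀ d u, (u, z • u + (H d - z • Y d)) ∈ T →
        M z (ζ d) = e (u, z • u + (H d - z • Y d)) - Nᗮ.starProjection (y d)) ∧
      (∀ z ∈ relResSet T, ∀ v ∈ N, M z v = 0) ∧
      (∀ z ∈ relResSet T, ∀ v' v, inner ℂ (M (star z) v') v = inner ℂ v' (M z v)) ∧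
      (∀ z ∈ relResSet T, ∀ v, ∃ c : ℝ, 0 ≤ c ∧
        inner ℂ v (M z v) - inner ℂ (M z v) v = (z - star z) * (c : ℂ)) ∧
      ∀ v' v, AnalyticOnNhd ℂ (fun z => inner ℂ v' (M z v)) (relResSet T) := by
  classical
  have hex : ∀ z, ∃ R : 𝓗 →L[ℂ] 𝓗, z ∈ relResSet T → ∀ f, (R f, z • R f + f) ∈ T := by
    intro z
    by_cases hz : z ∈ relResSet T
    · obtain ⟨R, hR⟩ := exists_resolvent hT hz
      exact ⟨R, fun _ => hR⟩
    · exact ⟨0, fun h => absurd h hz⟩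
  choose R hR using hex
  have hζm : ∀ d, ζ d ∈ Nᗮ := fun d => hζ ▸ LinearMap.mem_range_self ζ d
  -- A linear section of `ζ`, extended to all of `E` by the projection. It does not depend on `z`,
  -- which preserves analyticity.
  obtain ⟨s, hs⟩ : ∃ s : E →ₗ[ℂ] D, ∀ v, ζ (s v) = Nᗮ.starProjection v := by
    obtain ⟨g, hg⟩ := (ζ.rangeRestrict).exists_rightInverse_of_surjective
      (LinearMap.range_rangeRestrict ζ)
    have hp : ∀ v, Nᗮ.starProjection v ∈ LinearMap.range ζ := fun v => by
      rw [hζ]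
      exact Submodule.starProjection_apply_mem _ v
    refine ⟨g ∘ₗ LinearMap.codRestrict (LinearMap.range ζ)
      (Nᗮ.starProjection : E →ₗ[ℂ] E) hp, fun v => ?_⟩
    have h := LinearMap.congr_fun hg ⟨Nᗮ.starProjection v, hp v⟩
    exact congrArg Subtype.val h
  have hP : ∀ v : E, ∀ x ∈ Nᗮ, inner ℂ (Nᗮ.starProjection v) x = inner ℂ v x := by
    intro v x hx
    rw [Submodule.inner_starProjection_left_eq_right, Submodule.starProjection_eq_self_iff.2 hx]
  let X : ℂ → D → E := fun z d => e (R z (H d - z • Y d), z • R z (H d - z • Y d) +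
    (H d - z • Y d)) - Nᗮ.starProjection (y d)
  have hX : ∀ z ∈ relResSet T, ∀ d, X z d ∈ Nᗮ := fun z hz d =>
    Submodule.sub_mem _ (he _ (hR z hz _)) (Submodule.starProjection_apply_mem _ _)
  have hform : ∀ z ∈ relResSet T, ∀ d' d, weylForm Y H ζ y (R z) z d' d = inner ℂ (ζ d') (X z d) := by
    intro z hz d' d
    have h1 := heG _ (hR z hz (H d - z • Y d)) d'
    have h2 := congrArg (starRingEnd ℂ) h1
    rw [map_sub, inner_conj_symm, inner_conj_symm, inner_conj_symm] at h2
    have h3 : inner ℂ (ζ d') (Nᗮ.starProjection (y d)) = inner ℂ (ζ d') (y d) := by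
      rw [← Submodule.inner_starProjection_left_eq_right,
        Submodule.starProjection_eq_self_iff.2 (hζm d')]
    rw [inner_sub_right, h3, ← h2, weylForm_apply, inner_add_right, inner_smul_right]
    ring
  let b := stdOrthonormalBasis ℂ E
  -- Defining `M` by its coefficients in an orthonormal basis keeps it linear and analytic by
  -- construction; that it equals `X z ∘ s` is shown next.
  let M : ℂ → E →ₗ[ℂ] E := fun z =>
    ∑ i, (weylForm Y H ζ y (R z) z (s (b i)) ∘ₗ s).smulRight (b i)
  have hMb : ∀ z v i, inner ℂ (b i) (M z v) = weylForm Y H ζ y (R z) z (s (b i)) (s v) := by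
    intro z v i
    simp only [M, LinearMap.sum_apply, LinearMap.smulRight_apply, LinearMap.comp_apply]
    rw [b.orthonormal.inner_right_fintype]
  have hMX : ∀ z ∈ relResSet T, ∀ v, M z v = X z (s v) := by
    intro z hz v
    refine InnerProductSpace.ext_inner_left_basis b.toBasis fun i => ?_
    rw [OrthonormalBasis.coe_toBasis, hMb, hform z hz, hs, hP _ _ (hX z hz _)]
  have hsymm : ∀ z ∈ relResSet T, ∀ d' d, star (weylForm Y H ζ y (R (star z)) (star z) d d') =
      weylForm Y H ζ y (R z) z d' d := fun z hz =>
    star_weylForm Y H ζ y hT (hR z hz) (hR (star z) (star_mem_relResSet hT hz)) hG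
  -- The form depends on its first argument only through `ζ`. Conjugate symmetry, with `z̄` in place
  -- of `z`, transfers this to the second argument, so `X z d` depends on `d` only through `ζ d`.
  have hXeq : ∀ z ∈ relResSet T, ∀ x ∈ Nᗮ, ∀ d d', ζ d = ζ d' → inner ℂ x (X z d) =
      inner ℂ x (X z d') := by
    intro z hz x hx d d' hd
    rw [← hζ] at hx
    obtain ⟨d'', rfl⟩ := hx
    have hz' := star_mem_relResSet hT hz
    rw [← hform z hz, ← hform z hz, ← hsymm z hz, ← hsymm z hz, hform _ hz', hform _ hz', hd]
  have hXeq' : ∀ z ∈ relResSet T, ∀ d d', ζ d = ζ d' → X z d = X z d' := by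
    intro z hz d d' hd
    have h1 := hXeq z hz _ (Submodule.sub_mem _ (hX z hz d) (hX z hz d')) d d' hd
    rw [← sub_eq_zero, ← inner_sub_right] at h1
    exact sub_eq_zero.1 (inner_self_eq_zero.1 h1)
  refine ⟨M, fun z hz d u hu => ?_, fun z hz v hv => ?_, fun z hz v' v => ?_, fun z hz v => ?_,
    fun v' v z hz => ?_⟩
  · rw [hMX z hz, hXeq' z hz (s (ζ d)) d (by
      rw [hs, Submodule.starProjection_eq_self_iff.2 (hζm d)])]
    have : u = R z (H d - z • Y d) := relResSet_unique hz hu (hR z hz _)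
    rw [this]
  · have h0 : ζ (s v) = ζ 0 := by
      rw [hs, map_zero, Submodule.starProjection_apply_eq_zero_iff,
        Submodule.orthogonal_orthogonal]
      exact hv
    rw [hMX z hz, hXeq' z hz _ _ h0]
    refine inner_self_eq_zero (𝕜 := ℂ).1 ?_
    have hx := hX z hz 0
    rw [← hζ] at hx
    obtain ⟨d'', hd''⟩ := hx
    nth_rw 1 [← hd'']
    rw [← hform z hz, map_zero]
  · have hz' := star_mem_relResSet hT hz
    rw [hMX z hz, hMX _ hz']
    have h1 : inner ℂ (X (star z) (s v')) v = inner ℂ (X (star z) (s v')) (ζ (s v)) := by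
      rw [hs, ← Submodule.inner_starProjection_left_eq_right,
        Submodule.starProjection_eq_self_iff.2 (hX _ hz' _)]
    rw [h1, ← hP v' _ (hX z hz _), ← hs v', ← hform z hz, ← hsymm z hz, hform _ hz']
    exact (inner_conj_symm _ _).symm
  · refine ⟨‖R z (H (s v) - z • Y (s v)) - Y (s v)‖ ^ 2, sq_nonneg _, ?_⟩
    rw [← weylForm_sub_star Y H ζ y hT (hR z hz) hG (s v), hMX z hz, hform z hz, hs,
      hP _ _ (hX z hz _)]
    congr 1
    exact (inner_conj_symm _ _).symm
  · have hRa : AnalyticAt ℂ R z := analyticOnNhd_resolvent (fun z hz => hR z hz) z hz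
    have hf : ∀ a c : 𝓗, AnalyticAt ℂ (fun z => inner ℂ a (R z c)) z := fun a c =>
      ((innerSL ℂ a).comp (ContinuousLinearMap.apply ℂ 𝓗 c)).analyticAt _ |>.comp hRa
    have hw : ∀ d' d, AnalyticAt ℂ (fun z => weylForm Y H ζ y (R z) z d' d) z := by
      intro d' d
      simp only [weylForm_apply, map_sub, map_smul, inner_sub_right, inner_smul_right]
      fun_prop (disch := assumption)
    have hsum : ∀ z, inner ℂ v' (M z v) =
        ∑ i, inner ℂ v' (b i) * weylForm Y H ζ y (R z) z (s (b i)) (s v) := by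
      intro z
      rw [← b.sum_inner_mul_inner]
      simp only [hMb]
    simp only [hsum]
    exact Finset.analyticAt_fun_sum _ fun i _ => analyticAt_const.mul (hw _ _)

end WeylMap

end OrderZero

namespace OrderZero

/-! ### Vector-valued primitives -/

section Vector

variable {Ω : Opens ℝ} {μ : Measure ℝ} {n : ℕ}

theorem LocIntegrable.clm {E E' : Type*} [NormedAddCommGroup E] [NormedSpace ℝ E]
    [NormedAddCommGroup E'] [NormedSpace ℝ E'] {F : ℝ → E} (hF : LocIntegrable Ω μ F)
    (L : E →L[ℝ] E') : LocIntegrable Ω μ fun x => L (F x) :=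
  fun c hc d hd => L.integrable_comp (hF c hc d hd)

theorem IsPrimitive.clm {E E' : Type*} [NormedAddCommGroup E] [NormedSpace ℝ E] [CompleteSpace E]
    [NormedAddCommGroup E'] [NormedSpace ℝ E'] [CompleteSpace E'] {u F : ℝ → E}
    (h : IsPrimitive Ω μ u F) (hF : LocIntegrable Ω μ F) (L : E →L[ℝ] E') :
    IsPrimitive Ω μ (fun x => L (u x)) fun x => L (F x) := by
  intro c hc d hd hcd
  rw [L.integral_comp_comm (hF.sub_set hc hd Ioc_subset_Icc_self),
    L.integral_comp_comm (hF.sub_set hc hd Ico_subset_Icc_self), ← map_sub, h c hc d hd hcd,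
    map_smul, map_add]

theorem leftVal_clm {E E' : Type*} [NormedAddCommGroup E] [NormedSpace ℝ E]
    [NormedAddCommGroup E'] [NormedSpace ℝ E'] (u F : ℝ → E) (L : E →L[ℝ] E') (x : ℝ) :
    leftVal μ (fun x => L (u x)) (fun x => L (F x)) x = L (leftVal μ u F x) := by
  simp [leftVal, map_sub]

/-- Evaluation of a component, and its conjugate, as real-linear maps. -/
noncomputable def evalCLM (i : Fin n) : (Fin n → ℂ) →L[ℝ] ℂ := ContinuousLinearMap.proj i

noncomputable def starEvalCLM (i : Fin n) : (Fin n → ℂ) →L[ℝ] ℂ :=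
  (Complex.conjCLE : ℂ →L[ℝ] ℂ).comp (evalCLM i)

theorem evalCLM_apply (i : Fin n) (v : Fin n → ℂ) : evalCLM i v = v i := rfl
theorem starEvalCLM_apply (i : Fin n) (v : Fin n → ℂ) : starEvalCLM i v = star (v i) := rfl

theorem locIntegrable_pi_iff {F : ℝ → Fin n → ℂ} :
    LocIntegrable Ω μ F ↔ ∀ i, LocIntegrable Ω μ fun x => F x i := by
  refine ⟨fun h i => h.clm (evalCLM i), fun h c hc d hd => ?_⟩
  exact Integrable.of_eval fun i => h i c hc d hd

theorem isPrimitive_pi_iff {u F : ℝ → Fin n → ℂ} (hF : LocIntegrable Ω μ F) :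
    IsPrimitive Ω μ u F ↔ ∀ i, IsPrimitive Ω μ (fun x => u x i) fun x => F x i := by
  refine ⟨fun h i => h.clm hF (evalCLM i), fun h c hc d hd hcd => ?_⟩
  ext i
  have e : ∀ s, IntegrableOn F s μ → (∫ x in s, F x ∂μ) i = ∫ x in s, F x i ∂μ := fun s hs =>
    ((evalCLM i).integral_comp_comm hs).symm
  rw [Pi.sub_apply, Pi.smul_apply, Pi.add_apply, e _ (hF.sub_set hc hd Ioc_subset_Icc_self),
    e _ (hF.sub_set hc hd Ico_subset_Icc_self), h i c hc d hd hcd]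

theorem IsPrimitive.const_smul {u F : ℝ → Fin n → ℂ} (h : IsPrimitive Ω μ u F) (a : ℂ) :
    IsPrimitive Ω μ (a • u) (a • F) := by
  intro c hc d hd hcd
  simp only [Pi.smul_apply]
  rw [integral_smul, integral_smul, ← smul_add, ← smul_sub, h c hc d hd hcd, smul_comm]

theorem locallyBoundedVariationOn_apply {u : ℝ → Fin n → ℂ}
    (hu : LocallyBoundedVariationOn u (Ω : Set ℝ)) (i : Fin n) :
    LocallyBoundedVariationOn (fun x => u x i) (Ω : Set ℝ) :=
  (LipschitzWith.eval i : LipschitzWith 1 fun v : Fin n → ℂ => v i).comp_locallyBoundedVariationOn hu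

theorem bounded_aestronglyMeasurable {u : ℝ → Fin n → ℂ}
    (hu : LocallyBoundedVariationOn u (Ω : Set ℝ)) (hΩ : (Ω : Set ℝ).OrdConnected) {c d : ℝ}
    (hc : c ∈ Ω) (hd : d ∈ Ω) :
    (∃ B, ∀ x ∈ Icc c d, ‖u x‖ ≤ B) ∧ AEStronglyMeasurable u (μ.restrict (Icc c d)) := by
  have h := fun i => (locallyBoundedVariationOn_apply hu i).bounded_aestronglyMeasurable
    (μ := μ) hΩ hc hd
  choose B hB using fun i => (h i).1
  refine ⟨⟨∑ i, |B i|, fun x hx => ?_⟩, (aemeasurable_pi_lambda _ fun i =>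
    (h i).2.aemeasurable).aestronglyMeasurable⟩
  rw [pi_norm_le_iff_of_nonneg (Finset.sum_nonneg fun i _ => abs_nonneg _)]
  exact fun i => ((hB i x hx).trans (le_abs_self _)).trans
    (Finset.single_le_sum (f := fun i => |B i|) (fun i _ => abs_nonneg _) (Finset.mem_univ i))

theorem LocIntegrable.mulVec {A : ℝ → Matrix (Fin n) (Fin n) ℂ}
    (hA : ∀ i j, LocIntegrable Ω μ fun x => A x i j) {u : ℝ → Fin n → ℂ}
    (hu : LocallyBoundedVariationOn u (Ω : Set ℝ)) (hΩ : (Ω : Set ℝ).OrdConnected) :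
    LocIntegrable Ω μ fun x => A x *ᵥ u x := by
  refine locIntegrable_pi_iff.2 fun i c hc d hd => ?_
  refine integrable_finsetSum (f := fun j x => A x i j * u x j) Finset.univ fun j _ => ?_
  obtain ⟨⟨B, hB⟩, hm⟩ := (locallyBoundedVariationOn_apply hu j).bounded_aestronglyMeasurable
    (μ := μ) hΩ hc hd
  exact (hA i j c hc d hd).mul_bdd (c := B) hm ((ae_restrict_mem measurableSet_Icc).mono hB)

theorem LocIntegrable.const_mulVec {F : ℝ → Fin n → ℂ} (hF : LocIntegrable Ω μ F)
    (A : Matrix (Fin n) (Fin n) ℂ) : LocIntegrable Ω μ fun x => A *ᵥ F x :=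
  hF.clm (A.mulVecLin.toContinuousLinearMap.restrictScalars ℝ)

theorem LocIntegrable.add {E : Type*} [NormedAddCommGroup E] {F G : ℝ → E}
    (hF : LocIntegrable Ω μ F) (hG : LocIntegrable Ω μ G) : LocIntegrable Ω μ fun x => F x + G x :=
  fun c hc d hd => (hF c hc d hd).add (hG c hc d hd)

theorem LocIntegrable.sub {E : Type*} [NormedAddCommGroup E] {F G : ℝ → E}
    (hF : LocIntegrable Ω μ F) (hG : LocIntegrable Ω μ G) : LocIntegrable Ω μ fun x => F x - G x :=
  fun c hc d hd => (hF c hc d hd).sub (hG c hc d hd)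

/-- Integration by parts for the sesquilinear form of a matrix. -/
theorem IsPrimitive.sesquilinear [SFinite μ] {u F v G : ℝ → Fin n → ℂ} (hu : IsPrimitive Ω μ u F)
    (hF : LocIntegrable Ω μ F) (hv : IsPrimitive Ω μ v G) (hG : LocIntegrable Ω μ G)
    (hΩ : (Ω : Set ℝ).OrdConnected) {c d : ℝ} (hc : c ∈ Ω) (hd : d ∈ Ω) (hcd : c ≤ d)
    (J : Matrix (Fin n) (Fin n) ℂ) :
    IntegrableOn (fun x => star (u x) ⬝ᵥ J *ᵥ G x + star (F x) ⬝ᵥ J *ᵥ v x) (Ico c d) μ ∧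
    ∫ x in Ico c d, (star (u x) ⬝ᵥ J *ᵥ G x + star (F x) ⬝ᵥ J *ᵥ v x) ∂μ =
      star (leftVal μ u F d) ⬝ᵥ J *ᵥ leftVal μ v G d -
        star (leftVal μ u F c) ⬝ᵥ J *ᵥ leftVal μ v G c := by
  have key := fun i j => (hu.clm hF (starEvalCLM i)).mul (hF.clm (starEvalCLM i))
    (hv.clm hG (evalCLM j)) (hG.clm (evalCLM j)) hΩ hc hd hcd
  simp only [starEvalCLM_apply, evalCLM_apply] at key
  have l1 : ∀ i x, leftVal μ (fun x => star (u x i)) (fun x => star (F x i)) x =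
      star (leftVal μ u F x i) := fun i x => leftVal_clm u F (starEvalCLM i) x
  have l2 : ∀ i x, leftVal μ (fun x => v x i) (fun x => G x i) x = leftVal μ v G x i :=
    fun i x => leftVal_clm v G (evalCLM i) x
  simp only [l1, l2] at key
  have e : ∀ a b : Fin n → ℂ, star a ⬝ᵥ J *ᵥ b = ∑ i, ∑ j, J i j * (star (a i) * b j) := by
    intro a b
    simp only [dotProduct, Matrix.mulVec, Finset.mul_sum, Pi.star_apply]
    exact Finset.sum_congr rfl fun i _ => Finset.sum_congr rfl fun j _ => by ring
  have e' : ∀ x, star (u x) ⬝ᵥ J *ᵥ G x + star (F x) ⬝ᵥ J *ᵥ v x =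
      ∑ i, ∑ j, J i j * (star (u x i) * G x j + star (F x i) * v x j) := by
    intro x
    rw [e, e, ← Finset.sum_add_distrib]
    refine Finset.sum_congr rfl fun i _ => ?_
    rw [← Finset.sum_add_distrib]
    exact Finset.sum_congr rfl fun j _ => by ring
  have hi := fun i j => ((key i j).1.add (key i j).2.1).const_mul (J i j)
  have hi' : ∀ i j, Integrable (fun x => J i j * (star (u x i) * G x j + star (F x i) * v x j))
    (μ.restrict (Ico c d)) := hi
  simp only [e']
  refine ⟨integrable_finsetSum _ fun i _ => integrable_finsetSum _ fun j _ => hi' i j, ?_⟩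
  rw [integral_finsetSum _ fun i _ => integrable_finsetSum _ fun j _ => hi' i j, e, e,
    ← Finset.sum_sub_distrib]
  refine Finset.sum_congr rfl fun i _ => ?_
  rw [integral_finsetSum _ fun j _ => hi' i j, ← Finset.sum_sub_distrib]
  refine Finset.sum_congr rfl fun j _ => ?_
  rw [integral_const_mul, integral_add (key i j).1 (key i j).2.1, (key i j).2.2]
  ring

end Vector

/-! ### The measure with a unit mass at a point -/

section PointMeasure

/-- The measure `μ` with its mass at `x₀` replaced by a unit mass. -/
noncomputable def pointMeasure (μ : Measure ℝ) (x₀ : ℝ) : Measure ℝ :=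
  μ.restrict {x₀}ᶜ + Measure.dirac x₀

variable {μ : Measure ℝ} {x₀ : ℝ} {E : Type*} [NormedAddCommGroup E]

instance [SFinite μ] : SFinite (pointMeasure μ x₀) := by
  unfold pointMeasure
  infer_instance

theorem pointMeasure_singleton (x : ℝ) :
    pointMeasure μ x₀ {x} = if x = x₀ then 1 else μ {x} := by
  rw [pointMeasure, Measure.add_apply, Measure.restrict_apply (measurableSet_singleton _)]
  by_cases h : x = x₀
  · subst h
    simp
  · have : ({x} : Set ℝ) ∩ {x₀}ᶜ = {x} := by
      rw [inter_eq_left, singleton_subset_iff]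
      simpa using h
    rw [this]
    simp [h, Ne.symm h]

theorem integrableOn_pointMeasure {F : ℝ → E} {s : Set ℝ} (hs : MeasurableSet s) :
    IntegrableOn F s (pointMeasure μ x₀) ↔ IntegrableOn F (s \ {x₀}) μ := by
  rw [IntegrableOn, pointMeasure, Measure.restrict_add, integrable_add_measure,
    Measure.restrict_restrict hs]
  refine ⟨fun h => h.1, fun h => ⟨h, ?_⟩⟩
  exact (integrable_dirac (by simp)).restrict

theorem setIntegral_pointMeasure [NormedSpace ℝ E] [CompleteSpace E] {F : ℝ → E} {s : Set ℝ}
    (hs : MeasurableSet s)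
    (h : IntegrableOn F (s \ {x₀}) μ) :
    ∫ x in s, F x ∂(pointMeasure μ x₀) =
      (∫ x in s \ {x₀}, F x ∂μ) + s.indicator F x₀ := by
  classical
  rw [pointMeasure, Measure.restrict_add, Measure.restrict_restrict hs]
  change ∫ x, F x ∂(μ.restrict (s \ {x₀}) + _) = _
  rw [integral_add_measure h
    (integrable_dirac (by simp)).restrict, setIntegral_dirac]
  rfl

/-- If `G` has no mass at `x₀` then a function that agrees with `G` off `x₀` has the same integrals,
up to its value at `x₀`. -/
theorem integrableOn_pointMeasure_iff {F G : ℝ → E} (hFG : ∀ x ≠ x₀, F x = G x)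
    (hG : IntegrableOn G {x₀} μ) {s : Set ℝ} (hs : MeasurableSet s) :
    IntegrableOn F s (pointMeasure μ x₀) ↔ IntegrableOn G s μ := by
  rw [integrableOn_pointMeasure hs, integrableOn_congr_fun (g := G) (fun x hx => hFG x hx.2)
    (hs.diff (measurableSet_singleton _))]
  refine ⟨fun h => (h.union hG).mono_set (by rw [sdiff_union_self]; exact subset_union_left),
    fun h => h.mono_set sdiff_subset⟩

theorem setIntegral_pointMeasure_eq [NormedSpace ℝ E] [CompleteSpace E] {F G : ℝ → E}
    (hFG : ∀ x ≠ x₀, F x = G x) (hG : IntegrableOn G {x₀} μ) (hG0 : μ.real {x₀} • G x₀ = 0)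
    {s : Set ℝ} (hs : MeasurableSet s) (hGs : IntegrableOn G s μ) :
    ∫ x in s, F x ∂(pointMeasure μ x₀) = (∫ x in s, G x ∂μ) + s.indicator F x₀ := by
  have hm := hs.diff (measurableSet_singleton x₀)
  have h1 : EqOn F G (s \ {x₀}) := fun x hx => hFG x hx.2
  rw [setIntegral_pointMeasure hs ((hGs.mono_set sdiff_subset).congr_fun h1.symm hm),
    setIntegral_congr_fun hm h1]
  congr 1
  by_cases hx : x₀ ∈ s
  · have := setIntegral_union (disjoint_sdiff_left : Disjoint (s \ {x₀}) {x₀})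
      (measurableSet_singleton x₀) (hGs.mono_set sdiff_subset) hG
    rw [sdiff_union_of_subset (singleton_subset_iff.2 hx), integral_singleton, hG0, add_zero] at this
    exact this.symm
  · rw [sdiff_singleton_eq_self hx]

end PointMeasure

end OrderZero

namespace OrderZero

/-! ### The equation with a point source -/

section Equation

variable {Ω : Opens ℝ} {n : ℕ}

theorem LocIntegrable.integrable_mul {μ : Measure ℝ} {G : ℝ → ℂ} (hG : LocIntegrable Ω μ G)
    {x₀ : ℝ} (hx₀ : x₀ ∈ Ω) {f : ℝ → ℝ} (hf : Continuous f) (hc : HasCompactSupport f)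
    (hsub : tsupport f ⊆ (Ω : Set ℝ)) : Integrable (fun x => (f x : ℂ) * G x) μ := by
  obtain ⟨c, hcΩ, d, hdΩ, -, -, hcd⟩ := exists_Ioo_of_isCompact hc hsub hx₀
  obtain ⟨B, hB⟩ := hf.bounded_above_of_compact_support hc
  have h1 : IntegrableOn (fun x => (f x : ℂ) * G x) (Icc c d) μ :=
    (hG c hcΩ d hdΩ).bdd_mul (c := B)
      (Complex.continuous_ofReal.comp hf).aestronglyMeasurable
      (ae_of_all _ fun x => by simpa using hB x)
  refine (integrableOn_iff_integrable_of_support_subset fun x hx => ?_).1 h1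
  refine Ioo_subset_Icc_self (hcd (subset_tsupport _ ?_))
  rw [Function.mem_support] at hx ⊢
  exact fun h0 => hx (by simp [h0])

variable {q w : DistMatrix Ω n} {J : Matrix (Fin n) (Fin n) ℂ} {r : MeasureRep q w}

instance (r : MeasureRep q w) : SigmaFinite r.μ := r.radon.sigmaFinite

namespace MeasureRep

theorem measure_singleton_ne_top (r : MeasureRep q w) {x : ℝ} (hx : x ∈ Ω) : r.μ {x} ≠ ∞ :=
  (r.radon.lt_top _ (singleton_subset_iff.2 hx) isCompact_singleton).ne

theorem locIntegrable_wd (r : MeasureRep q w) (hΩ : (Ω : Set ℝ).OrdConnected) (i j : Fin n) :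
    LocIntegrable Ω r.μ fun x => r.wd x i j :=
  fun _ hc _ hd => r.wd_integrable i j _ (hΩ.out hc hd) isCompact_Icc

theorem locIntegrable_qd (r : MeasureRep q w) (hΩ : (Ω : Set ℝ).OrdConnected) (i j : Fin n) :
    LocIntegrable Ω r.μ fun x => r.qd x i j :=
  fun _ hc _ hd => r.qd_integrable i j _ (hΩ.out hc hd) isCompact_Icc

theorem wd_conjTranspose (r : MeasureRep q w) (x : ℝ) : (r.wd x)ᴴ = r.wd x := (r.wd_posSemidef x).1

end MeasureRep

/-- The criterion for non-negativity is applied to plus and minus the real and imaginary parts. -/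
theorem ae_eq_zero_of_test {μ : Measure ℝ} (hμ : RadonOn Ω μ) {g : ℝ → ℂ} (hgm : Measurable g)
    (hg : ∀ K ⊆ (Ω : Set ℝ), IsCompact K → IntegrableOn g K μ)
    (hφ : ∀ φ : 𝓓^{0}(Ω, ℝ), Integrable (fun x => (φ x : ℂ) * g x) μ)
    (h : ∀ φ : 𝓓^{0}(Ω, ℝ), ∫ x, (φ x : ℂ) * g x ∂μ = 0) : ∀ᵐ x ∂μ, g x = 0 := by
  have hre : ∀ φ : 𝓓^{0}(Ω, ℝ), ∫ x, φ x * (g x).re ∂μ = 0 := by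
    intro φ
    have h1 := integral_re (hφ φ)
    rw [show (∫ x, (φ x : ℂ) * g x ∂μ) = 0 from h φ] at h1
    simpa using h1
  have him : ∀ φ : 𝓓^{0}(Ω, ℝ), ∫ x, φ x * (g x).im ∂μ = 0 := by
    intro φ
    have h1 := integral_im (hφ φ)
    rw [show (∫ x, (φ x : ℂ) * g x ∂μ) = 0 from h φ] at h1
    simpa using h1
  have a1 := ae_nonneg_of_test hμ (g := fun x => (g x).re) (Complex.measurable_re.comp hgm)
    (fun K hK hc => (hg K hK hc).re) fun φ _ => (hre φ).ge
  have a2 := ae_nonneg_of_test hμ (g := fun x => -(g x).re) (Complex.measurable_re.comp hgm).neg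
    (fun K hK hc => (hg K hK hc).re.neg) fun φ _ => by
      simp only [mul_neg]
      rw [integral_neg, hre, neg_zero]
  have a3 := ae_nonneg_of_test hμ (g := fun x => (g x).im) (Complex.measurable_im.comp hgm)
    (fun K hK hc => (hg K hK hc).im) fun φ _ => (him φ).ge
  have a4 := ae_nonneg_of_test hμ (g := fun x => -(g x).im) (Complex.measurable_im.comp hgm).neg
    (fun K hK hc => (hg K hK hc).im.neg) fun φ _ => by
      simp only [mul_neg]
      rw [integral_neg, him, neg_zero]
  filter_upwards [a1, a2, a3, a4] with x h1 h2 h3 h4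
  exact Complex.ext (le_antisymm (by simpa using h2) h1) (le_antisymm (by simpa using h4) h3)

/-- A Hermitian matrix of distributions has a Hermitian density. -/
theorem MeasureRep.qd_conjTranspose (r : MeasureRep q w) (hq : IsHermitianDist q)
    (hΩ : (Ω : Set ℝ).OrdConnected) {x₀ : ℝ} (hx₀ : x₀ ∈ Ω) :
    ∀ᵐ x ∂r.μ, (r.qd x)ᴴ = r.qd x := by
  have hi : ∀ i j, ∀ φ : 𝓓^{0}(Ω, ℝ), Integrable (fun x => (φ x : ℂ) * r.qd x i j) r.μ :=
    fun i j φ => (r.locIntegrable_qd hΩ i j).integrable_mul hx₀ φ.continuous φ.hasCompactSupport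
      φ.tsupport_subset
  have hstar : ∀ i j, ∀ φ : 𝓓^{0}(Ω, ℝ), (fun x => (φ x : ℂ) * star (r.qd x i j)) =
      fun x => star ((φ x : ℂ) * r.qd x i j) := by
    intro i j φ
    funext x
    rw [star_mul', show star (φ x : ℂ) = φ x from Complex.conj_ofReal _]
  have hi' : ∀ i j, ∀ φ : 𝓓^{0}(Ω, ℝ), Integrable (fun x => (φ x : ℂ) * star (r.qd x i j)) r.μ := by
    intro i j φ
    rw [hstar]
    exact (Complex.conjCLE : ℂ →L[ℝ] ℂ).integrable_comp (hi i j φ)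
  have key : ∀ i j, ∀ᵐ x ∂r.μ, star (r.qd x j i) - r.qd x i j = 0 := by
    intro i j
    refine ae_eq_zero_of_test r.radon
      ((continuous_star.measurable.comp (r.qd_measurable j i)).sub (r.qd_measurable i j))
      (fun K hK hc => ?_) (fun φ => ?_) fun φ => ?_
    · exact ((Complex.conjCLE : ℂ →L[ℝ] ℂ).integrable_comp (r.qd_integrable j i K hK hc)).sub
        (r.qd_integrable i j K hK hc)
    · simp only [mul_sub]
      exact (hi' j i φ).sub (hi i j φ)
    · simp only [mul_sub]
      rw [integral_sub (hi' j i φ) (hi i j φ), hstar, ← r.q_eq, hq i j, r.q_eq]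
      rw [sub_eq_zero]
      exact integral_conj
  have h := ae_all_iff.2 fun i => ae_all_iff.2 (key i)
  filter_upwards [h] with x hx
  ext i j
  exact sub_eq_zero.1 (hx i j)

variable (J r) in
/-- The density of `u'` for a solution of `J u' + q u = w g + κ δ`, where `δ` is the unit mass at
`x₀`. -/
noncomputable def forcing (x₀ : ℝ) (u g : ℝ → Fin n → ℂ) (κ : Fin n → ℂ) (x : ℝ) : Fin n → ℂ :=
  if x = x₀ then J⁻¹ *ᵥ κ else J⁻¹ *ᵥ (r.wd x *ᵥ g x - r.qd x *ᵥ u x)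

variable (J r) in
/-- `u` is a balanced solution of `J u' + q u = w g + κ δ`, where `δ` is the unit mass at `x₀`. -/
structure PointSolves (x₀ : ℝ) (u g : ℝ → Fin n → ℂ) (κ : Fin n → ℂ) : Prop where
  loc : LocIntegrable Ω (pointMeasure r.μ x₀) (forcing J r x₀ u g κ)
  prim : IsPrimitive Ω (pointMeasure r.μ x₀) u (forcing J r x₀ u g κ)

variable {x₀ : ℝ} {u g : ℝ → Fin n → ℂ}

theorem PointSolves.locallyBoundedVariationOn {κ : Fin n → ℂ} (h : PointSolves J r x₀ u g κ) :
    LocallyBoundedVariationOn u (Ω : Set ℝ) := h.prim.locallyBoundedVariationOn h.loc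

theorem PointSolves.add {u' g' : ℝ → Fin n → ℂ} {κ κ' : Fin n → ℂ}
    (h : PointSolves J r x₀ u g κ) (h' : PointSolves J r x₀ u' g' κ') :
    PointSolves J r x₀ (u + u') (g + g') (κ + κ') := by
  have e : forcing J r x₀ (u + u') (g + g') (κ + κ') =
      fun x => forcing J r x₀ u g κ x + forcing J r x₀ u' g' κ' x := by
    funext x
    by_cases hx : x = x₀
    · simp [forcing, hx, Matrix.mulVec_add]
    · simp only [forcing, hx, if_false, Pi.add_apply, Matrix.mulVec_add, Matrix.mulVec_sub]
      abel
  exact ⟨e ▸ h.loc.add h'.loc, e ▸ h.prim.add h.loc h'.prim h'.loc⟩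

theorem PointSolves.smul {κ : Fin n → ℂ} (h : PointSolves J r x₀ u g κ) (a : ℂ) :
    PointSolves J r x₀ (a • u) (a • g) (a • κ) := by
  have e : forcing J r x₀ (a • u) (a • g) (a • κ) = a • forcing J r x₀ u g κ := by
    funext x
    by_cases hx : x = x₀
    · simp [forcing, hx, Matrix.mulVec_smul]
    · simp only [forcing, hx, if_false, Pi.smul_apply, Matrix.mulVec_smul, Matrix.mulVec_sub,
        smul_sub]
  rw [← and_self_iff (a := PointSolves J r x₀ _ _ _)]
  have h' : PointSolves J r x₀ (a • u) (a • g) (a • κ) :=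
    ⟨e ▸ fun c hc d hd => (h.loc c hc d hd).smul a, e ▸ h.prim.const_smul a⟩
  exact ⟨h', h'⟩

/-- The right-hand side enters only through `w g` almost everywhere, so it may be replaced by
another representative of its class in `L²(w)`. -/
theorem PointSolves.congr {κ : Fin n → ℂ} {g' : ℝ → Fin n → ℂ} (h : PointSolves J r x₀ u g κ)
    (hg : ∀ᵐ x ∂r.μ, r.wd x *ᵥ g x = r.wd x *ᵥ g' x) : PointSolves J r x₀ u g' κ := by
  have e : forcing J r x₀ u g κ =ᵐ[pointMeasure r.μ x₀] forcing J r x₀ u g' κ := by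
    refine ae_add_measure_iff.2 ⟨?_, ?_⟩
    · filter_upwards [ae_restrict_of_ae hg] with x hx
      simp only [forcing, hx]
    · rw [ae_dirac_eq]
      simp [forcing]
  exact ⟨h.loc.congr_ae e, h.prim.congr_ae e⟩

theorem locIntegrable_forcing (hΩ : (Ω : Set ℝ).OrdConnected)
    (hu : LocallyBoundedVariationOn u (Ω : Set ℝ))
    (hg : LocIntegrable Ω r.μ fun x => r.wd x *ᵥ g x) :
    LocIntegrable Ω r.μ fun x => J⁻¹ *ᵥ (r.wd x *ᵥ g x - r.qd x *ᵥ u x) :=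
  (hg.sub (LocIntegrable.mulVec (r.locIntegrable_qd hΩ) hu hΩ)).const_mulVec _

/-- The auxiliary measure `μ` may charge `x₀`; only its product with the densities of `q` and `w` is
known to have no mass there. -/
theorem real_smul_forcing (hq : jumpQ r x₀ = 0) (hw : jumpW r x₀ = 0) (u g : ℝ → Fin n → ℂ) :
    r.μ.real {x₀} • (J⁻¹ *ᵥ (r.wd x₀ *ᵥ g x₀ - r.qd x₀ *ᵥ u x₀)) = 0 := by
  have h1 : (r.μ.real {x₀} : ℂ) • (r.wd x₀ *ᵥ g x₀) = 0 := by
    rw [← Matrix.smul_mulVec]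
    exact (congrArg (· *ᵥ g x₀) hw).trans (Matrix.zero_mulVec _)
  have h2 : (r.μ.real {x₀} : ℂ) • (r.qd x₀ *ᵥ u x₀) = 0 := by
    rw [← Matrix.smul_mulVec]
    exact (congrArg (· *ᵥ u x₀) hq).trans (Matrix.zero_mulVec _)
  rw [← Complex.coe_smul, ← Matrix.mulVec_smul, smul_sub, h1, h2, sub_self, Matrix.mulVec_zero]

/-- Without a source, primitives with respect to `μ` and with respect to `pointMeasure μ x₀` are the
same. -/
theorem pointSolves_zero_iff (hx₀ : x₀ ∈ Ω)
    (hq : jumpQ r x₀ = 0) (hw : jumpW r x₀ = 0)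
    (hL : LocIntegrable Ω r.μ fun x => J⁻¹ *ᵥ (r.wd x *ᵥ g x - r.qd x *ᵥ u x)) :
    PointSolves J r x₀ u g 0 ↔
      IsPrimitive Ω r.μ u fun x => J⁻¹ *ᵥ (r.wd x *ᵥ g x - r.qd x *ᵥ u x) := by
  set G : ℝ → Fin n → ℂ := fun x => J⁻¹ *ᵥ (r.wd x *ᵥ g x - r.qd x *ᵥ u x) with hGdef
  have hFG : ∀ x ≠ x₀, forcing J r x₀ u g 0 x = G x := fun x hx => by simp [forcing, hx, G]
  have hG : IntegrableOn G {x₀} r.μ := by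
    simp [(r.measure_singleton_ne_top hx₀).lt_top]
  have hG0 : r.μ.real {x₀} • G x₀ = 0 := real_smul_forcing hq hw u g
  have hF0 : forcing J r x₀ u g 0 x₀ = 0 := by simp [forcing]
  have hint : ∀ s : Set ℝ, MeasurableSet s → IntegrableOn G s r.μ →
      ∫ x in s, forcing J r x₀ u g 0 x ∂(pointMeasure r.μ x₀) = ∫ x in s, G x ∂r.μ := by
    intro s hs hGs
    rw [setIntegral_pointMeasure_eq hFG hG hG0 hs hGs]
    by_cases h : x₀ ∈ s <;> simp [h, hF0]
  have hloc : LocIntegrable Ω (pointMeasure r.μ x₀) (forcing J r x₀ u g 0) := fun c hc d hd =>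
    (integrableOn_pointMeasure_iff hFG hG measurableSet_Icc).2 (hL c hc d hd)
  constructor
  · intro h c hc d hd hcd
    rw [h.prim c hc d hd hcd, hint _ measurableSet_Ioc (hL.sub_set hc hd Ioc_subset_Icc_self),
      hint _ measurableSet_Ico (hL.sub_set hc hd Ico_subset_Icc_self)]
  · refine fun h => ⟨hloc, fun c hc d hd hcd => ?_⟩
    rw [h c hc d hd hcd, hint _ measurableSet_Ioc (hL.sub_set hc hd Ioc_subset_Icc_self),
      hint _ measurableSet_Ico (hL.sub_set hc hd Ico_subset_Icc_self)]

/-- The distributional equation, solved for `u'`. -/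
theorem solves_iff (hJ : IsUnit J) (hΩ : (Ω : Set ℝ).OrdConnected) (hx₀ : x₀ ∈ Ω)
    (hu : LocallyBoundedVariationOn u (Ω : Set ℝ))
    (hg : LocIntegrable Ω r.μ fun x => r.wd x *ᵥ g x) :
    Solves J r u g ↔ ∀ φ : 𝓓(Ω, ℝ), ∀ k, -(∫ x, ((deriv φ x : ℝ) : ℂ) * u x k) =
      ∫ x, (φ x : ℂ) * (J⁻¹ *ᵥ (r.wd x *ᵥ g x - r.qd x *ᵥ u x)) k ∂r.μ := by
  have hqu := LocIntegrable.mulVec (r.locIntegrable_qd hΩ) hu hΩ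
  refine forall_congr' fun φ => ?_
  have hdiff : ContDiff ℝ 1 φ := φ.contDiff.of_le (by exact_mod_cast le_top)
  have i1 : ∀ k, Integrable fun x => ((deriv φ x : ℝ) : ℂ) * u x k := by
    intro k
    have hl : LocIntegrable Ω volume fun x => u x k := fun c hc d hd => by
      obtain ⟨⟨B, hB⟩, hm⟩ := (locallyBoundedVariationOn_apply hu k).bounded_aestronglyMeasurable
        (μ := volume) hΩ hc hd
      exact Integrable.of_bound hm B ((ae_restrict_mem measurableSet_Icc).mono hB)
    exact hl.integrable_mul hx₀ (hdiff.continuous_deriv le_rfl) φ.hasCompactSupport.deriv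
      (tsupport_deriv_subset.trans φ.tsupport_subset)
  have i2 : ∀ G : ℝ → Fin n → ℂ, LocIntegrable Ω r.μ G → ∀ k,
      Integrable (fun x => (φ x : ℂ) * G x k) r.μ := fun G hG k =>
    (locIntegrable_pi_iff.1 hG k).integrable_mul hx₀ φ.continuous φ.hasCompactSupport
      φ.tsupport_subset
  have lin : ∀ {ν : Measure ℝ} (f : ℝ → ℂ) (G : ℝ → Fin n → ℂ) (A : Matrix (Fin n) (Fin n) ℂ),
      (∀ k, Integrable (fun x => f x * G x k) ν) → ∀ k,
      ∫ x, f x * (A *ᵥ G x) k ∂ν = (A *ᵥ fun k => ∫ x, f x * G x k ∂ν) k := by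
    intro ν f G A hi k
    have e : ∀ x, f x * (A *ᵥ G x) k = ∑ j, A k j * (f x * G x j) := fun x => by
      simp only [Matrix.mulVec, dotProduct, Finset.mul_sum]
      exact Finset.sum_congr rfl fun j _ => by ring
    simp only [e]
    rw [integral_finsetSum _ fun j _ => (hi j).const_mul _]
    simp only [integral_const_mul]
    rfl
  set a : Fin n → ℂ := fun k => ∫ x, ((deriv φ x : ℝ) : ℂ) * u x k with ha
  set b : Fin n → ℂ := fun k => ∫ x, (φ x : ℂ) * (r.qd x *ᵥ u x) k ∂r.μ with hb
  set c : Fin n → ℂ := fun k => ∫ x, (φ x : ℂ) * (r.wd x *ᵥ g x) k ∂r.μ with hc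
  have e1 : ∀ k, ∫ x, ((deriv φ x : ℝ) : ℂ) * (J *ᵥ u x) k = (J *ᵥ a) k :=
    lin (fun x => ((deriv φ x : ℝ) : ℂ)) u J i1
  have e2 : ∀ k, ∫ x, (φ x : ℂ) * (J⁻¹ *ᵥ (r.wd x *ᵥ g x - r.qd x *ᵥ u x)) k ∂r.μ =
      (J⁻¹ *ᵥ (c - b)) k := by
    intro k
    rw [lin (fun x => (φ x : ℂ)) (fun x => r.wd x *ᵥ g x - r.qd x *ᵥ u x) J⁻¹ (i2 _ (hg.sub hqu))]
    congr 2
    funext k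
    simp only [Pi.sub_apply, mul_sub]
    rw [integral_sub (i2 _ hg k) (i2 _ hqu k)]
  have hdet := (Matrix.isUnit_iff_isUnit_det _).1 hJ
  simp only [e1, e2]
  change (∀ i, -((J *ᵥ a) i) + b i = c i) ↔ ∀ k, -(a k) = (J⁻¹ *ᵥ (c - b)) k
  rw [show (∀ i, -((J *ᵥ a) i) + b i = c i) ↔ -(J *ᵥ a) = c - b from
    ⟨fun h => funext fun i => eq_sub_of_add_eq (h i), fun h i =>
      add_eq_of_eq_sub (congrFun h i)⟩,
    show (∀ k, -(a k) = (J⁻¹ *ᵥ (c - b)) k) ↔ -a = J⁻¹ *ᵥ (c - b) from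
      ⟨fun h => funext h, fun h => congrFun h⟩]
  constructor
  · intro h
    rw [← h, Matrix.mulVec_neg, Matrix.mulVec_mulVec, Matrix.nonsing_inv_mul _ hdet,
      Matrix.one_mulVec]
  · intro h
    rw [← Matrix.mulVec_neg, h, Matrix.mulVec_mulVec, Matrix.mul_nonsing_inv _ hdet,
      Matrix.one_mulVec]

/-- Balanced solutions are the solutions without a point source. -/
theorem isSolution_iff (hJ : IsUnit J) (hΩ : (Ω : Set ℝ).OrdConnected) (hx₀ : x₀ ∈ Ω)
    (hq : jumpQ r x₀ = 0) (hw : jumpW r x₀ = 0)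
    (hg : LocIntegrable Ω r.μ fun x => r.wd x *ᵥ g x) :
    IsSolution J r u g ↔ PointSolves J r x₀ u g 0 := by
  constructor
  · rintro ⟨⟨hbv, hbal⟩, hs⟩
    have hL := locIntegrable_forcing (J := J) hΩ hbv hg
    rw [pointSolves_zero_iff hx₀ hq hw hL, isPrimitive_pi_iff hL]
    rw [solves_iff hJ hΩ hx₀ hbv hg] at hs
    intro k
    refine isPrimitive_of_integral_deriv_mul (locallyBoundedVariationOn_apply hbv k)
      (fun x hx => ?_) (locIntegrable_pi_iff.1 hL k) hΩ hx₀ fun φ => hs φ k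
    -- One-sided limits of a vector function take a default value unless they exist. Existence in
    -- every component lets them be computed componentwise.
    have hlm := fun j => (locallyBoundedVariationOn_apply hbv j).exists_tendsto hx
    have h1 := congrFun (hbal x hx) k
    rw [leftLim_eq_of_tendsto (tendsto_pi_nhds.2 fun j => (hlm j).1),
      rightLim_eq_of_tendsto (tendsto_pi_nhds.2 fun j => (hlm j).2)] at h1
    exact h1
  · intro h
    have hbv := h.locallyBoundedVariationOn
    have hL := locIntegrable_forcing (J := J) hΩ hbv hg
    rw [pointSolves_zero_iff hx₀ hq hw hL] at h
    refine ⟨balanced_of_isPrimitive h hL, ?_⟩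
    rw [solves_iff hJ hΩ hx₀ hbv hg]
    exact fun φ k => ((isPrimitive_pi_iff hL).1 h k).integral_deriv_mul
      (locIntegrable_pi_iff.1 hL k) hΩ hx₀ φ

end Equation

end OrderZero

namespace OrderZero

variable {Ω : Opens ℝ} {n : ℕ} {q w : DistMatrix Ω n} {J : Matrix (Fin n) (Fin n) ℂ}
  {r : MeasureRep q w}

/-! ### Functions in `𝓛²(w)` -/

section SquareIntegrable

namespace MeasureRep

theorem memL2_of_bounded (hΩ : (Ω : Set ℝ).OrdConnected) {f : ℝ → Fin n → ℂ}
    (hf : AEStronglyMeasurable f r.μ) {B : ℝ} (hB : ∀ x, ‖f x‖ ≤ B) {c d : ℝ} (hc : c ∈ Ω)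
    (hd : d ∈ Ω) (h0 : ∀ x ∉ Icc c d, f x = 0) : r.MemL2 f := by
  have e : r.dens f f = fun x => ∑ i, ∑ j, (star (f x i) * f x j) * r.wd x i j := by
    funext x
    simp only [dens, dotProduct, Matrix.mulVec, Finset.mul_sum, Pi.star_apply]
    exact Finset.sum_congr rfl fun i _ => Finset.sum_congr rfl fun j _ => by ring
  have hf' : ∀ i, AEStronglyMeasurable (fun x => f x i) r.μ := fun i =>
    (continuous_apply i).comp_aestronglyMeasurable hf
  have h1 : IntegrableOn (r.dens f f) (Icc c d) r.μ := by
    rw [e]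
    refine integrable_finsetSum _ fun i _ => integrable_finsetSum _ fun j _ => ?_
    refine (r.locIntegrable_wd hΩ i j c hc d hd).bdd_mul (c := B * B)
      ((continuous_star.comp_aestronglyMeasurable (hf' i)).mul (hf' j)).restrict
      (ae_of_all _ fun x => ?_)
    have h2 : ∀ i, ‖f x i‖ ≤ B := fun i => (norm_le_pi_norm _ i).trans (hB x)
    rw [norm_mul, norm_star]
    exact mul_le_mul (h2 i) (h2 j) (norm_nonneg _) ((norm_nonneg _).trans (h2 i))
  refine ⟨hf, (integrableOn_iff_integrable_of_support_subset fun x hx => ?_).1 h1⟩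
  by_contra hx'
  exact hx (by simp [dens, h0 x hx'])

/-- Each component of `w f` on a compact interval is the pairing of `f` with a unit vector cut off
to that interval, which lies in `𝓛²(w)`; the pairing of two such functions is integrable. -/
theorem MemL2.locIntegrable (hΩ : (Ω : Set ℝ).OrdConnected) {f : ℝ → Fin n → ℂ}
    (hf : r.MemL2 f) : LocIntegrable Ω r.μ fun x => r.wd x *ᵥ f x := by
  refine locIntegrable_pi_iff.2 fun i c hc d hd => ?_
  let e : ℝ → Fin n → ℂ := (Icc c d).indicator fun _ => Pi.single i 1
  have he : r.MemL2 e := by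
    refine memL2_of_bounded (c := c) (d := d) (B := ‖(Pi.single i 1 : Fin n → ℂ)‖) hΩ
      (aestronglyMeasurable_const.indicator measurableSet_Icc) (fun x => ?_) hc hd
      fun x hx => indicator_of_notMem hx _
    exact norm_indicator_le_norm_self _ _
  have h1 : IntegrableOn (r.dens e f) (Icc c d) r.μ := (he.integrable_dens r hf).integrableOn
  refine h1.congr_fun (fun x hx => ?_) measurableSet_Icc
  simp only [dens, e, indicator_of_mem hx]
  rw [← Pi.single_star, star_one, single_dotProduct, one_mul]

theorem wd_mulVec_eq_zero_of_dens {f : ℝ → Fin n → ℂ} {x : ℝ} (h : r.dens f f x = 0) :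
    r.wd x *ᵥ f x = 0 :=
  ((r.wd_posSemidef x).dotProduct_mulVec_zero_iff _).1 h

theorem ae_wd_mulVec_eq_zero {f : ℝ → Fin n → ℂ} {s : Set ℝ} (hf : IntegrableOn (r.dens f f) s r.μ)
    (h : ∫ x in s, r.dens f f x ∂r.μ = 0) : ∀ᵐ x ∂(r.μ.restrict s), r.wd x *ᵥ f x = 0 := by
  have h1 := integral_re hf
  rw [h] at h1
  have h2 := (integral_eq_zero_iff_of_nonneg (fun x => (Complex.nonneg_iff.1
    (r.dens_nonneg f x)).1) hf.re).1 (by simpa using h1)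
  filter_upwards [h2] with x hx
  refine wd_mulVec_eq_zero_of_dens (Complex.ext hx ?_)
  exact (Complex.nonneg_iff.1 (r.dens_nonneg f x)).2.symm

theorem ae_wd_eq_of_cls_eq {u v : r.FunL2} (h : cls u = cls v) :
    ∀ᵐ x ∂r.μ, r.wd x *ᵥ u.fn x = r.wd x *ᵥ v.fn x := by
  have h0 : cls (u - v) = 0 := by
    rw [← sub_eq_zero] at h
    exact h
  have h1 := norm_cls_sq (u - v)
  rw [h0, norm_zero] at h1
  have h2 := ae_wd_mulVec_eq_zero (s := univ) (f := (u - v).fn)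
    ((u - v).memL2.2.integrableOn) (by rw [setIntegral_univ, ← h1]; simp)
  rw [Measure.restrict_univ] at h2
  filter_upwards [h2] with x hx
  have e : (u - v).fn x = u.fn x - v.fn x := rfl
  rwa [e, Matrix.mulVec_sub, sub_eq_zero] at hx

theorem cls_eq_of_ae {u v : r.FunL2} (h : ∀ᵐ x ∂r.μ, r.wd x *ᵥ u.fn x = r.wd x *ᵥ v.fn x) :
    cls u = cls v := by
  have h0 : cls (u - v) = 0 := by
    rw [← norm_eq_zero, ← sq_eq_zero_iff]
    have h1 := norm_cls_sq (u - v)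
    have h2 : ∫ x, r.dens (u - v).fn (u - v).fn x ∂r.μ = 0 := by
      refine integral_eq_zero_of_ae ?_
      filter_upwards [h] with x hx
      have e : (u - v).fn x = u.fn x - v.fn x := rfl
      simp only [dens, e, Matrix.mulVec_sub, hx, sub_self, dotProduct_zero, Pi.zero_apply]
    rw [h2] at h1
    exact_mod_cast h1
  rw [← sub_eq_zero]
  exact h0

end MeasureRep

/-- The behaviour of `u` outside `Ω` is irrelevant because `μ` is concentrated on `Ω`. -/
theorem aestronglyMeasurable_of_locallyBoundedVariationOn (hΩ : (Ω : Set ℝ).OrdConnected) {x₀ : ℝ}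
    (hx₀ : x₀ ∈ Ω) {u : ℝ → Fin n → ℂ} (hu : LocallyBoundedVariationOn u (Ω : Set ℝ)) :
    AEStronglyMeasurable u r.μ := by
  obtain ⟨K, hK, hKΩ, hU⟩ := exists_exhaustion Ω
  have h1 : AEStronglyMeasurable u (r.μ.restrict (⋃ k, K k)) := by
    refine AEStronglyMeasurable.iUnion fun k => ?_
    obtain ⟨c, hc, d, hd, -, -, hsub⟩ := exists_Ioo_of_isCompact (hK k) (hKΩ k) hx₀
    exact (bounded_aestronglyMeasurable hu hΩ hc hd).2.mono_set
      (hsub.trans Ioo_subset_Icc_self)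
  have h2 : r.μ.restrict (Ω : Set ℝ) = r.μ :=
    Measure.restrict_eq_self_of_ae_mem (mem_ae_iff.2 r.radon.compl_eq_zero)
  rwa [hU, h2] at h1

end SquareIntegrable

/-! ### The initial value problem with a point source -/

theorem star_mulVec_dotProduct (A : Matrix (Fin n) (Fin n) ℂ) (x y : Fin n → ℂ) :
    star (A *ᵥ x) ⬝ᵥ y = star x ⬝ᵥ Aᴴ *ᵥ y := by
  rw [Matrix.star_mulVec, Matrix.dotProduct_mulVec]

/-- The matrix `2 J + B` is `2 J` times the one in question. This links the determinants defining
`Λ` with the matrices to be inverted at the atoms. -/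
theorem isUnit_one_add_half (hJ : IsUnit J) {B : Matrix (Fin n) (Fin n) ℂ}
    (h : (2 • J + B).det ≠ 0) : IsUnit (1 + (1 / 2 : ℂ) • (J⁻¹ * B)) := by
  have hd := (Matrix.isUnit_iff_isUnit_det _).1 hJ
  rw [Matrix.isUnit_iff_isUnit_det, isUnit_iff_ne_zero]
  intro h0
  apply h
  have e : 2 • J + B = (2 • J) * (1 + (1 / 2 : ℂ) • (J⁻¹ * B)) := by
    rw [mul_add, mul_one, Matrix.mul_smul, Matrix.smul_mul, ← mul_assoc,
      Matrix.mul_nonsing_inv _ hd, one_mul, ← Nat.cast_smul_eq_nsmul ℂ 2 B, smul_smul]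
    norm_num
  rw [e, Matrix.det_mul, h0, mul_zero]

theorem isUnit_one_sub_half (hJ : IsUnit J) {B : Matrix (Fin n) (Fin n) ℂ}
    (h : (2 • J - B).det ≠ 0) : IsUnit (1 - (1 / 2 : ℂ) • (J⁻¹ * B)) := by
  have := isUnit_one_add_half (B := -B) hJ (by rwa [← sub_eq_add_neg])
  rwa [Matrix.mul_neg, smul_neg, ← sub_eq_add_neg] at this

theorem det_ne_zero_of_notMem {z : ℂ} (hz : z ∉ exceptionalSet J r) {x : ℝ} (hx : x ∈ Ω) :
    (2 • J + (z • jumpW r x - jumpQ r x)).det ≠ 0 ∧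
      (2 • J - (z • jumpW r x - jumpQ r x)).det ≠ 0 := by
  constructor <;> intro h
  · exact hz ⟨x, hx, Or.inl h⟩
  · exact hz ⟨x, hx, Or.inr h⟩

theorem exists_pointSolves (hJ : IsUnit J) (hΩ : (Ω : Set ℝ).OrdConnected) {x₀ : ℝ} (hx₀ : x₀ ∈ Ω)
    {z : ℂ} (hz : z ∉ exceptionalSet J r) {f : ℝ → Fin n → ℂ} (hfm : AEStronglyMeasurable f r.μ)
    (hf : LocIntegrable Ω r.μ fun x => r.wd x *ᵥ f x) (κ ξ : Fin n → ℂ) :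
    ∃ u : ℝ → Fin n → ℂ, u x₀ = ξ ∧ PointSolves J r x₀ u (z • u + f) κ := by
  classical
  let A' : ℝ → Matrix (Fin n) (Fin n) ℂ := fun x => J⁻¹ * (z • r.wd x - r.qd x)
  -- The coefficient is set to zero at `x₀`, where `pointMeasure` has a unit mass, so that this mass
  -- only carries the source `κ`.
  let A : ℝ → Matrix (Fin n) (Fin n) ℂ := fun x => if x = x₀ then 0 else A' x
  let G : ℝ → Fin n → ℂ := fun x => if x = x₀ then J⁻¹ *ᵥ κ else J⁻¹ *ᵥ (r.wd x *ᵥ f x)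
  have hA'e : ∀ i j x, A' x i j = ∑ k, J⁻¹ i k * (z * r.wd x k j - r.qd x k j) := fun i j x => rfl
  have hA'm : ∀ i j, Measurable fun x => A' x i j := by
    intro i j
    simp only [hA'e]
    exact Finset.measurable_fun_sum _ fun k _ =>
      (((r.wd_measurable k j).const_mul z).sub (r.qd_measurable k j)).const_mul _
  have hA'i : ∀ i j, LocIntegrable Ω r.μ fun x => A' x i j := by
    intro i j c hc d hd
    simp only [hA'e]
    exact integrable_finsetSum _ fun k _ => (((r.locIntegrable_wd hΩ k j c hc d hd).const_mul z).sub
      (r.locIntegrable_qd hΩ k j c hc d hd)).const_mul _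
  have hAe : ∀ i j, (fun x => A x i j) = fun x => if x ∈ ({x₀} : Set ℝ) then 0 else A' x i j := by
    intro i j
    funext x
    by_cases hx : x = x₀ <;> simp [A, hx]
  have hs : ∀ {E : Type} [NormedAddCommGroup E] (F : ℝ → E), IntegrableOn F {x₀} r.μ := by
    intro E _ F
    simp [(r.measure_singleton_ne_top hx₀).lt_top]
  have hAm : ∀ i j, Measurable fun x => A x i j := by
    intro i j
    rw [hAe]
    exact Measurable.ite (measurableSet_singleton _) measurable_const (hA'm i j)
  have hAi : ∀ i j, LocIntegrable Ω (pointMeasure r.μ x₀) fun x => A x i j := by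
    intro i j c hc d hd
    have e : ∀ x ≠ x₀, A x i j = A' x i j := fun x hx => by
      show (if x = x₀ then 0 else A' x) i j = A' x i j
      rw [if_neg hx]
    exact (integrableOn_pointMeasure_iff (F := fun x => A x i j) (G := fun x => A' x i j) e (hs _)
      measurableSet_Icc).2 (hA'i i j c hc d hd)
  have hGi : LocIntegrable Ω (pointMeasure r.μ x₀) G := by
    intro c hc d hd
    have e : ∀ x ≠ x₀, G x = J⁻¹ *ᵥ (r.wd x *ᵥ f x) := fun x hx => if_neg hx
    exact (integrableOn_pointMeasure_iff (F := G) (G := fun x => J⁻¹ *ᵥ (r.wd x *ᵥ f x)) e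
      (hs _) measurableSet_Icc).2 (hf.const_mulVec _ c hc d hd)
  have hGm : AEStronglyMeasurable G (pointMeasure r.μ x₀) := by
    refine aestronglyMeasurable_add_measure_iff.2 ⟨?_, aestronglyMeasurable_dirac⟩
    have h1 : AEStronglyMeasurable (fun x => J⁻¹ *ᵥ (r.wd x *ᵥ f x)) r.μ :=
      aestronglyMeasurable_mulVec (A := fun _ => J⁻¹) (fun i j => aestronglyMeasurable_const)
        (aestronglyMeasurable_mulVec (A := r.wd) (fun i j => (r.wd_measurable i j).aestronglyMeasurable) hfm)
    refine h1.restrict.congr ?_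
    filter_upwards [ae_restrict_mem (measurableSet_singleton x₀).compl] with x hx
    have hx' : x ≠ x₀ := hx
    simp [G, hx']
  have hhalf : ∀ x ≠ x₀, (1 / 2 * (pointMeasure r.μ x₀).real {x}) • A x =
      (1 / 2 : ℂ) • (J⁻¹ * (z • jumpW r x - jumpQ r x)) := by
    intro x hx
    have h1 : (pointMeasure r.μ x₀).real {x} = r.μ.real {x} := by
      simp [Measure.real, pointMeasure_singleton, hx]
    rw [h1, ← Complex.coe_smul]
    have h2 : z • jumpW r x - jumpQ r x = (r.μ.real {x} : ℂ) • (z • r.wd x - r.qd x) := by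
      rw [jumpW, jumpQ, smul_sub, smul_comm]
    rw [h2, Matrix.mul_smul, smul_smul]
    simp only [A, hx, if_false, A']
    congr 1
    push_cast
    ring
  have hinv₁ : ∀ x ∈ Ω, IsUnit (1 - (1 / 2 * (pointMeasure r.μ x₀).real {x}) • A x) := by
    intro x hx
    by_cases h : x = x₀
    · simp [A, h]
    · rw [hhalf x h]
      exact isUnit_one_sub_half hJ (det_ne_zero_of_notMem hz hx).2
  have hinv₂ : ∀ x ∈ Ω, IsUnit (1 + (1 / 2 * (pointMeasure r.μ x₀).real {x}) • A x) := by
    intro x hx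
    by_cases h : x = x₀
    · simp [A, h]
    · rw [hhalf x h]
      exact isUnit_one_add_half hJ (det_ne_zero_of_notMem hz hx).1
  have hμ : ∀ x ∈ Ω, pointMeasure r.μ x₀ {x} ≠ ∞ := by
    intro x hx
    rw [pointMeasure_singleton]
    split_ifs
    · exact ENNReal.one_ne_top
    · exact r.measure_singleton_ne_top hx
  obtain ⟨u, hu0, hloc, hprim⟩ := exists_primitive hΩ hAm hAi hGm hGi hinv₁ hinv₂ hμ hx₀ ξ
  have e : (fun x => A x *ᵥ u x + G x) = forcing J r x₀ u (z • u + f) κ := by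
    funext x
    by_cases hx : x = x₀
    · simp [A, G, hx, forcing]
    · simp only [A, G, hx, forcing, if_false, A', Pi.add_apply, Pi.smul_apply]
      rw [← Matrix.mulVec_mulVec, ← Matrix.mulVec_add, Matrix.sub_mulVec, Matrix.smul_mulVec,
        Matrix.mulVec_add (r.wd x), Matrix.mulVec_smul]
      congr 1
      abel
  rw [e] at hloc hprim
  exact ⟨u, hu0, hloc, hprim⟩

/-! ### Green's identity -/

variable (J r) in
/-- The left-hand value of a solution. -/
noncomputable def leftSol (x₀ : ℝ) (u g : ℝ → Fin n → ℂ) (κ : Fin n → ℂ) (x : ℝ) : Fin n → ℂ :=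
  leftVal (pointMeasure r.μ x₀) u (forcing J r x₀ u g κ) x

theorem leftSol_base (x₀ : ℝ) (u g : ℝ → Fin n → ℂ) (κ : Fin n → ℂ) :
    leftSol J r x₀ u g κ x₀ = u x₀ - (1 / 2 : ℂ) • (J⁻¹ *ᵥ κ) := by
  simp only [leftSol, leftVal, forcing, if_true, Measure.real, pointMeasure_singleton,
    ENNReal.toReal_one, one_smul]
  congr 1
  rw [← Complex.coe_smul]
  norm_num

theorem leftSol_of_ne {x₀ x : ℝ} (hx : x ≠ x₀) (u g : ℝ → Fin n → ℂ) (κ : Fin n → ℂ) :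
    leftSol J r x₀ u g κ x =
      u x - (1 / 2 : ℝ) • (r.μ.real {x} • (J⁻¹ *ᵥ (r.wd x *ᵥ g x - r.qd x *ᵥ u x))) := by
  simp [leftSol, leftVal, forcing, hx, Measure.real, pointMeasure_singleton]

theorem real_smul_dens (r : MeasureRep q w) {x₀ : ℝ} (hw : jumpW r x₀ = 0) (u g : ℝ → Fin n → ℂ) :
    r.μ.real {x₀} • r.dens u g x₀ = 0 := by
  have h1 : (r.μ.real {x₀} : ℂ) • (r.wd x₀ *ᵥ g x₀) = 0 := by
    rw [← Matrix.smul_mulVec]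
    exact (congrArg (· *ᵥ g x₀) hw).trans (Matrix.zero_mulVec _)
  rw [← Complex.coe_smul, MeasureRep.dens, ← dotProduct_smul, h1, dotProduct_zero]

/-- The product rule for `u^* J v`. As `J` is skew-Hermitian, the derivatives turn into the
right-hand sides of the equations; the terms with `q` cancel because it is Hermitian, and the unit
mass at `x₀` contributes the sources. -/
theorem PointSolves.green (hJ : IsUnit J) (hJs : Jᴴ = -J) (hqh : ∀ᵐ x ∂r.μ, (r.qd x)ᴴ = r.qd x)
    (hΩ : (Ω : Set ℝ).OrdConnected) {x₀ : ℝ} (hx₀ : x₀ ∈ Ω) (hw : jumpW r x₀ = 0)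
    {u g v k : ℝ → Fin n → ℂ} {κ κ' : Fin n → ℂ} (hu : PointSolves J r x₀ u g κ)
    (hv : PointSolves J r x₀ v k κ') {c d : ℝ} (hc : c ∈ Ω) (hd : d ∈ Ω) (hcd : c ≤ d) :
    star (leftSol J r x₀ u g κ d) ⬝ᵥ J *ᵥ leftSol J r x₀ v k κ' d -
      star (leftSol J r x₀ u g κ c) ⬝ᵥ J *ᵥ leftSol J r x₀ v k κ' c =
    (∫ x in Ico c d, (r.dens u k x - r.dens g v x) ∂r.μ) +
      (Ico c d).indicator (fun _ => star (u x₀) ⬝ᵥ κ' - star κ ⬝ᵥ v x₀) x₀ := by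
  have hdet := (Matrix.isUnit_iff_isUnit_det _).1 hJ
  have hJJ : ∀ x : Fin n → ℂ, J *ᵥ (J⁻¹ *ᵥ x) = x := fun x => by
    rw [Matrix.mulVec_mulVec, Matrix.mul_nonsing_inv _ hdet, Matrix.one_mulVec]
  have hJJ' : ∀ x y : Fin n → ℂ, star (J⁻¹ *ᵥ x) ⬝ᵥ J *ᵥ y = -(star x ⬝ᵥ y) := fun x y => by
    have h1 : star (J *ᵥ (J⁻¹ *ᵥ x)) ⬝ᵥ y = -(star (J⁻¹ *ᵥ x) ⬝ᵥ J *ᵥ y) := by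
      rw [star_mulVec_dotProduct, hJs, Matrix.neg_mulVec, dotProduct_neg]
    rw [hJJ] at h1
    rw [h1, neg_neg]
  obtain ⟨hi, he⟩ := hu.prim.sesquilinear hu.loc hv.prim hv.loc hΩ hc hd hcd J
  simp only [leftSol]
  rw [← he]
  rw [integrableOn_pointMeasure measurableSet_Ico] at hi
  rw [setIntegral_pointMeasure measurableSet_Ico hi]
  have hm : MeasurableSet (Ico c d \ {x₀}) := measurableSet_Ico.diff (measurableSet_singleton x₀)
  have hae : (fun x => star (u x) ⬝ᵥ J *ᵥ forcing J r x₀ v k κ' x +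
      star (forcing J r x₀ u g κ x) ⬝ᵥ J *ᵥ v x) =ᵐ[r.μ.restrict (Ico c d \ {x₀})]
      fun x => r.dens u k x - r.dens g v x := by
    filter_upwards [ae_restrict_of_ae hqh, ae_restrict_mem hm] with x hx hxm
    have hx' : x ≠ x₀ := hxm.2
    simp only [forcing, hx', if_false, hJJ, hJJ', MeasureRep.dens]
    rw [dotProduct_sub, star_sub, sub_dotProduct, star_mulVec_dotProduct, star_mulVec_dotProduct,
      hx, r.wd_conjTranspose]
    ring
  have hi2 : IntegrableOn (fun x => r.dens u k x - r.dens g v x) (Ico c d \ {x₀}) r.μ :=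
    hi.congr hae
  have h0 : ∫ x in {x₀}, (r.dens u k x - r.dens g v x) ∂r.μ = 0 := by
    rw [integral_singleton, smul_sub, real_smul_dens r hw, real_smul_dens r hw, sub_zero]
  have hi3 : IntegrableOn (fun x => r.dens u k x - r.dens g v x) {x₀} r.μ := by
    simp [(r.measure_singleton_ne_top hx₀).lt_top]
  rw [integral_congr_ae hae]
  congr 1
  · by_cases hx : x₀ ∈ Ico c d
    · have := setIntegral_union (disjoint_sdiff_left : Disjoint (Ico c d \ {x₀}) {x₀})
        (measurableSet_singleton x₀) hi2 hi3
      rw [sdiff_union_of_subset (singleton_subset_iff.2 hx), h0, add_zero] at this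
      exact this.symm
    · rw [sdiff_singleton_eq_self hx]
  · by_cases hx : x₀ ∈ Ico c d
    · simp only [indicator_of_mem hx, forcing, if_true, hJJ, hJJ']
      ring
    · simp only [indicator_of_notMem hx]

end OrderZero

namespace OrderZero

variable {Ω : Opens ℝ} {n : ℕ} {q w : DistMatrix Ω n} {J : Matrix (Fin n) (Fin n) ℂ}
  {r : MeasureRep q w}

/-! ### Fundamental matrices -/

variable (J r) in
/-- The standing assumptions, for a base point `x₀` at which the coefficients have no mass. -/
structure IsBasePoint (x₀ : ℝ) : Prop where
  coeff : Coefficients J r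
  conn : (Ω : Set ℝ).OrdConnected
  mem : x₀ ∈ Ω
  jumpQ_eq : jumpQ r x₀ = 0
  jumpW_eq : jumpW r x₀ = 0

theorem PointSolves.congr_on {x₀ : ℝ} (hΩ : (Ω : Set ℝ).OrdConnected) {u g u' g' : ℝ → Fin n → ℂ}
    {κ : Fin n → ℂ} (h : PointSolves J r x₀ u g κ) (hu : ∀ x ∈ Ω, u x = u' x)
    (hg : ∀ x ∈ Ω, g x = g' x) : PointSolves J r x₀ u' g' κ := by
  have e : ∀ x ∈ Ω, forcing J r x₀ u g κ x = forcing J r x₀ u' g' κ x := fun x hx => by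
    simp only [forcing, hu x hx, hg x hx]
  refine ⟨fun c hc d hd => (h.loc c hc d hd).congr_fun (fun x hx => e x (hΩ.out hc hd hx))
    measurableSet_Icc, fun c hc d hd hcd => ?_⟩
  rw [← hu d hd, ← hu c hc, h.prim c hc d hd hcd,
    setIntegral_congr_fun measurableSet_Ioc fun x hx => e x (hΩ.out hc hd (Ioc_subset_Icc_self hx)),
    setIntegral_congr_fun measurableSet_Ico fun x hx => e x (hΩ.out hc hd (Ico_subset_Icc_self hx))]

theorem PointSolves.sum {ι : Type*} (s : Finset ι) {x₀ : ℝ} {u g : ι → ℝ → Fin n → ℂ}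
    (h : ∀ i, PointSolves J r x₀ (u i) (g i) 0) :
    PointSolves J r x₀ (∑ i ∈ s, u i) (∑ i ∈ s, g i) 0 := by
  classical
  induction s using Finset.induction_on with
  | empty =>
    have e : forcing J r x₀ 0 0 0 = 0 := by
      funext x
      simp [forcing]
    simp only [Finset.sum_empty]
    refine ⟨fun c hc d hd => ?_, fun c hc d hd hcd => ?_⟩
    · rw [e]
      exact integrable_zero _ _ _
    · rw [e]
      simp
  | insert i s hi ih =>
    rw [Finset.sum_insert hi, Finset.sum_insert hi]
    simpa using (h i).add ih

namespace IsBasePoint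

variable {x₀ : ℝ} (h : IsBasePoint J r x₀)
include h

theorem qd_conjTranspose : ∀ᵐ x ∂r.μ, (r.qd x)ᴴ = r.qd x :=
  r.qd_conjTranspose h.coeff.hermitian h.conn h.mem

/-- The density of `q` is Hermitian only almost everywhere, but an exceptional null set contains no
atom, and without an atom the jump is zero. -/
theorem jumpQ_conjTranspose (x : ℝ) : (jumpQ r x)ᴴ = jumpQ r x := by
  by_cases h0 : r.μ {x} = 0
  · simp [jumpQ, Measure.real, h0]
  · have h1 : (r.qd x)ᴴ = r.qd x := by
      have h2 := h.qd_conjTranspose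
      by_contra hne
      exact h0 (measure_mono_null (singleton_subset_iff.2 hne) (ae_iff.1 h2))
    rw [jumpQ, Matrix.conjTranspose_smul, h1]
    simp

theorem jumpW_conjTranspose (x : ℝ) : (jumpW r x)ᴴ = jumpW r x := by
  rw [jumpW, Matrix.conjTranspose_smul, r.wd_conjTranspose]
  simp

/-- Taking adjoints changes the sign of `J` and keeps the jumps, so the two determinants in the
definition of `Λ` are interchanged up to sign and conjugation. -/
theorem star_notMem {z : ℂ} (hz : z ∉ exceptionalSet J r) : star z ∉ exceptionalSet J r := by
  have hdet : ∀ A : Matrix (Fin n) (Fin n) ℂ, (-Aᴴ).det = 0 → A.det = 0 := by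
    intro A hA
    rw [Matrix.det_neg, Matrix.det_conjTranspose, mul_eq_zero] at hA
    rcases hA with hA | hA
    · exact absurd hA (pow_ne_zero _ (by norm_num))
    · exact star_eq_zero.1 hA
  rintro ⟨x, hx, hd⟩
  refine hz ⟨x, hx, ?_⟩
  rcases hd with hd | hd
  · right
    apply hdet
    rw [← hd]
    congr 1
    simp only [Matrix.conjTranspose_sub, Matrix.conjTranspose_smul, h.jumpQ_conjTranspose,
      h.jumpW_conjTranspose, h.coeff.skew, star_ofNat]
    module
  · left
    apply hdet
    rw [← hd]
    congr 1
    simp only [Matrix.conjTranspose_sub, Matrix.conjTranspose_add, Matrix.conjTranspose_smul,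
      h.jumpQ_conjTranspose, h.jumpW_conjTranspose, h.coeff.skew, star_ofNat]
    module

theorem green {u g v k : ℝ → Fin n → ℂ} {κ κ' : Fin n → ℂ} (hu : PointSolves J r x₀ u g κ)
    (hv : PointSolves J r x₀ v k κ') {c d : ℝ} (hc : c ∈ Ω) (hd : d ∈ Ω) (hcd : c ≤ d) :
    star (leftSol J r x₀ u g κ d) ⬝ᵥ J *ᵥ leftSol J r x₀ v k κ' d -
      star (leftSol J r x₀ u g κ c) ⬝ᵥ J *ᵥ leftSol J r x₀ v k κ' c =
    (∫ x in Ico c d, (r.dens u k x - r.dens g v x) ∂r.μ) +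
      (Ico c d).indicator (fun _ => star (u x₀) ⬝ᵥ κ' - star κ ⬝ᵥ v x₀) x₀ :=
  hu.green h.coeff.invertible h.coeff.skew h.qd_conjTranspose h.conn h.mem h.jumpW_eq hv hc hd hcd

theorem isSolution_iff {u g : ℝ → Fin n → ℂ} (hg : LocIntegrable Ω r.μ fun x => r.wd x *ᵥ g x) :
    IsSolution J r u g ↔ PointSolves J r x₀ u g 0 :=
  OrderZero.isSolution_iff h.coeff.invertible h.conn h.mem h.jumpQ_eq h.jumpW_eq hg

theorem isSolution_iff_smul {u : ℝ → Fin n → ℂ} {z : ℂ} :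
    IsSolution J r u (z • u) ↔ PointSolves J r x₀ u (z • u) 0 := by
  have key : LocallyBoundedVariationOn u (Ω : Set ℝ) →
      LocIntegrable Ω r.μ fun x => r.wd x *ᵥ (z • u) x := by
    intro hu c hc d hd
    have := (LocIntegrable.mulVec (r.locIntegrable_wd h.conn) hu h.conn c hc d hd).smul z
    refine this.congr (ae_of_all _ fun x => ?_)
    exact (Matrix.mulVec_smul (r.wd x) z (u x)).symm
  constructor
  · intro hs
    exact (h.isSolution_iff (key hs.1.1)).1 hs
  · intro hs
    exact (h.isSolution_iff (key hs.locallyBoundedVariationOn)).2 hs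

theorem exists_isFundamental {z : ℂ} (hz : z ∉ exceptionalSet J r) :
    ∃ U, IsFundamental J r x₀ z U := by
  have h0 : LocIntegrable Ω r.μ fun x => r.wd x *ᵥ (0 : ℝ → Fin n → ℂ) x := by
    intro c _ d _
    simp
  choose u hu0 hu using fun k : Fin n => exists_pointSolves h.coeff.invertible h.conn h.mem hz
    (f := 0) aestronglyMeasurable_const h0 0 (Pi.single k 1)
  refine ⟨fun x => Matrix.of fun i k => u k x i, fun k => ?_, ?_⟩
  · have := hu k
    rw [add_zero] at this
    exact h.isSolution_iff_smul.2 this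
  · ext i k
    simp only [Matrix.of_apply, hu0, Matrix.one_apply, Pi.single_apply]

theorem fundMatrix_base {z : ℂ} (hz : z ∉ exceptionalSet J r) : fundMatrix J r x₀ z x₀ = 1 := by
  rw [fundMatrix, dif_pos (h.exists_isFundamental hz)]
  exact (h.exists_isFundamental hz).choose_spec.2

theorem pointSolves_fundMatrix {z : ℂ} (hz : z ∉ exceptionalSet J r) (η : Fin n → ℂ) :
    PointSolves J r x₀ (fun x => fundMatrix J r x₀ z x *ᵥ η)
      (z • fun x => fundMatrix J r x₀ z x *ᵥ η) 0 := by
  have h1 : ∀ k, PointSolves J r x₀ (fun x => (fundMatrix J r x₀ z x).col k)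
      (z • fun x => (fundMatrix J r x₀ z x).col k) 0 := by
    intro k
    rw [fundMatrix, dif_pos (h.exists_isFundamental hz)]
    exact h.isSolution_iff_smul.1 ((h.exists_isFundamental hz).choose_spec.1 k)
  have h2 : ∀ k, PointSolves J r x₀ (η k • fun x => (fundMatrix J r x₀ z x).col k)
      (η k • z • fun x => (fundMatrix J r x₀ z x).col k) 0 := fun k => by
    have := (h1 k).smul (η k)
    rwa [smul_zero] at this
  have h3 := PointSolves.sum Finset.univ h2
  have e : (∑ k, η k • fun x => (fundMatrix J r x₀ z x).col k) =
      fun x => fundMatrix J r x₀ z x *ᵥ η := by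
    funext x i
    simp only [Finset.sum_apply, Pi.smul_apply, Matrix.mulVec, dotProduct, smul_eq_mul,
      Matrix.col_apply]
    exact Finset.sum_congr rfl fun _ _ => mul_comm _ _
  have e' : (∑ k, η k • z • fun x => (fundMatrix J r x₀ z x).col k) =
      z • fun x => fundMatrix J r x₀ z x *ᵥ η := by
    rw [← e, Finset.smul_sum]
    exact Finset.sum_congr rfl fun _ _ => smul_comm _ _ _
  rwa [e, e'] at h3

/-- The value of a solution at a point where it has no source, in terms of its left-hand value. -/
theorem eq_zero_of_leftSol {z : ℂ} (hz : z ∉ exceptionalSet J r) {u f : ℝ → Fin n → ℂ}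
    {κ : Fin n → ℂ} {x : ℝ} (hx : x ∈ Ω) (hne : x ≠ x₀) (hf : f x = 0)
    (h0 : leftSol J r x₀ u (z • u + f) κ x = 0) : u x = 0 := by
  rw [leftSol_of_ne hne] at h0
  -- Without inhomogeneity at `x`, the left-hand value is a matrix times the balanced value, and
  -- that matrix is invertible for `z ∉ Λ`.
  have e : u x - (1 / 2 : ℝ) • (r.μ.real {x} • (J⁻¹ *ᵥ (r.wd x *ᵥ (z • u + f) x - r.qd x *ᵥ u x))) =
      (1 - (1 / 2 : ℂ) • (J⁻¹ * (z • jumpW r x - jumpQ r x))) *ᵥ u x := by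
    have h2 : z • jumpW r x - jumpQ r x = (r.μ.real {x} : ℂ) • (z • r.wd x - r.qd x) := by
      rw [jumpW, jumpQ, smul_sub, smul_comm]
    rw [h2, Matrix.sub_mulVec, Matrix.one_mulVec, Matrix.mul_smul, Matrix.smul_mulVec,
      Matrix.smul_mulVec, ← Matrix.mulVec_mulVec, Matrix.sub_mulVec, Matrix.smul_mulVec,
      Pi.add_apply, hf, add_zero, Pi.smul_apply, Matrix.mulVec_smul, ← Complex.coe_smul,
      ← Complex.coe_smul]
    norm_num
  rw [e] at h0
  have hu := isUnit_one_sub_half h.coeff.invertible (det_ne_zero_of_notMem hz hx).2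
  exact (Matrix.mulVec_injective_iff_isUnit.2 hu) (by rw [h0, Matrix.mulVec_zero])

end IsBasePoint

end OrderZero

namespace OrderZero

variable {Ω : Opens ℝ} {n : ℕ} {q w : DistMatrix Ω n} {J : Matrix (Fin n) (Fin n) ℂ}
  {r : MeasureRep q w}

/-! ### One-sided limits of fundamental matrices -/

variable (J r) in
/-- The right-hand value of a solution. -/
noncomputable def rightSol (x₀ : ℝ) (u g : ℝ → Fin n → ℂ) (κ : Fin n → ℂ) (x : ℝ) : Fin n → ℂ :=
  rightVal (pointMeasure r.μ x₀) u (forcing J r x₀ u g κ) x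

theorem eq_half_leftSol_add_rightSol (x₀ : ℝ) (u g : ℝ → Fin n → ℂ) (κ : Fin n → ℂ) (x : ℝ) :
    u x = (1 / 2 : ℂ) • (leftSol J r x₀ u g κ x + rightSol J r x₀ u g κ x) := by
  simp only [leftSol, rightSol, leftVal, rightVal]
  module

theorem rightSol_of_ne {x₀ x : ℝ} (hx : x ≠ x₀) (u g : ℝ → Fin n → ℂ) (κ : Fin n → ℂ) :
    rightSol J r x₀ u g κ x =
      u x + (1 / 2 : ℝ) • (r.μ.real {x} • (J⁻¹ *ᵥ (r.wd x *ᵥ g x - r.qd x *ᵥ u x))) := by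
  simp [rightSol, rightVal, forcing, hx, Measure.real, pointMeasure_singleton]

theorem rightSol_base_zero (x₀ : ℝ) (u g : ℝ → Fin n → ℂ) :
    rightSol J r x₀ u g 0 x₀ = u x₀ := by
  simp [rightSol, rightVal, forcing]

theorem leftSol_base_zero (x₀ : ℝ) (u g : ℝ → Fin n → ℂ) :
    leftSol J r x₀ u g 0 x₀ = u x₀ := by
  simp [leftSol, leftVal, forcing]

theorem eq_of_forall_star_dotProduct {a b : Fin n → ℂ} (h : ∀ η : Fin n → ℂ, star η ⬝ᵥ a = star η ⬝ᵥ b) :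
    a = b := by
  funext i
  have := h (Pi.single i 1)
  rwa [← Pi.single_star, star_one, single_dotProduct, single_dotProduct, one_mul, one_mul] at this

/-- If the columns of a matrix function converge then so does the matrix function. -/
theorem tendsto_matrix_of_mulVec {l : Filter ℝ} {U : ℝ → Matrix (Fin n) (Fin n) ℂ}
    {L : (Fin n → ℂ) → Fin n → ℂ} (h : ∀ η, Tendsto (fun x => U x *ᵥ η) l (𝓝 (L η))) :
    ∃ V, Tendsto U l (𝓝 V) := by
  refine ⟨Matrix.of fun i k => L (Pi.single k 1) i, ?_⟩
  refine tendsto_pi_nhds.2 fun i => tendsto_pi_nhds.2 fun k => ?_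
  have h1 := tendsto_pi_nhds.1 (h (Pi.single k 1)) i
  simpa only [Matrix.mulVec_single_one, Matrix.col_apply, Matrix.of_apply] using h1

namespace IsBasePoint

variable {x₀ : ℝ} (h : IsBasePoint J r x₀)
include h

/-- The columns converge since they are balanced primitives, hence so does the matrix; without
convergence `leftLim` could be a default value. -/
theorem leftLim_fundMatrix_mulVec {z : ℂ} (hz : z ∉ exceptionalSet J r) {x : ℝ} (hx : x ∈ Ω)
    (η : Fin n → ℂ) : Function.leftLim (fundMatrix J r x₀ z) x *ᵥ η =
      leftSol J r x₀ (fun x => fundMatrix J r x₀ z x *ᵥ η)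
        (z • fun x => fundMatrix J r x₀ z x *ᵥ η) 0 x := by
  have h1 := fun η => (h.pointSolves_fundMatrix hz η).prim.tendsto_left
    (h.pointSolves_fundMatrix hz η).loc hx
  obtain ⟨V, hV⟩ := tendsto_matrix_of_mulVec h1
  have h2 := (tendsto_leftLim_of_tendsto ⟨V, hV⟩)
  exact tendsto_nhds_unique ((Continuous.matrix_mulVec continuous_id continuous_const).tendsto _
    |>.comp h2) (h1 η)

theorem rightLim_fundMatrix_mulVec {z : ℂ} (hz : z ∉ exceptionalSet J r) {x : ℝ} (hx : x ∈ Ω)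
    (η : Fin n → ℂ) : Function.rightLim (fundMatrix J r x₀ z) x *ᵥ η =
      rightSol J r x₀ (fun x => fundMatrix J r x₀ z x *ᵥ η)
        (z • fun x => fundMatrix J r x₀ z x *ᵥ η) 0 x := by
  have h1 := fun η => (h.pointSolves_fundMatrix hz η).prim.tendsto_right
    (h.pointSolves_fundMatrix hz η).loc hx
  obtain ⟨V, hV⟩ := tendsto_matrix_of_mulVec h1
  have h2 := (tendsto_rightLim_of_tendsto ⟨V, hV⟩)
  exact tendsto_nhds_unique ((Continuous.matrix_mulVec continuous_id continuous_const).tendsto _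
    |>.comp h2) (h1 η)

theorem fundMatrix_eq_half {z : ℂ} (hz : z ∉ exceptionalSet J r) {x : ℝ} (hx : x ∈ Ω) :
    fundMatrix J r x₀ z x = (1 / 2 : ℂ) • (Function.leftLim (fundMatrix J r x₀ z) x +
      Function.rightLim (fundMatrix J r x₀ z) x) := by
  refine Matrix.ext_of_mulVec_single fun k => ?_
  rw [Matrix.smul_mulVec, Matrix.add_mulVec, h.leftLim_fundMatrix_mulVec hz hx,
    h.rightLim_fundMatrix_mulVec hz hx]
  exact eq_half_leftSol_add_rightSol x₀ (fun x => fundMatrix J r x₀ z x *ᵥ Pi.single k 1) _ 0 x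

theorem locIntegrable_adjDensity {z : ℂ} (hz : star z ∉ exceptionalSet J r) {f : ℝ → Fin n → ℂ}
    (hf : LocIntegrable Ω r.μ fun x => r.wd x *ᵥ f x) :
    LocIntegrable Ω r.μ (adjDensity J r x₀ z f) := by
  refine locIntegrable_pi_iff.2 fun i c hc d hd => ?_
  have hbv := (h.pointSolves_fundMatrix hz (Pi.single i 1)).locallyBoundedVariationOn
  refine integrable_finsetSum (f := fun k x => (fundMatrix J r x₀ (star z) x)ᴴ i k *
    (r.wd x *ᵥ f x) k) Finset.univ fun k _ => ?_
  obtain ⟨⟨B, hB⟩, hm⟩ := (locallyBoundedVariationOn_apply hbv k).bounded_aestronglyMeasurable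
    (μ := r.μ) h.conn hc hd
  have e : ∀ x, (fundMatrix J r x₀ (star z) x)ᴴ i k =
      star ((fundMatrix J r x₀ (star z) x *ᵥ Pi.single i 1) k) := fun x => by
    rw [Matrix.mulVec_single_one, Matrix.conjTranspose_apply, Matrix.col_apply]
  simp only [e]
  refine (locIntegrable_pi_iff.1 hf k c hc d hd).bdd_mul (c := B)
    (continuous_star.comp_aestronglyMeasurable hm)
    ((ae_restrict_mem measurableSet_Icc).mono fun x hx => ?_)
  rw [norm_star]
  exact hB x hx

omit h in
theorem star_dotProduct_adjDensity (z : ℂ) (f : ℝ → Fin n → ℂ) (η : Fin n → ℂ) (x : ℝ) :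
    star η ⬝ᵥ adjDensity J r x₀ z f x =
      r.dens (fun x => fundMatrix J r x₀ (star z) x *ᵥ η) f x := by
  rw [adjDensity, MeasureRep.dens, star_mulVec_dotProduct]

omit h in
theorem star_dotProduct_integral {μ : Measure ℝ} {F : ℝ → Fin n → ℂ} {s : Set ℝ}
    (hF : IntegrableOn F s μ) (η : Fin n → ℂ) :
    star η ⬝ᵥ ∫ x in s, F x ∂μ = ∫ x in s, star η ⬝ᵥ F x ∂μ := by
  let L : (Fin n → ℂ) →L[ℂ] ℂ := (dotProductBilin ℂ ℂ (star η)).toContinuousLinearMap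
  exact (L.integral_comp_comm hF).symm

/-- The increments of the pairing of a solution with `U(·, z̄)`. -/
theorem pairing_sub {z : ℂ} (hz : z ∉ exceptionalSet J r) {u f : ℝ → Fin n → ℂ} {κ : Fin n → ℂ}
    (hu : PointSolves J r x₀ u (z • u + f) κ) (hf : LocIntegrable Ω r.μ fun x => r.wd x *ᵥ f x)
    {c d : ℝ} (hc : c ∈ Ω) (hd : d ∈ Ω) (hcd : c ≤ d) :
    (Function.leftLim (fundMatrix J r x₀ (star z)) d)ᴴ *ᵥ J *ᵥ leftSol J r x₀ u (z • u + f) κ d -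
      (Function.leftLim (fundMatrix J r x₀ (star z)) c)ᴴ *ᵥ J *ᵥ leftSol J r x₀ u (z • u + f) κ c =
    (∫ x in Ico c d, adjDensity J r x₀ z f x ∂r.μ) + (Ico c d).indicator (fun _ => κ) x₀ := by
  have hz' := h.star_notMem hz
  refine eq_of_forall_star_dotProduct fun η => ?_
  have hV := h.pointSolves_fundMatrix hz' η
  have hg := h.green hV hu hc hd hcd
  rw [← h.leftLim_fundMatrix_mulVec hz' hd, ← h.leftLim_fundMatrix_mulVec hz' hc,
    star_mulVec_dotProduct, star_mulVec_dotProduct] at hg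
  rw [dotProduct_sub, hg, dotProduct_add, star_dotProduct_integral
    ((h.locIntegrable_adjDensity hz' hf).sub_set hc hd Ico_subset_Icc_self)]
  congr 1
  -- The parameter `z̄` of the first solution is conjugated by the form, so it cancels against the
  -- `z` of the second, and only `f` remains.
  · refine integral_congr_ae (ae_of_all _ fun x => ?_)
    simp only
    rw [star_dotProduct_adjDensity, r.dens_add_right, r.dens_smul_right, r.dens_smul, star_star]
    ring
  · by_cases hx : x₀ ∈ Ico c d
    · rw [indicator_of_mem hx, indicator_of_mem hx, h.fundMatrix_base hz', Matrix.one_mulVec]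
      simp
    · rw [indicator_of_notMem hx, indicator_of_notMem hx, dotProduct_zero]

/-- The jumps of the pairing of a solution with `U(·, z̄)`. -/
theorem pairing_jump {z : ℂ} (hz : z ∉ exceptionalSet J r) {u f : ℝ → Fin n → ℂ} {x : ℝ}
    (hx : x ∈ Ω) :
    (Function.rightLim (fundMatrix J r x₀ (star z)) x)ᴴ *ᵥ J *ᵥ
        rightSol J r x₀ u (z • u + f) 0 x =
      (Function.leftLim (fundMatrix J r x₀ (star z)) x)ᴴ *ᵥ J *ᵥ
        leftSol J r x₀ u (z • u + f) 0 x + (r.μ.real {x} : ℂ) • adjDensity J r x₀ z f x := by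
  have hz' := h.star_notMem hz
  have hdet := (Matrix.isUnit_iff_isUnit_det _).1 h.coeff.invertible
  have hJJ : ∀ x : Fin n → ℂ, J *ᵥ (J⁻¹ *ᵥ x) = x := fun x => by
    rw [Matrix.mulVec_mulVec, Matrix.mul_nonsing_inv _ hdet, Matrix.one_mulVec]
  have hJs : ∀ x y : Fin n → ℂ, star x ⬝ᵥ J *ᵥ y = -(star (J *ᵥ x) ⬝ᵥ y) := fun x y => by
    rw [star_mulVec_dotProduct, h.coeff.skew, Matrix.neg_mulVec, dotProduct_neg, neg_neg]
  refine eq_of_forall_star_dotProduct fun η => ?_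
  rw [dotProduct_add, dotProduct_smul, ← star_mulVec_dotProduct, ← star_mulVec_dotProduct,
    h.leftLim_fundMatrix_mulVec hz' hx, h.rightLim_fundMatrix_mulVec hz' hx,
    star_dotProduct_adjDensity]
  set V : ℝ → Fin n → ℂ := fun x => fundMatrix J r x₀ (star z) x *ᵥ η
  by_cases hx0 : x = x₀
  · subst hx0
    have h1 := real_smul_dens r h.jumpW_eq V f
    rw [← Complex.coe_smul] at h1
    rw [rightSol_base_zero, rightSol_base_zero, leftSol_base_zero, leftSol_base_zero, h1, add_zero]
  · rw [rightSol_of_ne hx0, rightSol_of_ne hx0, leftSol_of_ne hx0, leftSol_of_ne hx0]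
    simp only [← Complex.coe_smul]
    set m : ℂ := (r.μ.real {x} : ℂ) with hm
    have hms : star m = m := Complex.conj_ofReal _
    -- Hermitian symmetry of the density is available at `x` only after multiplication by the mass
    -- there. The terms quadratic in the half jumps cancel between the two sides, which is why the
    -- balanced values give the exact jump of the product.
    have hq : m * (star (r.qd x *ᵥ V x) ⬝ᵥ u x) = m * (star (V x) ⬝ᵥ r.qd x *ᵥ u x) := by
      have h1 : star (jumpQ r x *ᵥ V x) ⬝ᵥ u x = star (V x) ⬝ᵥ jumpQ r x *ᵥ u x := by
        rw [star_mulVec_dotProduct, h.jumpQ_conjTranspose]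
      simp only [jumpQ, ← hm, Matrix.smul_mulVec, star_smul, smul_dotProduct, dotProduct_smul,
        hms, smul_eq_mul] at h1
      exact h1
    set F : Fin n → ℂ := r.wd x *ᵥ (star z • V) x - r.qd x *ᵥ V x with hF
    set G : Fin n → ℂ := r.wd x *ᵥ (z • u + f) x - r.qd x *ᵥ u x with hG
    have hhalf : star (((1 / 2 : ℝ) : ℂ)) = ((1 / 2 : ℝ) : ℂ) := Complex.conj_ofReal _
    have h1 : star (V x) ⬝ᵥ J *ᵥ (J⁻¹ *ᵥ G) = r.dens V (z • u + f) x - star (V x) ⬝ᵥ r.qd x *ᵥ u x := by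
      rw [hJJ, hG, dotProduct_sub]; rfl
    have h2 : star (J⁻¹ *ᵥ F) ⬝ᵥ J *ᵥ u x = -(r.dens (star z • V) u x) + star (r.qd x *ᵥ V x) ⬝ᵥ u x := by
      rw [hJs, hJJ, hF, star_sub, sub_dotProduct, star_mulVec_dotProduct, r.wd_conjTranspose,
        MeasureRep.dens]
      ring
    rw [r.dens_add_right, r.dens_smul_right] at h1
    rw [r.dens_smul, star_star] at h2
    simp only [star_add, star_sub, star_smul, hms, hhalf, add_dotProduct, sub_dotProduct,
      Matrix.mulVec_add, Matrix.mulVec_sub, dotProduct_add, dotProduct_sub, Matrix.mulVec_smul,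
      dotProduct_smul, smul_dotProduct, h1, h2, smul_eq_mul]
    push_cast
    linear_combination hq

/-- The symplectic identity for the left-hand limits. -/
theorem leftLim_symplectic {z : ℂ} (hz : z ∉ exceptionalSet J r) {x : ℝ} (hx : x ∈ Ω)
    (η : Fin n → ℂ) : (Function.leftLim (fundMatrix J r x₀ (star z)) x)ᴴ *ᵥ J *ᵥ
      Function.leftLim (fundMatrix J r x₀ z) x *ᵥ η = J *ᵥ η := by
  have hz' := h.star_notMem hz
  have h0 : LocIntegrable Ω r.μ fun x => r.wd x *ᵥ (0 : ℝ → Fin n → ℂ) x := by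
    intro c _ d _
    simp
  have hV := h.pointSolves_fundMatrix hz η
  have hb : (Function.leftLim (fundMatrix J r x₀ (star z)) x₀)ᴴ *ᵥ J *ᵥ
      Function.leftLim (fundMatrix J r x₀ z) x₀ *ᵥ η = J *ᵥ η := by
    refine eq_of_forall_star_dotProduct fun η' => ?_
    rw [← star_mulVec_dotProduct, h.leftLim_fundMatrix_mulVec hz' h.mem,
      h.leftLim_fundMatrix_mulVec hz h.mem, leftSol_base_zero, leftSol_base_zero,
      h.fundMatrix_base hz, h.fundMatrix_base hz', Matrix.one_mulVec, Matrix.one_mulVec]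
  rw [← add_zero (z • _)] at hV
  -- For two homogeneous solutions the pairing does not change, and it is normalized at `x₀`.
  have key : ∀ c ∈ Ω, ∀ d ∈ Ω, c ≤ d → (Function.leftLim (fundMatrix J r x₀ (star z)) d)ᴴ *ᵥ J *ᵥ
      Function.leftLim (fundMatrix J r x₀ z) d *ᵥ η =
      (Function.leftLim (fundMatrix J r x₀ (star z)) c)ᴴ *ᵥ J *ᵥ
      Function.leftLim (fundMatrix J r x₀ z) c *ᵥ η := by
    intro c hc d hd hcd
    have h1 := h.pairing_sub hz hV h0 hc hd hcd
    have e : ∀ x, adjDensity J r x₀ z 0 x = 0 := fun x => by simp [adjDensity]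
    simp only [e, integral_zero, indicator_zero, add_zero] at h1
    rw [← h.leftLim_fundMatrix_mulVec hz hd, ← h.leftLim_fundMatrix_mulVec hz hc] at h1
    exact sub_eq_zero.1 h1
  rcases le_total x x₀ with hle | hle
  · rw [← key x hx x₀ h.mem hle, hb]
  · rw [key x₀ h.mem x hx hle, hb]

/-- The pairing of two homogeneous solutions does not jump. -/
theorem rightLim_symplectic {z : ℂ} (hz : z ∉ exceptionalSet J r) {x : ℝ} (hx : x ∈ Ω)
    (η : Fin n → ℂ) : (Function.rightLim (fundMatrix J r x₀ (star z)) x)ᴴ *ᵥ J *ᵥ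
      Function.rightLim (fundMatrix J r x₀ z) x *ᵥ η = J *ᵥ η := by
  have h1 := h.pairing_jump hz (u := fun x => fundMatrix J r x₀ z x *ᵥ η) (f := 0) hx
  rw [add_zero, ← h.leftLim_fundMatrix_mulVec hz hx, ← h.rightLim_fundMatrix_mulVec hz hx,
    h.leftLim_symplectic hz hx] at h1
  rw [h1]
  simp [adjDensity]

end IsBasePoint

end OrderZero

namespace OrderZero

variable {Ω : Opens ℝ} {n : ℕ} {q w : DistMatrix Ω n} {J : Matrix (Fin n) (Fin n) ℂ}
  {r : MeasureRep q w}

/-! ### Compactly supported solutions with a point source -/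

theorem adjDensity_eq_zero {x₀ : ℝ} {z : ℂ} {f : ℝ → Fin n → ℂ} {x : ℝ} (hx : f x = 0) :
    adjDensity J r x₀ z f x = 0 := by
  simp [adjDensity, hx]

theorem PointSolves.zero (x₀ : ℝ) : PointSolves J r x₀ 0 0 0 := by
  have := PointSolves.sum (J := J) (r := r) (x₀ := x₀) (∅ : Finset (Fin 0)) (u := fun _ => 0)
    (g := fun _ => 0) fun i => i.elim0
  simpa only [Finset.sum_empty] using this

/-- The triples `(Y, H, ζ)` where `Y` is a compactly supported solution of
`J Y' + q Y = w H - ζ δ`. -/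
noncomputable def IsBasePoint.boundaryData {x₀ : ℝ} (h : IsBasePoint J r x₀) :
    Submodule ℂ (r.FunL2 × r.FunL2 × EuclideanSpace ℂ (Fin n)) where
  carrier := {p | PointSolves J r x₀ p.1.fn p.2.1.fn (-WithLp.ofLp p.2.2) ∧
    ∃ c ∈ Ω, ∃ d ∈ Ω, c < x₀ ∧ x₀ < d ∧ ∀ x ∉ Ioo c d, p.1.fn x = 0 ∧ p.2.1.fn x = 0}
  add_mem' := by
    rintro p p' ⟨h, c, hc, d, hd, hcx, hxd, h0⟩ ⟨h', c', hc', d', hd', hcx', hxd', h0'⟩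
    refine ⟨?_, min c c', ?_, max d d', ?_, (min_le_left _ _).trans_lt hcx,
      hxd.trans_le (le_max_left _ _), fun x hx => ?_⟩
    · have := h.add h'
      rw [← neg_add] at this
      exact this
    · rcases min_choice c c' with e | e <;> rw [e] <;> assumption
    · rcases max_choice d d' with e | e <;> rw [e] <;> assumption
    · have h1 : x ∉ Ioo c d := fun hx' => hx ⟨(min_le_left _ _).trans_lt hx'.1,
        hx'.2.trans_le (le_max_left _ _)⟩
      have h2 : x ∉ Ioo c' d' := fun hx' => hx ⟨(min_le_right _ _).trans_lt hx'.1,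
        hx'.2.trans_le (le_max_right _ _)⟩
      have e1 : (p + p').1.fn x = p.1.fn x + p'.1.fn x := rfl
      have e2 : (p + p').2.1.fn x = p.2.1.fn x + p'.2.1.fn x := rfl
      rw [e1, e2, (h0 x h1).1, (h0 x h1).2, (h0' x h2).1, (h0' x h2).2]
      simp
  zero_mem' := by
    obtain ⟨c, hc, hcx, -⟩ := exists_lt_mem Ω h.mem
    obtain ⟨d, hd, hxd, -⟩ := exists_gt_mem Ω h.mem
    refine ⟨?_, c, hc, d, hd, hcx, hxd, fun x _ => ⟨rfl, rfl⟩⟩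
    have e : -WithLp.ofLp (0 : r.FunL2 × r.FunL2 × EuclideanSpace ℂ (Fin n)).2.2 = 0 := by simp
    rw [e]
    exact PointSolves.zero x₀
  smul_mem' := by
    rintro a p ⟨h, c, hc, d, hd, hcx, hxd, h0⟩
    refine ⟨?_, c, hc, d, hd, hcx, hxd, fun x hx => ?_⟩
    · have := h.smul a
      rw [smul_neg] at this
      exact this
    · have e1 : (a • p).1.fn x = a • p.1.fn x := rfl
      have e2 : (a • p).2.1.fn x = a • p.2.1.fn x := rfl
      rw [e1, e2, (h0 x hx).1, (h0 x hx).2]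
      simp

namespace IsBasePoint

variable {x₀ : ℝ} (h : IsBasePoint J r x₀)
include h

/-- As `J` is invertible, the symplectic identity makes the one-sided limit injective. The identity
concerns one-sided limits and not the balanced values. -/
theorem isUnit_leftLim {z : ℂ} (hz : z ∉ exceptionalSet J r) {x : ℝ} (hx : x ∈ Ω) :
    IsUnit (Function.leftLim (fundMatrix J r x₀ z) x) := by
  refine Matrix.mulVec_injective_iff_isUnit.1 fun η η' hη => ?_
  have h1 := h.leftLim_symplectic hz hx η
  rw [hη, h.leftLim_symplectic hz hx η'] at h1
  exact (Matrix.mulVec_injective_iff_isUnit.2 h.coeff.invertible h1).symm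

theorem isUnit_rightLim {z : ℂ} (hz : z ∉ exceptionalSet J r) {x : ℝ} (hx : x ∈ Ω) :
    IsUnit (Function.rightLim (fundMatrix J r x₀ z) x) := by
  refine Matrix.mulVec_injective_iff_isUnit.1 fun η η' hη => ?_
  have h1 := h.rightLim_symplectic hz hx η
  rw [hη, h.rightLim_symplectic hz hx η'] at h1
  exact (Matrix.mulVec_injective_iff_isUnit.2 h.coeff.invertible h1).symm

theorem conjTranspose_mulVec_injective {A : Matrix (Fin n) (Fin n) ℂ} (hA : IsUnit A) :
    Function.Injective fun v => Aᴴ *ᵥ J *ᵥ v := by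
  intro v v' hv
  have h1 : IsUnit Aᴴ := by
    rw [Matrix.isUnit_iff_isUnit_det, Matrix.det_conjTranspose]
    exact ((Matrix.isUnit_iff_isUnit_det _).1 hA).star
  exact Matrix.mulVec_injective_iff_isUnit.2 h.coeff.invertible
    (Matrix.mulVec_injective_iff_isUnit.2 h1 hv)

theorem leftLim_base {z : ℂ} (hz : z ∉ exceptionalSet J r) :
    Function.leftLim (fundMatrix J r x₀ z) x₀ = 1 := by
  refine Matrix.ext_of_mulVec_single fun k => ?_
  rw [h.leftLim_fundMatrix_mulVec hz h.mem, leftSol_base_zero, h.fundMatrix_base hz]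

theorem real_smul_adjDensity (z : ℂ) (f : ℝ → Fin n → ℂ) :
    r.μ.real {x₀} • adjDensity J r x₀ z f x₀ = 0 := by
  have h1 : (r.μ.real {x₀} : ℂ) • (r.wd x₀ *ᵥ f x₀) = 0 := by
    rw [← Matrix.smul_mulVec]
    exact (congrArg (· *ᵥ f x₀) h.jumpW_eq).trans (Matrix.zero_mulVec _)
  rw [← Complex.coe_smul, adjDensity, ← Matrix.mulVec_smul, h1, Matrix.mulVec_zero]

/-- For compactly supported `f` the equation with parameter `z` has a compactly supported solution
with a point source. -/
theorem exists_mem_boundaryData {z : ℂ} (hz : z ∉ exceptionalSet J r) (f : r.FunL2)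
    (hc : IsCompactlySupported Ω f.fn) : ∃ p ∈ h.boundaryData, p.2.1 = z • p.1 + f ∧
      p.2.2 = WithLp.toLp 2 ((∫ y in Ioi x₀, adjDensity J r x₀ z f.fn y ∂r.μ) +
        ∫ y in Iio x₀, adjDensity J r x₀ z f.fn y ∂r.μ) ∧
      p.1.fn x₀ = (1 / 2 : ℂ) • (J⁻¹ *ᵥ ((∫ y in Iio x₀, adjDensity J r x₀ z f.fn y ∂r.μ) -
        ∫ y in Ioi x₀, adjDensity J r x₀ z f.fn y ∂r.μ)) := by
  set a := adjDensity J r x₀ z f.fn with ha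
  set ζp := ∫ y in Ioi x₀, a y ∂r.μ with hζp
  set ζm := ∫ y in Iio x₀, a y ∂r.μ with hζm
  have hz' := h.star_notMem hz
  have hwf := f.memL2.locIntegrable h.conn
  have haL : LocIntegrable Ω r.μ a := h.locIntegrable_adjDensity hz' hwf
  obtain ⟨K, hKΩ, hK, hf0⟩ := hc
  obtain ⟨c, hc, d, hd, hcx, hxd, hKcd⟩ := exists_Ioo_of_isCompact hK hKΩ h.mem
  have hf0' : ∀ x ∉ Ioo c d, f.fn x = 0 := fun x hx => hf0 x fun hxK => hx (hKcd hxK)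
  have ha0 : ∀ x ∉ Ioo c d, a x = 0 := fun x hx => adjDensity_eq_zero (hf0' x hx)
  have hdet := (Matrix.isUnit_iff_isUnit_det _).1 h.coeff.invertible
  have hJJ : ∀ x : Fin n → ℂ, J *ᵥ (J⁻¹ *ᵥ x) = x := fun x => by
    rw [Matrix.mulVec_mulVec, Matrix.mul_nonsing_inv _ hdet, Matrix.one_mulVec]
  -- Value and source at `x₀` are chosen so that the pairing `k` of the left-hand values of `Y` and
  -- `U(·, z̄)` is `ζm` at `x₀`. To the left this is exactly what `f` accumulates, and to the right
  -- `ζm - (ζp + ζm) + ζp = 0`, so `k` vanishes beyond the support of `f` on both sides.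
  obtain ⟨Y, hY0, hY⟩ := exists_pointSolves h.coeff.invertible h.conn h.mem hz f.memL2.1 hwf
    (-(ζp + ζm)) ((1 / 2 : ℂ) • (J⁻¹ *ᵥ (ζm - ζp)))
  let k : ℝ → Fin n → ℂ := fun x => (Function.leftLim (fundMatrix J r x₀ (star z)) x)ᴴ *ᵥ J *ᵥ
    leftSol J r x₀ Y (z • Y + f.fn) (-(ζp + ζm)) x
  have hk0 : k x₀ = ζm := by
    simp only [k]
    rw [h.leftLim_base hz', Matrix.conjTranspose_one, Matrix.one_mulVec, leftSol_base, hY0,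
      ← smul_sub, ← Matrix.mulVec_sub, Matrix.mulVec_smul, hJJ]
    module
  have hkr : ∀ x ∈ Ω, d ≤ x → k x = 0 := by
    intro x hx hdx
    have hlt := hxd.trans_le hdx
    have h1 := h.pairing_sub hz hY hwf h.mem hx hlt.le
    have h2 : ∫ y in Ico x₀ x, a y ∂r.μ = ζp := by
      rw [haL.integral_Ico h.mem hx hlt, h.real_smul_adjDensity, zero_add, hζp]
      refine (setIntegral_eq_of_subset_of_forall_sdiff_eq_zero measurableSet_Ioi
        (fun y (hy : y ∈ Ioo x₀ x) => hy.1) fun y hy =>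
          ha0 y fun hy' => hy.2 ⟨hy.1, hy'.2.trans_le hdx⟩).symm
    have hmem : x₀ ∈ Ico x₀ x := ⟨le_rfl, hlt⟩
    rw [indicator_of_mem hmem] at h1
    have h3 : k x - k x₀ = (∫ y in Ico x₀ x, a y ∂r.μ) + -(ζp + ζm) := h1
    rw [h2, hk0, sub_eq_iff_eq_add] at h3
    rw [h3]
    abel
  have hkl : ∀ x ∈ Ω, x ≤ c → k x = 0 := by
    intro x hx hxc
    have hlt := hxc.trans_lt hcx
    have h1 := h.pairing_sub hz hY hwf hx h.mem hlt.le
    have h2 : ∫ y in Ico x x₀, a y ∂r.μ = ζm := by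
      refine (setIntegral_eq_of_subset_of_forall_sdiff_eq_zero measurableSet_Iio
        (fun y (hy : y ∈ Ico x x₀) => hy.2) fun y hy =>
          ha0 y fun hy' => hy.2 ⟨(hxc.trans_lt hy'.1).le, hy.1⟩).symm
    have hmem : x₀ ∉ Ico x x₀ := fun h' => lt_irrefl _ h'.2
    rw [indicator_of_notMem hmem, add_zero] at h1
    have h3 : k x₀ - k x = ∫ y in Ico x x₀, a y ∂r.μ := h1
    rw [h2, hk0] at h3
    exact sub_eq_self.1 h3
  -- A vanishing pairing means a vanishing left-hand value, because `U⁻(·, z̄)` and `J` are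
  -- invertible; off `Λ` and away from the support of `f` the balanced value then vanishes too.
  have hYv : ∀ x ∈ Ω, x ∉ Ioo c d → Y x = 0 := by
    intro x hx hxcd
    have hk : k x = 0 := by
      rcases le_or_gt d x with h1 | h1
      · exact hkr x hx h1
      · exact hkl x hx (not_lt.1 fun h2 => hxcd ⟨h2, h1⟩)
    refine h.eq_zero_of_leftSol hz hx (by rintro rfl; exact hxcd ⟨hcx, hxd⟩) (hf0' x hxcd) ?_
      (κ := -(ζp + ζm)) (f := f.fn)
    refine h.conjTranspose_mulVec_injective (h.isUnit_leftLim hz' hx) ?_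
    simp only [Matrix.mulVec_zero]
    exact hk
  -- The equation does not control `Y` outside `Ω`, where boundary data must also vanish.
  let Y' : ℝ → Fin n → ℂ := (Ioo c d).indicator Y
  have hYY : ∀ x ∈ Ω, Y x = Y' x := by
    intro x hx
    by_cases hxcd : x ∈ Ioo c d
    · exact (indicator_of_mem hxcd Y).symm
    · rw [hYv x hx hxcd]
      exact (indicator_of_notMem hxcd Y).symm
  obtain ⟨⟨B, hB⟩, -⟩ := bounded_aestronglyMeasurable (μ := r.μ) hY.locallyBoundedVariationOn
    h.conn hc hd
  have hYm : r.MemL2 Y' := by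
    refine MeasureRep.memL2_of_bounded (c := c) (d := d) (B := |B|) h.conn
      ((aestronglyMeasurable_of_locallyBoundedVariationOn h.conn h.mem
        hY.locallyBoundedVariationOn).indicator measurableSet_Ioo) (fun x => ?_) hc hd
      fun x hx => indicator_of_notMem (fun hx' => hx (Ioo_subset_Icc_self hx')) _
    by_cases hxcd : x ∈ Ioo c d
    · simp only [Y', indicator_of_mem hxcd]
      exact (hB x (Ioo_subset_Icc_self hxcd)).trans (le_abs_self _)
    · simp only [Y', indicator_of_notMem hxcd, norm_zero]
      exact abs_nonneg _
  let y : r.FunL2 := (⟨Y', hYm⟩ : r.funSubmodule)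
  have hyf : ∀ x, (z • y + f).fn x = z • Y' x + f.fn x := fun x => rfl
  refine ⟨(y, z • y + f, WithLp.toLp 2 (ζp + ζm)), ⟨?_, c, hc, d, hd, hcx,
    hxd, fun x hx => ?_⟩, rfl, rfl, ?_⟩
  · refine hY.congr_on h.conn hYY fun x hx => ?_
    rw [hyf, ← hYY x hx]
    rfl
  · have : y.fn x = 0 := indicator_of_notMem hx Y
    refine ⟨this, ?_⟩
    rw [hyf, hf0' x hx]
    change z • y.fn x + 0 = 0
    rw [this, smul_zero, add_zero]
  · rw [← hY0]
    exact (hYY x₀ h.mem).symm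

/-- Green's identity for boundary data. -/
theorem green_boundaryData {u g : ℝ → Fin n → ℂ} {κ : Fin n → ℂ} (hu : PointSolves J r x₀ u g κ)
    {p : r.FunL2 × r.FunL2 × EuclideanSpace ℂ (Fin n)} (hp : p ∈ h.boundaryData) :
    ∫ x, (r.dens u p.2.1.fn x - r.dens g p.1.fn x) ∂r.μ =
      star (u x₀) ⬝ᵥ WithLp.ofLp p.2.2 + star κ ⬝ᵥ p.1.fn x₀ := by
  obtain ⟨hv, c, hc, d, hd, hcx, hxd, h0⟩ := hp
  have h1 := h.green hu hv hc hd (hcx.trans hxd).le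
  have hl : ∀ x ∉ Ioo c d, leftSol J r x₀ p.1.fn p.2.1.fn (-WithLp.ofLp p.2.2) x = 0 := by
    intro x hx
    have hne : x ≠ x₀ := by rintro rfl; exact hx ⟨hcx, hxd⟩
    rw [leftSol_of_ne hne, (h0 x hx).1, (h0 x hx).2]
    simp
  have hmem : x₀ ∈ Ico c d := ⟨hcx.le, hxd⟩
  rw [hl c (by simp), hl d (by simp), indicator_of_mem hmem] at h1
  rw [← setIntegral_eq_integral_of_forall_compl_eq_zero (s := Ico c d) fun x hx => ?_]
  · simp only [Matrix.mulVec_zero, dotProduct_zero, sub_zero, dotProduct_neg] at h1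
    linear_combination -h1
  · have hx' : x ∉ Ioo c d := fun h' => hx (Ioo_subset_Ico_self h')
    simp [MeasureRep.dens, (h0 x hx').1, (h0 x hx').2]

end IsBasePoint

end OrderZero

namespace OrderZero

variable {Ω : Opens ℝ} {n : ℕ} {q w : DistMatrix Ω n} {J : Matrix (Fin n) (Fin n) ℂ}
  {r : MeasureRep q w}

/-! ### The boundary data of a self-adjoint relation -/

theorem inner_eq_star_dotProduct (x y : EuclideanSpace ℂ (Fin n)) :
    inner ℂ x y = star (WithLp.ofLp x) ⬝ᵥ WithLp.ofLp y := by
  rw [EuclideanSpace.inner_eq_star_dotProduct, dotProduct_comm]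

/-- The class map as a linear map. -/
noncomputable def MeasureRep.clsLinear (r : MeasureRep q w) : r.FunL2 →ₗ[ℂ] r.L2 :=
  (SeparationQuotient.mkCLM ℂ r.FunL2).toLinearMap

theorem MeasureRep.clsLinear_apply (f : r.FunL2) : r.clsLinear f = cls f := rfl

/-- Evaluation at a point as a linear map. -/
noncomputable def MeasureRep.evalLinear (r : MeasureRep q w) (x : ℝ) :
    r.FunL2 →ₗ[ℂ] EuclideanSpace ℂ (Fin n) where
  toFun f := WithLp.toLp 2 (f.fn x)
  map_add' _ _ := rfl
  map_smul' _ _ := rfl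

theorem MeasureRep.inner_cls_sub_inner_cls (u g v k : r.FunL2) :
    inner ℂ (cls u) (cls k) - inner ℂ (cls g) (cls v) =
      ∫ x, (r.dens u.fn k.fn x - r.dens g.fn v.fn x) ∂r.μ :=
  (integral_sub (u.memL2.integrable_dens r k.memL2) (g.memL2.integrable_dens r v.memL2)).symm

theorem MeasureRep.dens_eq_zero_of_left {u f : ℝ → Fin n → ℂ} {x : ℝ} (h : r.wd x *ᵥ u x = 0) :
    r.dens u f x = 0 := by
  rw [← r.dens_star, MeasureRep.dens, h, dotProduct_zero, star_zero]

namespace IsBasePoint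

variable {x₀ : ℝ} (h : IsBasePoint J r x₀)
include h

theorem mem_solutionsOfNormZero {u : ℝ → Fin n → ℂ} : u ∈ solutionsOfNormZero J r ↔
    PointSolves J r x₀ u 0 0 ∧ ∀ᵐ x ∂r.μ, r.wd x *ᵥ u x = 0 :=
  and_congr_left fun _ => h.isSolution_iff fun c _ d _ => by simp

/-- The solutions of norm zero form a vector space, so the span in the definition adds nothing. -/
theorem mem_nullValues {v : EuclideanSpace ℂ (Fin n)} : v ∈ nullValues J r x₀ ↔
    ∃ u ∈ solutionsOfNormZero J r, v = WithLp.toLp 2 (u x₀) := by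
  refine ⟨fun hv => ?_, fun hv => Submodule.subset_span hv⟩
  induction hv using Submodule.span_induction with
  | mem v hv => exact hv
  | zero =>
    exact ⟨0, h.mem_solutionsOfNormZero.2 ⟨PointSolves.zero x₀, ae_of_all _ fun x => by simp⟩, rfl⟩
  | add v v' _ _ hv hv' =>
    obtain ⟨u, hu, rfl⟩ := hv
    obtain ⟨u', hu', rfl⟩ := hv'
    rw [h.mem_solutionsOfNormZero] at hu hu'
    refine ⟨u + u', h.mem_solutionsOfNormZero.2 ⟨?_, ?_⟩, rfl⟩
    · simpa using hu.1.add hu'.1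
    · filter_upwards [hu.2, hu'.2] with x h1 h2
      rw [Pi.add_apply, Matrix.mulVec_add, h1, h2, add_zero]
  | smul a v _ hv =>
    obtain ⟨u, hu, rfl⟩ := hv
    rw [h.mem_solutionsOfNormZero] at hu
    refine ⟨a • u, h.mem_solutionsOfNormZero.2 ⟨?_, ?_⟩, rfl⟩
    · simpa using hu.1.smul a
    · filter_upwards [hu.2] with x h1
      rw [Pi.smul_apply, Matrix.mulVec_smul, h1, smul_zero]

theorem memL2_of_mem_solutionsOfNormZero {u : ℝ → Fin n → ℂ} (hu : u ∈ solutionsOfNormZero J r) :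
    r.MemL2 u := by
  rw [h.mem_solutionsOfNormZero] at hu
  refine ⟨aestronglyMeasurable_of_locallyBoundedVariationOn h.conn h.mem
    hu.1.locallyBoundedVariationOn, (integrable_zero ℝ ℂ r.μ).congr ?_⟩
  filter_upwards [hu.2] with x hx
  exact (MeasureRep.dens_eq_zero_of_left hx).symm

/-- Any representative can be corrected by the solution of norm zero whose value at `x₀` is the
projection onto `N_0` of its own value; this changes neither its class nor the right-hand side. -/
theorem evalMap_spec {p : r.L2 × r.L2} (hp : p ∈ maximalRelation J r) :
    ∃ u f : r.FunL2, u.fn = evalMap J r x₀ p ∧ PointSolves J r x₀ u.fn f.fn 0 ∧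
      MeasureRep.cls u = p.1 ∧ MeasureRep.cls f = p.2 ∧
      WithLp.toLp 2 (u.fn x₀) ∈ (nullValues J r x₀)ᗮ := by
  have hex : ∃ v : ℝ → Fin n → ℂ, ∃ u f : r.FunL2, u.fn = v ∧ IsSolution J r u.fn f.fn ∧
      MeasureRep.cls u = p.1 ∧ MeasureRep.cls f = p.2 ∧
      WithLp.toLp 2 (u.fn x₀) ∈ (nullValues J r x₀)ᗮ := by
    obtain ⟨u, f, hs, hu, hf⟩ := hp
    have hwf := f.memL2.locIntegrable h.conn
    obtain ⟨k, hk, hkv⟩ := h.mem_nullValues.1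
      ((nullValues J r x₀).starProjection_apply_mem (WithLp.toLp 2 (u.fn x₀)))
    let k' : r.FunL2 := (⟨k, h.memL2_of_mem_solutionsOfNormZero hk⟩ : r.funSubmodule)
    rw [h.mem_solutionsOfNormZero] at hk
    refine ⟨_, u + (-1 : ℂ) • k', f, rfl, (h.isSolution_iff hwf).2 ?_, ?_, hf, ?_⟩
    · have := ((h.isSolution_iff hwf).1 hs).add (hk.1.smul (-1))
      rw [smul_zero, smul_zero, add_zero, add_zero] at this
      exact this
    · rw [← hu]
      refine MeasureRep.cls_eq_of_ae ?_
      filter_upwards [hk.2] with x hx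
      have e : (u + (-1 : ℂ) • k').fn x = u.fn x + (-1 : ℂ) • k x := rfl
      rw [e, Matrix.mulVec_add, Matrix.mulVec_smul, hx, smul_zero, add_zero]
    · have e : WithLp.toLp 2 ((u + (-1 : ℂ) • k').fn x₀) = WithLp.toLp 2 (u.fn x₀) -
          (nullValues J r x₀).starProjection (WithLp.toLp 2 (u.fn x₀)) := by
        have e1 : (u + (-1 : ℂ) • k').fn x₀ = u.fn x₀ + (-1 : ℂ) • k x₀ := rfl
        rw [hkv, ← WithLp.toLp_sub, e1]
        congr 1
        module
      rw [e]
      exact Submodule.sub_starProjection_mem_orthogonal _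
  obtain ⟨u, f, h1, h2, h3⟩ := hex.choose_spec
  refine ⟨u, f, ?_, (h.isSolution_iff (f.memL2.locIntegrable h.conn)).1 h2, h3⟩
  rw [evalMap, dif_pos hex, h1]

theorem integrable_adjDensity {z : ℂ} (hz : z ∉ exceptionalSet J r) (f : r.FunL2)
    (hc : IsCompactlySupported Ω f.fn) : Integrable (adjDensity J r x₀ z f.fn) r.μ := by
  obtain ⟨K, hKΩ, hK, hf0⟩ := hc
  obtain ⟨c, hc, d, hd, -, -, hKcd⟩ := exists_Ioo_of_isCompact hK hKΩ h.mem
  have h1 := h.locIntegrable_adjDensity (h.star_notMem hz) (f.memL2.locIntegrable h.conn) c hc d hd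
  refine (integrableOn_iff_integrable_of_support_subset fun x hx => ?_).1 h1
  by_contra hxcd
  exact hx (adjDensity_eq_zero (hf0 x fun hxK => hxcd (Ioo_subset_Icc_self (hKcd hxK))))

theorem integral_adjDensity {z : ℂ} (hz : z ∉ exceptionalSet J r) (f : r.FunL2)
    (hc : IsCompactlySupported Ω f.fn) : ∫ y, adjDensity J r x₀ z f.fn y ∂r.μ =
      (∫ y in Ioi x₀, adjDensity J r x₀ z f.fn y ∂r.μ) +
        ∫ y in Iio x₀, adjDensity J r x₀ z f.fn y ∂r.μ := by
  have hi := h.integrable_adjDensity hz f hc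
  rw [← integral_add_compl measurableSet_Ioi hi, compl_Ioi, ← Iio_union_right,
    setIntegral_union (by simp) (measurableSet_singleton _) hi.integrableOn hi.integrableOn,
    integral_singleton, h.real_smul_adjDensity, add_zero]

/-- Let `u = U(·, z̄) η`. Testing with the truncation of `u` to a compact interval shows that the
integral of `u^* w u` over it is zero. So `w u = 0` almost everywhere by positivity. -/
theorem mem_nullValues_of_forall {z : ℂ} (hz : z ∉ exceptionalSet J r) {η : Fin n → ℂ}
    (hη : ∀ f : r.FunL2, IsCompactlySupported Ω f.fn →
      star η ⬝ᵥ ∫ y, adjDensity J r x₀ z f.fn y ∂r.μ = 0) :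
    WithLp.toLp 2 η ∈ nullValues J r x₀ := by
  have hz' := h.star_notMem hz
  set u : ℝ → Fin n → ℂ := fun x => fundMatrix J r x₀ (star z) x *ᵥ η with hu
  have hus := h.pointSolves_fundMatrix hz' η
  have hum := aestronglyMeasurable_of_locallyBoundedVariationOn (r := r) h.conn h.mem
    hus.locallyBoundedVariationOn
  have key : ∀ c ∈ Ω, ∀ d ∈ Ω, ∀ᵐ x ∂(r.μ.restrict (Icc c d)), r.wd x *ᵥ u x = 0 := by
    intro c hc d hd
    obtain ⟨⟨B, hB⟩, -⟩ := bounded_aestronglyMeasurable (μ := r.μ) hus.locallyBoundedVariationOn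
      h.conn hc hd
    have hm : r.MemL2 ((Icc c d).indicator u) := by
      refine MeasureRep.memL2_of_bounded (c := c) (d := d) (B := |B|) h.conn
        (hum.indicator measurableSet_Icc) (fun x => ?_) hc hd
        fun x hx => indicator_of_notMem hx _
      by_cases hx : x ∈ Icc c d
      · rw [indicator_of_mem hx]
        exact (hB x hx).trans (le_abs_self _)
      · rw [indicator_of_notMem hx, norm_zero]
        exact abs_nonneg _
    let f : r.FunL2 := (⟨_, hm⟩ : r.funSubmodule)
    have hfc : IsCompactlySupported Ω f.fn :=
      ⟨Icc c d, h.conn.out hc hd, isCompact_Icc, fun x hx => indicator_of_notMem hx u⟩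
    have hfa : ∀ x, star η ⬝ᵥ adjDensity J r x₀ z f.fn x = (Icc c d).indicator (r.dens u u) x := by
      intro x
      rw [star_dotProduct_adjDensity]
      by_cases hx : x ∈ Icc c d
      · have e : f.fn x = u x := indicator_of_mem hx u
        rw [indicator_of_mem hx, MeasureRep.dens, e, MeasureRep.dens]
      · have e : f.fn x = 0 := indicator_of_notMem hx u
        rw [indicator_of_notMem hx, MeasureRep.dens, e, Matrix.mulVec_zero, dotProduct_zero]
    have h1 := hη f hfc
    have hi := h.integrable_adjDensity hz f hfc
    rw [← setIntegral_univ, star_dotProduct_integral hi.integrableOn, setIntegral_univ] at h1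
    simp only [hfa] at h1
    rw [integral_indicator measurableSet_Icc] at h1
    refine MeasureRep.ae_wd_mulVec_eq_zero ?_ h1
    refine (integrable_indicator_iff measurableSet_Icc).1 (hm.2.congr (ae_of_all _ fun x => ?_))
    by_cases hx : x ∈ Icc c d
    · simp only [MeasureRep.dens, indicator_of_mem hx]
    · simp only [MeasureRep.dens, indicator_of_notMem hx, Matrix.mulVec_zero, dotProduct_zero]
  have hae : ∀ᵐ x ∂r.μ, r.wd x *ᵥ u x = 0 := by
    obtain ⟨K, hK, hKΩ, hU⟩ := exists_exhaustion Ω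
    have h2 : r.μ.restrict (Ω : Set ℝ) = r.μ :=
      Measure.restrict_eq_self_of_ae_mem (mem_ae_iff.2 r.radon.compl_eq_zero)
    rw [← h2, ← hU, ae_restrict_iUnion_iff]
    intro k
    obtain ⟨c, hc, d, hd, -, -, hsub⟩ := exists_Ioo_of_isCompact (hK k) (hKΩ k) h.mem
    exact ae_restrict_of_ae_restrict_of_subset (hsub.trans Ioo_subset_Icc_self) (key c hc d hd)
  -- Since `w u = 0`, the parameter drops out and `u` solves the equation with right-hand side zero.
  refine h.mem_nullValues.2 ⟨u, h.mem_solutionsOfNormZero.2 ⟨hus.congr ?_, hae⟩, ?_⟩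
  · filter_upwards [hae] with x hx
    rw [Pi.smul_apply, Matrix.mulVec_smul, hx, smul_zero, Pi.zero_apply, Matrix.mulVec_zero]
  · simp only [hu, h.fundMatrix_base hz', Matrix.one_mulVec]

/-- The boundary terms of the boundary data. -/
noncomputable def boundaryTerm : h.boundaryData →ₗ[ℂ] EuclideanSpace ℂ (Fin n) :=
  LinearMap.snd ℂ _ _ ∘ₗ LinearMap.snd ℂ _ _ ∘ₗ h.boundaryData.subtype

/-- The classes of the solutions among the boundary data. -/
noncomputable def boundarySolution : h.boundaryData →ₗ[ℂ] r.L2 :=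
  r.clsLinear ∘ₗ LinearMap.fst ℂ _ _ ∘ₗ h.boundaryData.subtype

/-- The classes of the inhomogeneities among the boundary data. -/
noncomputable def boundaryRhs : h.boundaryData →ₗ[ℂ] r.L2 :=
  r.clsLinear ∘ₗ LinearMap.fst ℂ _ _ ∘ₗ LinearMap.snd ℂ _ _ ∘ₗ h.boundaryData.subtype

/-- The values at the base point of the solutions among the boundary data. -/
noncomputable def boundaryValue : h.boundaryData →ₗ[ℂ] EuclideanSpace ℂ (Fin n) :=
  r.evalLinear x₀ ∘ₗ LinearMap.fst ℂ _ _ ∘ₗ h.boundaryData.subtype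

theorem inner_sub_inner_boundary (d d' : h.boundaryData) :
    inner ℂ (h.boundarySolution d) (h.boundaryRhs d') -
      inner ℂ (h.boundaryRhs d) (h.boundarySolution d') =
      inner ℂ (h.boundaryValue d) (h.boundaryTerm d') -
        inner ℂ (h.boundaryTerm d) (h.boundaryValue d') := by
  rw [inner_eq_star_dotProduct, inner_eq_star_dotProduct]
  have h1 := (MeasureRep.inner_cls_sub_inner_cls d.1.1 d.1.2.1 d'.1.1 d'.1.2.1).trans
    (h.green_boundaryData d.2.1 d'.2)
  rw [star_neg, neg_dotProduct, ← sub_eq_add_neg] at h1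
  exact h1

theorem inner_sub_inner_evalMap {p : r.L2 × r.L2} (hp : p ∈ maximalRelation J r)
    (d : h.boundaryData) :
    inner ℂ p.1 (h.boundaryRhs d) - inner ℂ p.2 (h.boundarySolution d) =
      inner ℂ (WithLp.toLp 2 (evalMap J r x₀ p x₀)) (h.boundaryTerm d) := by
  obtain ⟨u, f, hu, hs, h1, h2, -⟩ := h.evalMap_spec hp
  rw [← hu, ← h1, ← h2, inner_eq_star_dotProduct]
  have h3 := (MeasureRep.inner_cls_sub_inner_cls u f d.1.1 d.1.2.1).trans
    (h.green_boundaryData hs d.2)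
  rw [star_zero, zero_dotProduct, add_zero] at h3
  exact h3

/-- Green's identity against solutions of norm zero gives one inclusion. For the other, a vector
orthogonal to the range is orthogonal to all integrals of `U(·, 0)^* w f`, because these occur as
boundary terms. Having the fundamental matrix at a single parameter is enough, and `0` is available.
-/
theorem range_boundaryTerm (h0 : (0 : ℂ) ∉ exceptionalSet J r) :
    LinearMap.range h.boundaryTerm = (nullValues J r x₀)ᗮ := by
  apply le_antisymm
  · rintro _ ⟨d, rfl⟩
    rw [Submodule.mem_orthogonal]
    intro v hv
    obtain ⟨k, hk, rfl⟩ := h.mem_nullValues.1 hv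
    rw [h.mem_solutionsOfNormZero] at hk
    have h1 := h.green_boundaryData hk.1 d.2
    rw [star_zero, zero_dotProduct, add_zero] at h1
    rw [inner_eq_star_dotProduct]
    refine h1.symm.trans (integral_eq_zero_of_ae ?_)
    filter_upwards [hk.2] with x hx
    rw [MeasureRep.dens_eq_zero_of_left hx, MeasureRep.dens, Pi.zero_apply, star_zero,
      zero_dotProduct, sub_zero, Pi.zero_apply]
  · rw [← Submodule.orthogonal_orthogonal (LinearMap.range h.boundaryTerm)]
    refine Submodule.orthogonal_le fun η hη => ?_
    refine h.mem_nullValues_of_forall h0 (η := WithLp.ofLp η) fun f hf => ?_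
    obtain ⟨p, hp, -, h1, -⟩ := h.exists_mem_boundaryData h0 f hf
    have h2 := (Submodule.mem_orthogonal' _ _).1 hη p.2.2 ⟨⟨p, hp⟩, rfl⟩
    rw [inner_eq_star_dotProduct, h1, ← h.integral_adjDensity h0 f hf] at h2
    exact h2

end IsBasePoint

end OrderZero

namespace OrderZero

variable {Ω : Opens ℝ} {n : ℕ} {q w : DistMatrix Ω n} {J : Matrix (Fin n) (Fin n) ℂ}
  {r : MeasureRep q w}

/-! ### Green's function -/

theorem integral_const_mulVec {μ : Measure ℝ} (A : Matrix (Fin n) (Fin n) ℂ) {F : ℝ → Fin n → ℂ}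
    (hF : Integrable F μ) : ∫ y, A *ᵥ F y ∂μ = A *ᵥ ∫ y, F y ∂μ :=
  (LinearMap.toContinuousLinearMap A.mulVecLin).integral_comp_comm hF

theorem integrable_const_mulVec {μ : Measure ℝ} (A : Matrix (Fin n) (Fin n) ℂ)
    {F : ℝ → Fin n → ℂ} (hF : Integrable F μ) : Integrable (fun y => A *ᵥ F y) μ :=
  (LinearMap.toContinuousLinearMap A.mulVecLin).integrable_comp hF

theorem MeasureRep.MemL2.indicator {f : ℝ → Fin n → ℂ} (hf : r.MemL2 f) {s : Set ℝ}
    (hs : MeasurableSet s) : r.MemL2 (s.indicator f) := by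
  refine ⟨hf.1.indicator hs, (hf.2.indicator hs).congr (ae_of_all _ fun x => ?_)⟩
  by_cases hx : x ∈ s
  · simp only [MeasureRep.dens, indicator_of_mem hx]
  · simp only [MeasureRep.dens, indicator_of_notMem hx, Matrix.mulVec_zero, dotProduct_zero]

namespace IsBasePoint

variable {x₀ : ℝ} (h : IsBasePoint J r x₀)
include h

theorem inv_mulVec_mulVec (x : Fin n → ℂ) : J⁻¹ *ᵥ (J *ᵥ x) = x := by
  rw [Matrix.mulVec_mulVec, Matrix.nonsing_inv_mul _
    ((Matrix.isUnit_iff_isUnit_det _).1 h.coeff.invertible), Matrix.one_mulVec]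

theorem mulVec_inv_mulVec (x : Fin n → ℂ) : J *ᵥ (J⁻¹ *ᵥ x) = x := by
  rw [Matrix.mulVec_mulVec, Matrix.mul_nonsing_inv _
    ((Matrix.isUnit_iff_isUnit_det _).1 h.coeff.invertible), Matrix.one_mulVec]

/-- A balanced value `U(x) η = 0` at `x ≠ x₀` forces the left-hand value to vanish as well, since
the jump there is a multiple of the balanced value; and `U⁻` is invertible. -/
theorem isUnit_fundMatrix {z : ℂ} (hz : z ∉ exceptionalSet J r) {x : ℝ} (hx : x ∈ Ω) :
    IsUnit (fundMatrix J r x₀ z x) := by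
  rcases eq_or_ne x x₀ with rfl | hne
  · rw [h.fundMatrix_base hz]
    exact isUnit_one
  · refine Matrix.mulVec_injective_iff_isUnit.1 fun η η' hη => ?_
    have h1 : fundMatrix J r x₀ z x *ᵥ (η - η') = 0 := by
      rw [Matrix.mulVec_sub]
      exact sub_eq_zero.2 hη
    have h2 := h.leftLim_fundMatrix_mulVec hz hx (η - η')
    rw [leftSol_of_ne hne, Pi.smul_apply, h1, smul_zero, Matrix.mulVec_zero, Matrix.mulVec_zero,
      sub_zero, Matrix.mulVec_zero, smul_zero, smul_zero, sub_zero] at h2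
    exact sub_eq_zero.1 (Matrix.mulVec_injective_iff_isUnit.2 (h.isUnit_leftLim hz hx)
      (h2.trans (Matrix.mulVec_zero _).symm))

/-- A solution in terms of its value at the base point and the inhomogeneity. -/
theorem eq_fundMatrix_mulVec {z : ℂ} (hz : z ∉ exceptionalSet J r) {u : ℝ → Fin n → ℂ}
    {f : r.FunL2} (hc : IsCompactlySupported Ω f.fn)
    (hu : PointSolves J r x₀ u (z • u + f.fn) 0) {x : ℝ} (hx : x ∈ Ω) :
    u x = fundMatrix J r x₀ z x *ᵥ (u x₀ +
      (1 / 2 : ℂ) • (J⁻¹ *ᵥ ((∫ y in Ioi x₀, adjDensity J r x₀ z f.fn y ∂r.μ) -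
        ∫ y in Iio x₀, adjDensity J r x₀ z f.fn y ∂r.μ)) -
      (1 / 2 : ℂ) • (J⁻¹ *ᵥ ((∫ y in Ioi x, adjDensity J r x₀ z f.fn y ∂r.μ) -
        ∫ y in Iio x, adjDensity J r x₀ z f.fn y ∂r.μ)) +
      jumpTerm J r x₀ z x *ᵥ ((r.μ.real {x} : ℂ) • adjDensity J r x₀ z f.fn x)) := by
  have hz' := h.star_notMem hz
  have hwf := f.memL2.locIntegrable h.conn
  have hi := h.integrable_adjDensity hz f hc
  have hint := h.integral_adjDensity hz f hc
  set a := adjDensity J r x₀ z f.fn with ha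
  set U := fundMatrix J r x₀ z with hU
  have hsplit : ∀ {c d : ℝ}, c ≤ d →
      (∫ y in Iio d, a y ∂r.μ) - ∫ y in Iio c, a y ∂r.μ = ∫ y in Ico c d, a y ∂r.μ := by
    intro c d hcd
    have hdis : Disjoint (Iio c) (Ico c d) := disjoint_left.2 fun y h1 h2 => not_le.2 h1 h2.1
    rw [← Iio_union_Ico_eq_Iio hcd, setIntegral_union hdis measurableSet_Ico hi.integrableOn
      hi.integrableOn, add_sub_cancel_left]
  have hind : ∀ s : Set ℝ, s.indicator (fun _ => (0 : Fin n → ℂ)) x₀ = 0 := fun s => by simp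
  set l := leftSol J r x₀ u (z • u + f.fn) 0 x with hl
  set ρ := rightSol J r x₀ u (z • u + f.fn) 0 x with hρ
  set m : Fin n → ℂ := (r.μ.real {x} : ℂ) • a x with hm
  -- The pairing of the left-hand values at `x`. On the right-hand side it becomes `k + m`, with `m`
  -- the atom of `U(·, z̄)^* w f` at `x`.
  set k : Fin n → ℂ := J *ᵥ u x₀ + ((∫ y in Iio x, a y ∂r.μ) - ∫ y in Iio x₀, a y ∂r.μ) with hk
  have hbase : (Function.leftLim (fundMatrix J r x₀ (star z)) x₀)ᴴ *ᵥ J *ᵥ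
      leftSol J r x₀ u (z • u + f.fn) 0 x₀ = J *ᵥ u x₀ := by
    rw [h.leftLim_base hz', Matrix.conjTranspose_one, Matrix.one_mulVec, leftSol_base_zero]
  have hkl : (Function.leftLim (fundMatrix J r x₀ (star z)) x)ᴴ *ᵥ J *ᵥ l = k := by
    rcases le_total x₀ x with hle | hle
    · have h1 := h.pairing_sub hz hu hwf h.mem hx hle
      rw [hbase, ← hsplit hle, hind, add_zero, sub_eq_iff_eq_add] at h1
      rw [hl, h1, hk, add_comm]
    · have h1 := h.pairing_sub hz hu hwf hx h.mem hle
      rw [hbase, ← hsplit hle, hind, add_zero, sub_eq_iff_eq_add'] at h1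
      rw [hk, h1]
      abel_nf
      rfl
  have hkr : (Function.rightLim (fundMatrix J r x₀ (star z)) x)ᴴ *ᵥ J *ᵥ ρ = k + m := by
    rw [← hkl]
    exact h.pairing_jump hz hx
  have hl' : l = Function.leftLim U x *ᵥ (J⁻¹ *ᵥ k) := by
    refine h.conjTranspose_mulVec_injective (h.isUnit_leftLim hz' hx) ?_
    simp only
    rw [h.leftLim_symplectic hz hx, h.mulVec_inv_mulVec, hkl]
  have hρ' : ρ = Function.rightLim U x *ᵥ (J⁻¹ *ᵥ (k + m)) := by
    refine h.conjTranspose_mulVec_injective (h.isUnit_rightLim hz' hx) ?_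
    simp only
    rw [h.rightLim_symplectic hz hx, h.mulVec_inv_mulVec, hkr]
  -- The mean of `U⁻ J⁻¹ k` and `U⁺ J⁻¹ (k + m)` differs from `U J⁻¹ (k + m / 2)` by one quarter of
  -- `(U⁺ - U⁻) J⁻¹ m`. This is what the matrix `S` supplies.
  have hS : ∀ v, U x *ᵥ (jumpTerm J r x₀ z x *ᵥ v) = (1 / 4 : ℂ) •
      (Function.rightLim U x *ᵥ (J⁻¹ *ᵥ v) - Function.leftLim U x *ᵥ (J⁻¹ *ᵥ v)) := by
    intro v
    have hdet := (Matrix.isUnit_iff_isUnit_det _).1 (h.isUnit_fundMatrix hz hx)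
    rw [jumpTerm, Matrix.smul_mulVec, Matrix.mulVec_smul, Matrix.mul_assoc, Matrix.mulVec_mulVec,
      ← Matrix.mul_assoc, Matrix.mul_nonsing_inv _ hdet, Matrix.one_mul, ← Matrix.mulVec_mulVec,
      Matrix.sub_mulVec]
  have hUx : ∀ v, U x *ᵥ v =
      (1 / 2 : ℂ) • (Function.leftLim U x *ᵥ v + Function.rightLim U x *ᵥ v) := by
    intro v
    conv_lhs => rw [hU, h.fundMatrix_eq_half hz hx, Matrix.smul_mulVec, Matrix.add_mulVec]
  have htot : (∫ y in Iio x, a y ∂r.μ) + m + ∫ y in Ioi x, a y ∂r.μ =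
      (∫ y in Ioi x₀, a y ∂r.μ) + ∫ y in Iio x₀, a y ∂r.μ := by
    rw [← hint, ← integral_add_compl measurableSet_Iic hi, compl_Iic, ← Iio_union_right,
      setIntegral_union (by simp) (measurableSet_singleton _) hi.integrableOn hi.integrableOn,
      integral_singleton, hm, Complex.coe_smul]
  have hv : u x₀ + (1 / 2 : ℂ) • (J⁻¹ *ᵥ ((∫ y in Ioi x₀, a y ∂r.μ) - ∫ y in Iio x₀, a y ∂r.μ)) -
      (1 / 2 : ℂ) • (J⁻¹ *ᵥ ((∫ y in Ioi x, a y ∂r.μ) - ∫ y in Iio x, a y ∂r.μ)) =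
        J⁻¹ *ᵥ k + (1 / 2 : ℂ) • (J⁻¹ *ᵥ m) := by
    have e : (∫ y in Ioi x₀, a y ∂r.μ) = (∫ y in Iio x, a y ∂r.μ) + m + (∫ y in Ioi x, a y ∂r.μ) -
        ∫ y in Iio x₀, a y ∂r.μ := by rw [htot]; abel
    rw [e, hk, Matrix.mulVec_add J⁻¹ (J *ᵥ u x₀), h.inv_mulVec_mulVec]
    simp only [Matrix.mulVec_add, Matrix.mulVec_sub]
    module
  clear_value k m l ρ
  rw [hv, Matrix.mulVec_add, hS, hUx, eq_half_leftSol_add_rightSol x₀ u (z • u + f.fn) 0 x, ← hl,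
    ← hρ, hl', hρ', Matrix.mulVec_add J⁻¹]
  simp only [Matrix.mulVec_add, Matrix.mulVec_smul]
  module

/-- The integral with Green's kernel. -/
theorem integral_kernelH {z : ℂ} (hz : z ∉ exceptionalSet J r) {f : r.FunL2}
    (hc : IsCompactlySupported Ω f.fn) (Mm Mp : Matrix (Fin n) (Fin n) ℂ) (x : ℝ) :
    ∫ y, (fundMatrix J r x₀ z x * kernelH J r x₀ z Mm Mp x y) *ᵥ adjDensity J r x₀ z f.fn y ∂r.μ =
    fundMatrix J r x₀ z x *ᵥ (Mm *ᵥ (∫ y in Iio x₀, adjDensity J r x₀ z f.fn y ∂r.μ) +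
      Mp *ᵥ (∫ y in Ioi x₀, adjDensity J r x₀ z f.fn y ∂r.μ) -
      (1 / 2 : ℂ) • (J⁻¹ *ᵥ ((∫ y in Ioi x, adjDensity J r x₀ z f.fn y ∂r.μ) -
        ∫ y in Iio x, adjDensity J r x₀ z f.fn y ∂r.μ)) +
      jumpTerm J r x₀ z x *ᵥ ((r.μ.real {x} : ℂ) • adjDensity J r x₀ z f.fn x)) := by
  have hi := h.integrable_adjDensity hz f hc
  have hatom := h.real_smul_adjDensity z f.fn
  set a := adjDensity J r x₀ z f.fn with ha
  -- The point `x₀` contributes nothing to the integral, so the value one half of the balanced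
  -- characteristic functions there is immaterial.
  have hne : ∀ᵐ y ∂r.μ, y ≠ x₀ ∨ a y = 0 := by
    rcases smul_eq_zero.1 hatom with h1 | h1
    · have h2 : r.μ {x₀} = 0 := by
        rcases (ENNReal.toReal_eq_zero_iff _).1 h1 with h2 | h2
        · exact h2
        · exact absurd h2 (r.measure_singleton_ne_top h.mem)
      filter_upwards [measure_eq_zero_iff_ae_notMem.1 h2] with y hy
      exact Or.inl hy
    · refine ae_of_all _ fun y => ?_
      rcases eq_or_ne y x₀ with rfl | hy
      · exact Or.inr h1
      · exact Or.inl hy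
  have i1 := integrable_const_mulVec Mm (hi.indicator (measurableSet_Iio (a := x₀)))
  have i2 := integrable_const_mulVec Mp (hi.indicator (measurableSet_Ioi (a := x₀)))
  have i3' : Integrable (fun y => (Ioi x).indicator a y - (Iio x).indicator a y) r.μ :=
    (hi.indicator measurableSet_Ioi).sub (hi.indicator measurableSet_Iio)
  have i3 := integrable_const_mulVec ((1 / 2 : ℂ) • J⁻¹) i3'
  have i4 := integrable_const_mulVec (jumpTerm J r x₀ z x)
    (hi.indicator (measurableSet_singleton x))
  have i12 : Integrable (fun y => Mm *ᵥ (Iio x₀).indicator a y +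
      Mp *ᵥ (Ioi x₀).indicator a y) r.μ := i1.add i2
  have i123 : Integrable (fun y => Mm *ᵥ (Iio x₀).indicator a y + Mp *ᵥ (Ioi x₀).indicator a y -
      ((1 / 2 : ℂ) • J⁻¹) *ᵥ ((Ioi x).indicator a y - (Iio x).indicator a y)) r.μ := i12.sub i3
  have hpt : ∀ᵐ y ∂r.μ, kernelH J r x₀ z Mm Mp x y *ᵥ a y =
      Mm *ᵥ (Iio x₀).indicator a y + Mp *ᵥ (Ioi x₀).indicator a y -
        ((1 / 2 : ℂ) • J⁻¹) *ᵥ ((Ioi x).indicator a y - (Iio x).indicator a y) +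
        jumpTerm J r x₀ z x *ᵥ ({x} : Set ℝ).indicator a y := by
    filter_upwards [hne] with y hy
    have e1 : (charLeft x₀ y • Mm) *ᵥ a y = Mm *ᵥ (Iio x₀).indicator a y := by
      rcases lt_trichotomy y x₀ with h1 | h1 | h1
      · rw [indicator_of_mem (mem_Iio.2 h1), charLeft, if_pos h1, one_smul]
      · rw [hy.resolve_left (not_not.2 h1), indicator_of_notMem (by simp [h1])]
        simp
      · rw [indicator_of_notMem (by simp [h1.le]), charLeft, if_neg h1.not_gt, if_neg h1.ne']
        simp
    have e2 : (charRight x₀ y • Mp) *ᵥ a y = Mp *ᵥ (Ioi x₀).indicator a y := by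
      rcases lt_trichotomy y x₀ with h1 | h1 | h1
      · rw [indicator_of_notMem (by simp [h1.le]), charRight, if_neg h1.not_gt, if_neg h1.ne]
        simp
      · rw [hy.resolve_left (not_not.2 h1), indicator_of_notMem (by simp [h1])]
        simp
      · rw [indicator_of_mem (mem_Ioi.2 h1), charRight, if_pos h1, one_smul]
    have e3 : (((1 / 2 : ℂ) * (SignType.sign (y - x) : ℂ)) • J⁻¹) *ᵥ a y =
        ((1 / 2 : ℂ) • J⁻¹) *ᵥ ((Ioi x).indicator a y - (Iio x).indicator a y) := by
      rcases lt_trichotomy y x with h1 | h1 | h1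
      · rw [indicator_of_notMem (by simp [h1.le]), indicator_of_mem (mem_Iio.2 h1),
          sign_neg (sub_neg.2 h1), zero_sub, Matrix.mulVec_neg]
        simp [Matrix.neg_mulVec]
      · rw [indicator_of_notMem (by simp [h1]), indicator_of_notMem (by simp [h1]), h1]
        simp
      · rw [indicator_of_mem (mem_Ioi.2 h1), indicator_of_notMem (by simp [h1.le]),
          sign_pos (sub_pos.2 h1), sub_zero]
        simp
    have e4 : (if y = x then jumpTerm J r x₀ z x else 0) *ᵥ a y =
        jumpTerm J r x₀ z x *ᵥ ({x} : Set ℝ).indicator a y := by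
      by_cases h1 : y = x
      · rw [if_pos h1, indicator_of_mem (mem_singleton_iff.2 h1)]
      · rw [if_neg h1, indicator_of_notMem (mt mem_singleton_iff.1 h1)]
        simp
    rw [kernelH, Matrix.add_mulVec, Matrix.sub_mulVec, Matrix.add_mulVec, e1, e2, e3, e4]
  have hk : Integrable (fun y => kernelH J r x₀ z Mm Mp x y *ᵥ a y) r.μ :=
    (i123.add i4).congr (EventuallyEq.symm hpt)
  simp only [← Matrix.mulVec_mulVec]
  rw [integral_const_mulVec _ hk, integral_congr_ae hpt]
  congr 1
  rw [integral_add i123 i4, integral_sub i12 i3, integral_add i1 i2,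
    integral_const_mulVec _ (hi.indicator measurableSet_Iio),
    integral_const_mulVec _ (hi.indicator measurableSet_Ioi), integral_const_mulVec _ i3',
    integral_const_mulVec _ (hi.indicator (measurableSet_singleton x)),
    integral_sub (hi.indicator measurableSet_Ioi) (hi.indicator measurableSet_Iio),
    integral_indicator measurableSet_Iio, integral_indicator measurableSet_Ioi,
    integral_indicator measurableSet_Ioi, integral_indicator measurableSet_Iio,
    integral_indicator (measurableSet_singleton x), integral_singleton, Matrix.smul_mulVec,
    Complex.coe_smul]

end IsBasePoint

end OrderZero

namespace OrderZero

variable {Ω : Opens ℝ} {n : ℕ} {q w : DistMatrix Ω n} {J : Matrix (Fin n) (Fin n) ℂ}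
  {r : MeasureRep q w} {T : Submodule ℂ (r.L2 × r.L2)}

/-! ### The `M`-function -/

theorem resolventMap_mem {z : ℂ} (hz : z ∈ relResolventSet T) (f : r.L2) :
    (resolventMap T z f, z • resolventMap T z f + f) ∈ T := by
  have hex : ∃ u, (u, z • u + f) ∈ T := hz.2 f
  rw [resolventMap, dif_pos hex]
  exact hex.choose_spec

theorem toEuclideanCLM_symm_mulVec
    (L : EuclideanSpace ℂ (Fin n) →L[ℂ] EuclideanSpace ℂ (Fin n)) (v : Fin n → ℂ) :
    (Matrix.toEuclideanCLM (𝕜 := ℂ) (n := Fin n)).symm L *ᵥ v =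
      WithLp.ofLp (L (WithLp.toLp 2 v)) := by
  conv_rhs => rw [← (Matrix.toEuclideanCLM (𝕜 := ℂ) (n := Fin n)).apply_symm_apply L]
  rw [Matrix.ofLp_toEuclideanCLM]

theorem projMatrix_mulVec (x₀ : ℝ) (v : Fin n → ℂ) : projMatrix J r x₀ *ᵥ v =
    WithLp.ofLp ((nullValues J r x₀)ᗮ.starProjection (WithLp.toLp 2 v)) :=
  toEuclideanCLM_symm_mulVec _ v

namespace IsBasePoint

variable {x₀ : ℝ} (h : IsBasePoint J r x₀)
include h

/-- The chosen right-hand side is only a representative of the class of `z u + f`; the equation does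
not distinguish between representatives. -/
theorem resolventEval_solves (hT : (T : Set (r.L2 × r.L2)) ⊆ maximalRelation J r) {z : ℂ}
    (hz : z ∈ relResolventSet T) (f : r.FunL2) :
    PointSolves J r x₀ (resolventEval J r T x₀ z (MeasureRep.cls f))
      (z • resolventEval J r T x₀ z (MeasureRep.cls f) + f.fn) 0 := by
  obtain ⟨u, g, hu, hs, h1, h2, -⟩ := h.evalMap_spec (hT (resolventMap_mem hz (MeasureRep.cls f)))
  have h3 : MeasureRep.cls g = MeasureRep.cls (z • u + f) := by
    rw [← r.clsLinear_apply, ← r.clsLinear_apply, map_add, map_smul, r.clsLinear_apply,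
      r.clsLinear_apply, r.clsLinear_apply, h2, h1]
  have e : (z • u + f).fn = z • u.fn + f.fn := rfl
  have h4 := MeasureRep.ae_wd_eq_of_cls_eq h3
  rw [e] at h4
  rw [resolventEval, ← hu]
  exact hs.congr h4

/-- For `z ∉ Λ` a solution is determined by its value at `x₀` through variation of constants, whose
formula has the same dependence on `x` as Green's formula. So the latter needs to be checked at `x₀`
only. -/
theorem isGreenPair_iff (hT : (T : Set (r.L2 × r.L2)) ⊆ maximalRelation J r) {z : ℂ}
    (hz : z ∈ relResolventSet T \ exceptionalSet J r) {Mm Mp : Matrix (Fin n) (Fin n) ℂ} :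
    IsGreenPair J r T x₀ z Mm Mp ↔ ∀ f : r.FunL2, IsCompactlySupported Ω f.fn →
      resolventEval J r T x₀ z (MeasureRep.cls f) x₀ =
        Mm *ᵥ (∫ y in Iio x₀, adjDensity J r x₀ z f.fn y ∂r.μ) +
        Mp *ᵥ (∫ y in Ioi x₀, adjDensity J r x₀ z f.fn y ∂r.μ) -
        (1 / 2 : ℂ) • (J⁻¹ *ᵥ ((∫ y in Ioi x₀, adjDensity J r x₀ z f.fn y ∂r.μ) -
          ∫ y in Iio x₀, adjDensity J r x₀ z f.fn y ∂r.μ)) := by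
  constructor
  · intro hG f hf
    rw [hG f hf x₀ h.mem, h.integral_kernelH hz.2 hf, h.fundMatrix_base hz.2, Matrix.one_mulVec,
      Complex.coe_smul, h.real_smul_adjDensity, Matrix.mulVec_zero, add_zero]
  · intro hG f hf x hx
    rw [h.eq_fundMatrix_mulVec hz.2 hf (h.resolventEval_solves hT hz.1 f) hx,
      h.integral_kernelH hz.2 hf, hG f hf, sub_add_cancel]

theorem exists_indicator (f : r.FunL2) (hf : IsCompactlySupported Ω f.fn) {s : Set ℝ}
    (hs : MeasurableSet s) (z : ℂ) : ∃ g : r.FunL2, IsCompactlySupported Ω g.fn ∧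
      ∀ x, adjDensity J r x₀ z g.fn x = s.indicator (adjDensity J r x₀ z f.fn) x := by
  obtain ⟨K, hKΩ, hK, h0⟩ := hf
  let g : r.FunL2 := (⟨_, f.memL2.indicator hs⟩ : r.funSubmodule)
  refine ⟨g, ⟨K, hKΩ, hK, fun x hx => ?_⟩, fun x => ?_⟩
  · exact (indicator_apply_eq_zero (s := s) (f := f.fn)).2 fun _ => h0 x hx
  · by_cases hx : x ∈ s
    · have e : g.fn x = f.fn x := indicator_of_mem hx f.fn
      rw [indicator_of_mem hx, adjDensity, e, adjDensity]
    · have e : g.fn x = 0 := indicator_of_notMem hx f.fn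
      rw [indicator_of_notMem hx, adjDensity_eq_zero e]

/-- The two matrices of Green's function are determined on `B_+` and `B_-`. -/
theorem mulVec_eq_of_isGreenPair (hT : (T : Set (r.L2 × r.L2)) ⊆ maximalRelation J r) {z : ℂ}
    (hz : z ∈ relResolventSet T \ exceptionalSet J r) {Mm Mp Mm' Mp' : Matrix (Fin n) (Fin n) ℂ}
    (hG : IsGreenPair J r T x₀ z Mm Mp) (hG' : IsGreenPair J r T x₀ z Mm' Mp') :
    (∀ ζ ∈ BPlus J r x₀ z, Mp *ᵥ ζ = Mp' *ᵥ ζ) ∧ ∀ ζ ∈ BMinus J r x₀ z, Mm *ᵥ ζ = Mm' *ᵥ ζ := by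
  rw [h.isGreenPair_iff hT hz] at hG hG'
  have hdis : Disjoint (Ioi x₀) (Iio x₀) :=
    disjoint_left.2 fun y (h1 : x₀ < y) (h2 : y < x₀) => lt_asymm h1 h2
  constructor
  · rintro _ ⟨f, hf, rfl⟩
    -- Cutting `f` off to one side of `x₀` makes the other integral zero and isolates one of the two
    -- matrices.
    obtain ⟨g, hg, hgf⟩ := h.exists_indicator f hf measurableSet_Ioi z (s := Ioi x₀)
    have h1 := (hG g hg).symm.trans (hG' g hg)
    simp only [hgf] at h1
    rw [setIntegral_indicator measurableSet_Ioi, setIntegral_indicator measurableSet_Ioi,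
      inter_self, hdis.symm.inter_eq, setIntegral_empty, Matrix.mulVec_zero, Matrix.mulVec_zero,
      zero_add, zero_add, sub_left_inj] at h1
    exact h1
  · rintro _ ⟨f, hf, rfl⟩
    obtain ⟨g, hg, hgf⟩ := h.exists_indicator f hf measurableSet_Iio z (s := Iio x₀)
    have h1 := (hG g hg).symm.trans (hG' g hg)
    simp only [hgf] at h1
    rw [setIntegral_indicator measurableSet_Iio, setIntegral_indicator measurableSet_Iio,
      inter_self, hdis.inter_eq, setIntegral_empty, Matrix.mulVec_zero, Matrix.mulVec_zero,
      add_zero, add_zero, sub_left_inj] at h1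
    exact h1

/-- Two candidates agree on `B_+`, `B_-` and `N_0`. A vector orthogonal to the space where they
agree is orthogonal to all integrals of `U(·, z̄)^* w f`, hence lies in `N_0`, where they agree; so
it is zero. -/
theorem isMValue_unique (hT : (T : Set (r.L2 × r.L2)) ⊆ maximalRelation J r) {z : ℂ}
    (hz : z ∈ relResolventSet T \ exceptionalSet J r) {A B : Matrix (Fin n) (Fin n) ℂ}
    (hA : IsMValue J r T x₀ z A) (hB : IsMValue J r T x₀ z B) : A = B := by
  obtain ⟨Mm, Mp, hG, hp, hm, h0⟩ := hA
  obtain ⟨Mm', Mp', hG', hp', hm', h0'⟩ := hB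
  obtain ⟨e1, e2⟩ := h.mulVec_eq_of_isGreenPair hT hz hG hG'
  let K : Submodule ℂ (EuclideanSpace ℂ (Fin n)) :=
    LinearMap.eqLocus (Matrix.toEuclideanLin A) (Matrix.toEuclideanLin B)
  have hK : ∀ ζ : Fin n → ℂ, WithLp.toLp 2 ζ ∈ K ↔ A *ᵥ ζ = B *ᵥ ζ := fun ζ => by
    rw [LinearMap.mem_eqLocus, Matrix.toLpLin_toLp, Matrix.toLpLin_toLp]
    exact (WithLp.toLp_injective 2).eq_iff
  have hbot : Kᗮ = ⊥ := by
    rw [eq_bot_iff]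
    intro η hη
    have h1 : η ∈ nullValues J r x₀ := by
      refine h.mem_nullValues_of_forall hz.2 (η := WithLp.ofLp η) fun f hf => ?_
      rw [h.integral_adjDensity hz.2 f hf]
      have k1 := (hK (∫ y in Ioi x₀, adjDensity J r x₀ z f.fn y ∂r.μ)).2 (by
        rw [hp _ ⟨f, hf, rfl⟩, hp' _ ⟨f, hf, rfl⟩, ← Matrix.mulVec_mulVec, e1 _ ⟨f, hf, rfl⟩,
          Matrix.mulVec_mulVec])
      have k2 := (hK (∫ y in Iio x₀, adjDensity J r x₀ z f.fn y ∂r.μ)).2 (by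
        rw [hm _ ⟨f, hf, rfl⟩, hm' _ ⟨f, hf, rfl⟩, ← Matrix.mulVec_mulVec, e2 _ ⟨f, hf, rfl⟩,
          Matrix.mulVec_mulVec])
      have k3 := (Submodule.mem_orthogonal' _ _).1 hη _ (K.add_mem k1 k2)
      rw [inner_eq_star_dotProduct] at k3
      exact k3
    have h2 : η ∈ K := (hK (WithLp.ofLp η)).2 ((h0 _ h1).trans (h0' _ h1).symm)
    exact inner_self_eq_zero.1 ((Submodule.mem_orthogonal' _ _).1 hη η h2)
  have htop : K = ⊤ := (Submodule.orthogonal_eq_bot_iff).1 hbot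
  refine Matrix.ext_of_mulVec_single fun i => (hK _).1 ?_
  rw [htop]
  exact Submodule.mem_top

/-- A criterion for being the value of the `M`-function. -/
theorem isMValue_of_forall (hT : (T : Set (r.L2 × r.L2)) ⊆ maximalRelation J r) {z : ℂ}
    (hz : z ∈ relResolventSet T \ exceptionalSet J r) {A : Matrix (Fin n) (Fin n) ℂ}
    (hA : ∀ f : r.FunL2, IsCompactlySupported Ω f.fn →
      resolventEval J r T x₀ z (MeasureRep.cls f) x₀ =
        A *ᵥ ((∫ y in Ioi x₀, adjDensity J r x₀ z f.fn y ∂r.μ) +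
          ∫ y in Iio x₀, adjDensity J r x₀ z f.fn y ∂r.μ) +
        projMatrix J r x₀ *ᵥ ((1 / 2 : ℂ) • (J⁻¹ *ᵥ
          ((∫ y in Iio x₀, adjDensity J r x₀ z f.fn y ∂r.μ) -
            ∫ y in Ioi x₀, adjDensity J r x₀ z f.fn y ∂r.μ))))
    (hP : projMatrix J r x₀ * A = A)
    (h0 : ∀ ζ, WithLp.toLp 2 ζ ∈ nullValues J r x₀ → A *ᵥ ζ = 0) : IsMValue J r T x₀ z A := by
  have hPP : projMatrix J r x₀ * projMatrix J r x₀ = projMatrix J r x₀ := by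
    rw [projMatrix, ← map_mul]
    congr 1
    exact (Submodule.isIdempotentElem_starProjection _).eq
  have hPJ : projMatrix J r x₀ * ((1 / 2 : ℂ) • (J⁻¹ - projMatrix J r x₀ * J⁻¹)) = 0 := by
    rw [Matrix.mul_smul, Matrix.mul_sub, ← Matrix.mul_assoc, hPP, sub_self, smul_zero]
  -- The correction restores the part of `J⁻¹ / 2` that `P` removes in the hypothesis on `A`; it is
  -- itself annihilated by `P`, so `P M_± = P A = A`.
  refine ⟨A - (1 / 2 : ℂ) • (J⁻¹ - projMatrix J r x₀ * J⁻¹),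
    A + (1 / 2 : ℂ) • (J⁻¹ - projMatrix J r x₀ * J⁻¹), (h.isGreenPair_iff hT hz).2 fun f hf => ?_,
    fun ζ _ => ?_, fun ζ _ => ?_, h0⟩
  · rw [hA f hf]
    simp only [Matrix.add_mulVec, Matrix.sub_mulVec, Matrix.smul_mulVec, ← Matrix.mulVec_mulVec,
      Matrix.mulVec_add, Matrix.mulVec_sub, Matrix.mulVec_smul]
    module
  · rw [Matrix.mul_add, hP, hPJ, add_zero]
  · rw [Matrix.mul_sub, hP, hPJ, sub_zero]

/-- The Weyl map is built from boundary data that do not involve `z`. Points off `Λ` are only needed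
to recognize it as the `M`-function, by means of the special boundary data with `H = z Y + f`. -/
theorem exists_herglotz (hdisc : ExceptionalSetDiscrete J r)
    (hT : (T : Set (r.L2 × r.L2)) ⊆ maximalRelation J r) (hTsa : T.adjoint = T) :
    ∃ M : ℂ → Matrix (Fin n) (Fin n) ℂ,
      (∀ z ∈ relResolventSet T \ exceptionalSet J r, IsMValue J r T x₀ z (M z)) ∧
      (∀ z ∈ relResolventSet T, M z = (M (star z))ᴴ) ∧
      (∀ z : ℂ, z.im ≠ 0 → z ∈ relResolventSet T ∧
        ((2 * Complex.I * (z.im : ℂ))⁻¹ • (M z - (M z)ᴴ)).PosSemidef) ∧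
      ∀ i j, AnalyticOnNhd ℂ (fun z => M z i j) (relResolventSet T) := by
  have h0 : (0 : ℂ) ∉ exceptionalSet J r := by exact_mod_cast hdisc.not_real 0
  have heN : ∀ p ∈ T, WithLp.toLp 2 (evalMap J r x₀ p x₀) ∈ (nullValues J r x₀)ᗮ := by
    intro p hp
    obtain ⟨u, f, hu, -, -, -, h1⟩ := h.evalMap_spec (hT hp)
    rwa [← hu]
  obtain ⟨M, hM, hM0, hsymm, hpos, han⟩ := exists_weylMap h.boundarySolution h.boundaryRhs
    h.boundaryTerm h.boundaryValue hTsa (N := nullValues J r x₀)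
    (e := fun p => WithLp.toLp 2 (evalMap J r x₀ p x₀)) heN
    (fun p hp d => h.inner_sub_inner_evalMap (hT hp) d) (h.range_boundaryTerm h0)
    h.inner_sub_inner_boundary
  let A : ℂ → Matrix (Fin n) (Fin n) ℂ := fun z =>
    (Matrix.toEuclideanCLM (𝕜 := ℂ) (n := Fin n)).symm (LinearMap.toContinuousLinearMap (M z))
  have hAv : ∀ z v, A z *ᵥ v = WithLp.ofLp (M z (WithLp.toLp 2 v)) := fun z v =>
    toEuclideanCLM_symm_mulVec _ v
  have hAi : ∀ z v v', star v' ⬝ᵥ A z *ᵥ v =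
      inner ℂ (WithLp.toLp 2 v') (M z (WithLp.toLp 2 v)) := fun z v v' => by
    rw [hAv, inner_eq_star_dotProduct]
  have hAi' : ∀ z v v', star v' ⬝ᵥ (A z)ᴴ *ᵥ v =
      inner ℂ (M z (WithLp.toLp 2 v')) (WithLp.toLp 2 v) := fun z v v' => by
    rw [← star_mulVec_dotProduct, hAv, inner_eq_star_dotProduct]
  -- As `M` vanishes on `N_0` at `z̄`, symmetry puts the range of `M z` into `N_0^⊥`.
  have hrange : ∀ z ∈ relResolventSet T, ∀ v, M z v ∈ (nullValues J r x₀)ᗮ := by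
    intro z hz v
    rw [Submodule.mem_orthogonal]
    intro η hη
    rw [← hsymm z hz, hM0 _ (star_mem_relResSet hTsa hz) η hη, inner_zero_left]
  refine ⟨A, fun z hz => h.isMValue_of_forall hT hz (fun f hf => ?_) ?_ fun ζ hζ => ?_,
    fun z hz => ?_, fun z hz => ⟨mem_relResSet_of_im_ne_zero hTsa hz, ?_⟩, fun i j => ?_⟩
  · obtain ⟨p, hp, h1, h2, h3⟩ := h.exists_mem_boundaryData hz.2 f hf
    -- For this choice of boundary data `H - z Y` is `f` itself, so the element of `T` in the
    -- definition of the Weyl map is the one that defines `E_z f`.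
    have hcls : h.boundaryRhs ⟨p, hp⟩ - z • h.boundarySolution ⟨p, hp⟩ = MeasureRep.cls f := by
      have e : h.boundaryRhs ⟨p, hp⟩ = r.clsLinear p.2.1 := rfl
      have e' : h.boundarySolution ⟨p, hp⟩ = r.clsLinear p.1 := rfl
      rw [e, e', h1, map_add, map_smul, add_sub_cancel_left]
      rfl
    have h4 := hM z hz.1 ⟨p, hp⟩ (resolventMap T z (MeasureRep.cls f))
      (by rw [hcls]; exact resolventMap_mem hz.1 _)
    rw [hcls] at h4
    have e1 : h.boundaryTerm ⟨p, hp⟩ = p.2.2 := rfl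
    have e2 : h.boundaryValue ⟨p, hp⟩ = WithLp.toLp 2 (p.1.fn x₀) := rfl
    rw [e1, e2, h2, h3, eq_sub_iff_add_eq] at h4
    rw [hAv, projMatrix_mulVec]
    exact (congrArg WithLp.ofLp h4).symm
  · refine Matrix.ext_of_mulVec_single fun i => ?_
    rw [← Matrix.mulVec_mulVec, hAv, projMatrix_mulVec]
    exact congrArg WithLp.ofLp (Submodule.starProjection_eq_self_iff.2 (hrange z hz.1 _))
  · rw [hAv, hM0 z hz.1 _ hζ]
    rfl
  · refine Matrix.ext_of_mulVec_single fun i => eq_of_forall_star_dotProduct fun η => ?_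
    rw [hAi, hAi', hsymm z hz]
  · refine posSemidef_of_forall_nonneg fun v => ?_
    obtain ⟨c, hc, h1⟩ := hpos z (mem_relResSet_of_im_ne_zero hTsa hz) (WithLp.toLp 2 v)
    have h2 : z - star z = 2 * Complex.I * (z.im : ℂ) := by
      rw [Complex.star_def, Complex.sub_conj]
      push_cast
      ring
    have h3 : 2 * Complex.I * (z.im : ℂ) ≠ 0 := by simpa using hz
    rw [Matrix.smul_mulVec, dotProduct_smul, Matrix.sub_mulVec, dotProduct_sub, hAi, hAi', h1, h2,
      smul_eq_mul, inv_mul_cancel_left₀ h3]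
    exact_mod_cast hc
  · have e : (fun z => A z i j) = fun z => inner ℂ (WithLp.toLp 2 (Pi.single i 1 : Fin n → ℂ))
        (M z (WithLp.toLp 2 (Pi.single j 1 : Fin n → ℂ))) := by
      funext z
      rw [← hAi, ← Pi.single_star, star_one, single_dotProduct, one_mul, Matrix.mulVec_single_one,
        Matrix.col_apply]
    rw [e]
    exact han _ _

end IsBasePoint

end OrderZero

theorem lemmaT {n : ℕ} {a b : EReal} (J : Matrix (Fin n) (Fin n) ℂ)
    (q w : DistMatrix (openInterval a b) n) (r : MeasureRep q w)
    (hcoeff : Coefficients J r) (hdisc : ExceptionalSetDiscrete J r)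
    (T : Submodule ℂ (r.L2 × r.L2)) (hT : (T : Set (r.L2 × r.L2)) ⊆ maximalRelation J r)
    (hTsa : T.adjoint = T)
    (x₀ : ℝ) (hx₀ : x₀ ∈ openInterval a b) (hq : jumpQ r x₀ = 0) (hw : jumpW r x₀ = 0) :
    (∀ z ∈ relResolventSet T \ exceptionalSet J r, ∃! A, IsMValue J r T x₀ z A) ∧
    ∃ M : ℂ → Matrix (Fin n) (Fin n) ℂ,
      (∀ z ∈ relResolventSet T \ exceptionalSet J r, IsMValue J r T x₀ z (M z)) ∧
      (∀ z ∈ relResolventSet T, M z = (M (star z))ᴴ) ∧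
      (∀ z : ℂ, z.im ≠ 0 → z ∈ relResolventSet T ∧
        ((2 * Complex.I * (z.im : ℂ))⁻¹ • (M z - (M z)ᴴ)).PosSemidef) ∧
      ∀ i j, AnalyticOnNhd ℂ (fun z => M z i j) (relResolventSet T) := by
  have hconn : (openInterval a b : Set ℝ).OrdConnected :=
    ⟨fun _ hc _ hd _ hx => ⟨hc.1.trans_le (EReal.coe_le_coe_iff.2 hx.1),
      (EReal.coe_le_coe_iff.2 hx.2).trans_lt hd.2⟩⟩
  have h : IsBasePoint J r x₀ := ⟨hcoeff, hconn, hx₀, hq, hw⟩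
  obtain ⟨M, hM⟩ := h.exists_herglotz hdisc hT hTsa
  exact ⟨fun z hz => ⟨M z, hM.1 z hz, fun B hB => h.isMValue_unique hT hz hB (hM.1 z hz)⟩, M, hM⟩
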